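/- **Setting.** A formal hypersurface $M$ through $0$ in $\mathbb C^2$ is given by an equation $\operatorname{Im} w=\varphi(z,\bar z,\operatorname{Re} w)$, where $\varphi(z,\bar z,u)=\sum\varphi_{abc}z^a\bar z^bu^c$ is a formal power series with $\varphi(0)=0$ that is Hermitian, $\varphi_{bac}=\overline{\varphi_{abc}}$. A formal transformation is a pair $(F,G)$ of power series in $(z,w)$ with complex coefficients and $F(0)=G(0)=0$; it is invertible if its Jacobian determinant at $0$ is nonzero. It sends $M$ to the formal hypersurface $M'$ with series $\varphi'$ if $$\operatorname{Im} G(z,u+i\varphi)=\varphi'\big(F(z,u+i\varphi),\overline{F(z,u+i\varphi)},\operatorname{Re} G(z,u+i\varphi)\big),\qquad \varphi=\varphi(z,\bar z,u).$$ If it is invertible, we also say that it is a change of formal coordinates in which $M$ is given by $\varphi'$. Let ${\sf Aut}_0(M)$ be the set of invertible formal transformations that send $M$ to $M$. Consider the following conditions. * (1') $M$ is of infinite type at $0$: there is a nonconstant formal holomorphic curve $\Gamma=(\Gamma_1,\Gamma_2)$, $\Gamma(0)=0$, contained in $M$, i.e. $\operatorname{Im}\Gamma_2(t)=\varphi(\Gamma_1(t),\overline{\Gamma_1(t)},\operatorname{Re}\Gamma_2(t))$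 as power series in $t,\bar t$. * (2') There is a formal real curve $\gamma$ in $M$ with $\gamma(0)=0$ such that the Levi form $\mathcal L$ of $M$ satisfies $(\mathcal L\circ\gamma)'(0)\ne0$. Here $\mathcal L=\rho_{z\bar z}|\rho_w|^2-2\operatorname{Re}(\rho_{z\bar w}\rho_w\rho_{\bar z})+\rho_{w\bar w}|\rho_z|^2$ with $\rho=\varphi(z,\bar z,\operatorname{Re}w)-\operatorname{Im}w$. * (3) $M$ is nonresonant: in every formal coordinate system in which $M$ is prenormalized, the characteristic polynomial $P$ of its graphing series has no integral root $k\ge2$. *Prenormalized* means that the graphing series, again denoted by $\varphi$, satisfies $\varphi(z,\bar z,0)=\varphi(z,0,u)=\varphi(0,\bar z,u)=0$, $\varphi_{111}=\pm1$, $\varphi_{l11}=0$ for $l\ge2$, and $\varphi_{l1k}=0$ for $l\ge3$, $k\ge2$. For such a series put $\varphi_{ab}=\varphi_{ab1}$, $\varepsilon=\varphi_{11}\in\{1,-1\}$, and write $\varphi_{ab}=r_{ab}+is_{ab}$ with $r_{ab},s_{ab}$ real (so $s_{22}=s_{33}=0$), and $$T=\varepsilon(2k^2-4k+3+4r_{22}^2)-3r_{33}.$$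 The *characteristic polynomial* is $P(k)=c\det B$, where the constant $c$ is chosen such that $P$ is monic in $k$, and $$B=\begin{pmatrix}-6r_{32}&6s_{32}&-2r_{22}&2(k-1)\\ T-4r_{42}&2\varepsilon(k-1)r_{22}+4s_{42}&-3r_{32}&s_{32}\\ 2\varepsilon(k-1)r_{22}-4s_{42}&-T-4r_{42}&-3s_{32}&-r_{32}\\ \varepsilon(8r_{22}r_{32}+2(k-1)s_{32})-8r_{43}&\varepsilon(-8r_{22}s_{32}+2(k-1)r_{32})+8s_{43}&\tfrac23\varepsilon(k^2-2k+3)-4r_{33}&6\varepsilon(k-1)r_{22}\end{pmatrix}.$$ **Corollary 1.2.** Let $M$ be a formal hypersurface through $0$ in $\mathbb C^2$ satisfying (1'), (2') and (3). Then ${\sf Aut}_0(M)$ is a group under composition, and it embeds as a subgroup of $S^1\times\mathbb R^*$ via $(F,G)\mapsto(F_z(0),G_w(0))$ in coordinates adapted to $M$. Precisely, there are formal coordinates in which the graphing series $\varphi'$ of $M$ satisfies $d\varphi'(0)=0$, and there is an injective group homomorphism ${\sf Aut}_0(M)\to S^1\times\mathbb R^*$ which in every such coordinate system is given by $(F,G)\mapsto(F_z(0),G_w(0))$,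 where $(F,G)$ is the automorphism expressed in these coordinates. In particular, any two elements of ${\sf Aut}_0(M)$ with the same $1$-jet at $0$ are equal. -/

import Mathlib

namespace FormalCR

open MvPowerSeries

/-! ### Formal real hypersurfaces in `ℂ²`

A power series `φ(z, z̄, u)` is an element of `ℂ⟦z, χ, u⟧`, where the variable `X 0` is `z`, the
variable `X 1` is `χ` (standing for `z̄`) and the variable `X 2` is `u`. A formal holomorphic
function of `(z, w)` is an element of `ℂ⟦z, w⟧`, with `X 0 = z` and `X 1 = w`. -/

/-- Formal complex conjugation of a series in `(z, z̄, u)`, with `u` real: the coefficients are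
conjugated and `z`, `z̄` are interchanged. -/
noncomputable def conj (f : MvPowerSeries (Fin 3) ℂ) : MvPowerSeries (Fin 3) ℂ :=
  MvPowerSeries.map (starRingEnd ℂ) (subst ![(X 1 : MvPowerSeries (Fin 3) ℂ), X 0, X 2] f)

/-- The real part `(f + f̄) / 2`. -/
noncomputable def rePart (f : MvPowerSeries (Fin 3) ℂ) : MvPowerSeries (Fin 3) ℂ :=
  C (1 / 2 : ℂ) * (f + conj f)

/-- The imaginary part `(f - f̄) / (2i)`. -/
noncomputable def imPart (f : MvPowerSeries (Fin 3) ℂ) : MvPowerSeries (Fin 3) ℂ :=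
  C (1 / (2 * Complex.I) : ℂ) * (f - conj f)

/-- The coefficient of `z ^ a * z̄ ^ b * u ^ c`. -/
noncomputable def coeff₃ (a b c : ℕ) (φ : MvPowerSeries (Fin 3) ℂ) : ℂ :=
  coeff (Finsupp.single 0 a + Finsupp.single 1 b + Finsupp.single 2 c) φ

/-- `φ` is the graphing series of a formal real hypersurface `Im w = φ(z, z̄, Re w)` through `0`:
it vanishes at `0` and is Hermitian (real-valued). -/
structure IsHypersurface (φ : MvPowerSeries (Fin 3) ℂ) : Prop where
  zero : constantCoeff φ = 0
  hermitian : conj φ = φ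

/-- `dφ(0) = 0`, i.e. the tangent space of the hypersurface at `0` is `Im w = 0`. -/
def IsTangential (φ : MvPowerSeries (Fin 3) ℂ) : Prop :=
  coeff₃ 1 0 0 φ = 0 ∧ coeff₃ 0 1 0 φ = 0 ∧ coeff₃ 0 0 1 φ = 0

/-! ### Formal transformations -/

/-- A formal holomorphic map `(z, w) ↦ (F(z, w), G(z, w))` sending `0` to `0`. -/
@[ext]
structure FormalMap where
  F : MvPowerSeries (Fin 2) ℂ
  G : MvPowerSeries (Fin 2) ℂ
  F_zero : constantCoeff F = 0
  G_zero : constantCoeff G = 0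

namespace FormalMap

theorem constantCoeff_subst_pair (Ψ : FormalMap) (f : MvPowerSeries (Fin 2) ℂ)
    (hf : constantCoeff f = 0) : constantCoeff (subst ![Ψ.F, Ψ.G] f) = 0 := by
  have h : ∀ i, constantCoeff ((![Ψ.F, Ψ.G] : Fin 2 → MvPowerSeries (Fin 2) ℂ) i) = 0 := by
    intro i
    fin_cases i
    · exact Ψ.F_zero
    · exact Ψ.G_zero
  exact constantCoeff_subst_eq_zero (hasSubst_of_constantCoeff_zero h) h hf

/-- The identity `(z, w) ↦ (z, w)`. -/
noncomputable def id : FormalMap where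
  F := X 0
  G := X 1
  F_zero := by simp
  G_zero := by simp

/-- Composition: `Φ.comp Ψ` is `(z, w) ↦ Φ(Ψ(z, w))`. -/
noncomputable def comp (Φ Ψ : FormalMap) : FormalMap where
  F := subst ![Ψ.F, Ψ.G] Φ.F
  G := subst ![Ψ.F, Ψ.G] Φ.G
  F_zero := constantCoeff_subst_pair Ψ Φ.F Φ.F_zero
  G_zero := constantCoeff_subst_pair Ψ Φ.G Φ.G_zero

/-- The Jacobian matrix at `0`, i.e. the 1-jet at `0`: the rows are `(F_z(0), F_w(0))` and
`(G_z(0), G_w(0))`. -/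
noncomputable def jacobian (Φ : FormalMap) : Matrix (Fin 2) (Fin 2) ℂ :=
  !![coeff (Finsupp.single 0 1) Φ.F, coeff (Finsupp.single 1 1) Φ.F;
     coeff (Finsupp.single 0 1) Φ.G, coeff (Finsupp.single 1 1) Φ.G]

/-- A formal map is invertible if its Jacobian determinant at `0` is not zero. -/
def Invertible (Φ : FormalMap) : Prop := Φ.jacobian.det ≠ 0

/-- The restriction `f(z, u + iφ(z, z̄, u))` of a holomorphic `f(z, w)` to the hypersurface with
graphing series `φ`, parametrized by `(z, u)`. -/
noncomputable def restrict (φ : MvPowerSeries (Fin 3) ℂ) (f : MvPowerSeries (Fin 2) ℂ) :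
    MvPowerSeries (Fin 3) ℂ :=
  subst ![(X 0 : MvPowerSeries (Fin 3) ℂ), X 2 + C Complex.I * φ] f

/-- `Φ = (F, G)` sends the hypersurface of `φ` into that of `φ'`: on the former,
`Im G = φ'(F, F̄, Re G)`. -/
def Sends (Φ : FormalMap) (φ φ' : MvPowerSeries (Fin 3) ℂ) : Prop :=
  imPart (restrict φ Φ.G) =
    subst ![restrict φ Φ.F, conj (restrict φ Φ.F), rePart (restrict φ Φ.G)] φ'

end FormalMap

/-- `H` is a change of formal holomorphic coordinates at `0` in which the hypersurface of `φ`
becomes the hypersurface of `φ'`. -/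
def IsCoordinateChange (H : FormalMap) (φ φ' : MvPowerSeries (Fin 3) ℂ) : Prop :=
  H.Invertible ∧ IsHypersurface φ' ∧ H.Sends φ φ'

/-- The stability group `Aut₀(M)` of the hypersurface of `φ`: the invertible formal
transformations that preserve it. -/
def Aut₀ (φ : MvPowerSeries (Fin 3) ℂ) : Set FormalMap :=
  {Φ | Φ.Invertible ∧ Φ.Sends φ φ}

/-! ### Infinite type, and first order vanishing of the Levi form -/

/-- The hypersurface of `φ` is of infinite type at `0`: it contains a (nonconstant) formal
holomorphic curve `t ↦ (Γ₁(t), Γ₂(t))` through `0`. The identity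
`Im Γ₂ = φ(Γ₁, Γ̄₁, Re Γ₂)` is one of power series in `t` and `t̄`, the variables `X 0` and `X 1`
below. -/
def IsInfiniteType (φ : MvPowerSeries (Fin 3) ℂ) : Prop :=
  ∃ Γ₁ Γ₂ : PowerSeries ℂ,
    PowerSeries.constantCoeff Γ₁ = 0 ∧ PowerSeries.constantCoeff Γ₂ = 0 ∧
    (Γ₁ ≠ 0 ∨ Γ₂ ≠ 0) ∧
    let hol : PowerSeries ℂ → MvPowerSeries (Fin 2) ℂ := fun Γ =>
      PowerSeries.subst (X 0 : MvPowerSeries (Fin 2) ℂ) Γ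
    let antihol : PowerSeries ℂ → MvPowerSeries (Fin 2) ℂ := fun Γ =>
      PowerSeries.subst (X 1 : MvPowerSeries (Fin 2) ℂ) (PowerSeries.map (starRingEnd ℂ) Γ)
    C (1 / (2 * Complex.I) : ℂ) * (hol Γ₂ - antihol Γ₂) =
      subst ![hol Γ₁, antihol Γ₁, C (1 / 2 : ℂ) * (hol Γ₂ + antihol Γ₂)] φ

/-- The Levi form of the hypersurface of `φ`, as a series in the coordinates `(z, z̄, u)` of the
hypersurface. With `ρ = φ(z, z̄, Re w) - Im w` it is
`ρ_{z z̄} |ρ_w|² - ρ_{z w̄} ρ_w ρ_{z̄} - ρ_{w z̄} ρ_z ρ_{w̄} + ρ_{w w̄} |ρ_z|²`, the complex Hessian of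
`ρ` on the vector field `ρ_w ∂_z - ρ_z ∂_w`, which spans the `(1,0)` tangent vectors; here
`ρ_w = (φ_u + i) / 2`. -/
noncomputable def leviForm (φ : MvPowerSeries (Fin 3) ℂ) : MvPowerSeries (Fin 3) ℂ :=
  let φz := pderiv ℂ 0 φ
  let φzb := pderiv ℂ 1 φ
  let φu := pderiv ℂ 2 φ
  let ρw := C (1 / 2 : ℂ) * (φu + C Complex.I)
  let ρwb := C (1 / 2 : ℂ) * (φu - C Complex.I)
  pderiv ℂ 1 φz * (ρw * ρwb)
    - C (1 / 2 : ℂ) * pderiv ℂ 2 φz * ρw * φzb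
    - C (1 / 2 : ℂ) * pderiv ℂ 2 φzb * φz * ρwb
    + C (1 / 4 : ℂ) * pderiv ℂ 2 φu * (φz * φzb)

/-- There is a formal real curve `γ(t) = (z(t), u(t) + iφ(z(t), z̄(t), u(t)))` in the hypersurface,
`γ(0) = 0`, along which the Levi form `𝓛` satisfies `(𝓛 ∘ γ)'(0) ≠ 0`. -/
def LeviVanishesToFirstOrder (φ : MvPowerSeries (Fin 3) ℂ) : Prop :=
  ∃ (z : PowerSeries ℂ) (u : PowerSeries ℝ),
    PowerSeries.constantCoeff z = 0 ∧ PowerSeries.constantCoeff u = 0 ∧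
    PowerSeries.coeff 1 (show PowerSeries ℂ from
      subst ![z, PowerSeries.map (starRingEnd ℂ) z, PowerSeries.map Complex.ofRealHom u]
        (leviForm φ)) ≠ 0

/-! ### The characteristic polynomial and resonances -/

/-- The prenormalization of the graphing series, where `φ_{abc}` is the coefficient of
`z ^ a * z̄ ^ b * u ^ c`: `φ(z, z̄, 0) = 0`, `φ(z, 0, u) = φ(0, z̄, u) = 0`, `φ_{111} = ± 1`,
`φ_{l11} = 0` for `l ≥ 2`, and `φ_{l1k} = 0` for `l ≥ 3`, `k ≥ 2`. -/
structure IsPrenormalized (φ : MvPowerSeries (Fin 3) ℂ) : Prop where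
  infinite_type : ∀ a b, coeff₃ a b 0 φ = 0
  left : ∀ a c, coeff₃ a 0 c φ = 0
  right : ∀ b c, coeff₃ 0 b c φ = 0
  levi : coeff₃ 1 1 1 φ = 1 ∨ coeff₃ 1 1 1 φ = -1
  first : ∀ l, 2 ≤ l → coeff₃ l 1 1 φ = 0
  higher : ∀ l k, 3 ≤ l → 2 ≤ k → coeff₃ l 1 k φ = 0

open Polynomial in
/-- The matrix `B`, with entries in `ℝ[k]` (the variable `k` is `Polynomial.X`), built from the
coefficients `φ_{ab}` of `z ^ a * z̄ ^ b * u`; here `ε = φ_{11}`, and `φ_{22}`, `φ_{33}` are real. -/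
noncomputable def resonanceMatrix (φ : MvPowerSeries (Fin 3) ℂ) : Matrix (Fin 4) (Fin 4) ℝ[X] :=
  let k : ℝ[X] := Polynomial.X
  let re (a b : ℕ) : ℝ[X] := Polynomial.C (coeff₃ a b 1 φ).re
  let im (a b : ℕ) : ℝ[X] := Polynomial.C (coeff₃ a b 1 φ).im
  let ε := re 1 1
  let T := ε * (2 * k ^ 2 - 4 * k + 3 + 4 * re 2 2 ^ 2) - 3 * re 3 3
  !![-6 * re 3 2, 6 * im 3 2, -2 * re 2 2, 2 * (k - 1);
     T - 4 * re 4 2, 2 * ε * (k - 1) * re 2 2 + 4 * im 4 2, -3 * re 3 2, im 3 2;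
     2 * ε * (k - 1) * re 2 2 - 4 * im 4 2, -T - 4 * re 4 2, -3 * im 3 2, -re 3 2;
     ε * (8 * re 2 2 * re 3 2 + 2 * (k - 1) * im 3 2) - 8 * re 4 3,
       ε * (-8 * re 2 2 * im 3 2 + 2 * (k - 1) * re 3 2) + 8 * im 4 3,
       Polynomial.C (2 / 3 : ℝ) * ε * (k ^ 2 - 2 * k + 3) - 4 * re 3 3,
       6 * ε * (k - 1) * re 2 2]

/-- The characteristic polynomial of a prenormalized hypersurface: `c * det B`, with the constant
`c` that makes it monic in `k`. -/
noncomputable def characteristicPolynomial (φ : MvPowerSeries (Fin 3) ℂ) : Polynomial ℝ :=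
  Polynomial.C ((resonanceMatrix φ).det.leadingCoeff)⁻¹ * (resonanceMatrix φ).det

/-- An integer `k ≥ 2` is a resonance if it is a root of the characteristic polynomial in a
prenormalized coordinate system. -/
def IsResonance (φ : MvPowerSeries (Fin 3) ℂ) (k : ℤ) : Prop :=
  2 ≤ k ∧ ∃ (H : FormalMap) (φ' : MvPowerSeries (Fin 3) ℂ),
    IsCoordinateChange H φ φ' ∧ IsPrenormalized φ' ∧
      (characteristicPolynomial φ').IsRoot (k : ℝ)

/-- There are no resonances. -/
def IsNonresonant (φ : MvPowerSeries (Fin 3) ℂ) : Prop := ∀ k : ℤ, ¬ IsResonance φ k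

end FormalCR

/-! The plan is to straighten `M` so that it contains the complex line `w = 0`, and then to
determine an automorphism order by order along this line.

Normal form. Every `M` has coordinates in which `φ(z, 0, u) = 0` (`exists_normal_coordinates`). In
them a holomorphic curve inside `M` must lie in `w = 0`, so that `φ = u p`
(`IsInfiniteType.coeff₃_eq_zero`). If `φ₁₁₁` vanished, the Levi form would have order at least two.
This order is a coordinate invariant, because up to a unit the Levi form is the commutator of the CR
vector fields (`crBracket_eq`, `crBracket_mul`), so condition (2') gives `φ₁₁₁ ≠ 0`. Taking a real
multiple of the coefficient of `z̄` in `p` as the new `z` then prenormalizes `M`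
(`exists_prenormalized_of_normal`).

Linear part. In prenormalized coordinates the equation on `u = 0` forces `F(z, 0) = λ z` with `|λ| =
1` and `G = w g` with `g(z, 0) = m` real and nonzero (`IsPrenormalized.linear_part`).

Uniqueness. Suppose `λ = m = 1`, `F = z + w ^ n f` and `G = w + w ^ (n + 1) g` with `n ≥ 1`. On `M`
one has `w = u (1 + i p)`, and the terms of order `n` in `u` give, on `u = 0`, `(1 + p²) Im((1 + i
p) ^ n g) = 2 Re(p_z (1 + i p) ^ n f)` (`Sends.linearized`). The terms without `z̄` express `g(z,
0)` through `g(0)` and `f(0)`. The coefficients of `z z̄`, `z² z̄`, `z² z̄²`, `z³ z̄²`, `z³ z̄³`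
then reduce to four real linear equations for `f(0)` and `f_z(0)`, whose matrix is `B` at `k = n +
1`. Without resonances these numbers vanish, hence so do `f` and `g` on `w = 0`, and `n` can be
raised by one (`X1_dvd_of_linearized`). So the automorphism is the identity
(`IsPrenormalized.eq_id`).

Group. If `dφ = 0` at the origin, the Jacobians of automorphisms are upper triangular, and so are
those of changes between such coordinates. The diagonal is therefore multiplicative and invariant
under conjugation. It defines the homomorphism, which is injective by uniqueness. -/

namespace FormalCR

open MvPowerSeries

/-! ### Congruences of power series -/

section Congruence

variable {σ τ : Type*} {R : Type*} [CommRing R]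

/-- The ideal of the power series whose coefficients vanish on a lower set of exponents. -/
def vanishIdeal (S : LowerSet (σ →₀ ℕ)) : Ideal (MvPowerSeries σ R) where
  carrier := {f | ∀ d ∈ S, coeff d f = 0}
  zero_mem' := fun d _ => by simp
  add_mem' := fun {f g} hf hg d hd => by rw [map_add, hf d hd, hg d hd, add_zero]
  smul_mem' := fun c f hf d hd => by
    classical
    rw [smul_eq_mul, coeff_mul]
    refine Finset.sum_eq_zero fun p hp => ?_
    have : p.2 ≤ d := by
      rw [← Finset.HasAntidiagonal.mem_antidiagonal.mp hp]
      exact le_add_self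
    rw [hf _ (S.lower this hd), mul_zero]

theorem mem_vanishIdeal {S : LowerSet (σ →₀ ℕ)} {f : MvPowerSeries σ R} :
    f ∈ vanishIdeal S ↔ ∀ d ∈ S, coeff d f = 0 := Iff.rfl

theorem mk_vanishIdeal_eq_iff {S : LowerSet (σ →₀ ℕ)} {f g : MvPowerSeries σ R} :
    Ideal.Quotient.mk (vanishIdeal S) f = Ideal.Quotient.mk (vanishIdeal S) g ↔
      ∀ d ∈ S, coeff d f = coeff d g := by
  rw [Ideal.Quotient.eq, mem_vanishIdeal]
  simp only [map_sub, sub_eq_zero]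

/-- The exponents of total degree less than `N`. -/
def degreeLT (σ : Type*) (N : ℕ) : LowerSet (σ →₀ ℕ) where
  carrier := {d | d.degree < N}
  lower' := fun _ _ hba ha => lt_of_le_of_lt (Finsupp.degree_mono hba) ha

theorem mem_degreeLT {N : ℕ} {d : σ →₀ ℕ} : d ∈ degreeLT σ N ↔ d.degree < N := Iff.rfl

theorem mem_vanishIdeal_degreeLT {N : ℕ} {f : MvPowerSeries σ R} :
    f ∈ vanishIdeal (degreeLT σ N) ↔ (N : ℕ∞) ≤ f.order :=
  ⟨fun h => nat_le_order fun _ hd => h _ hd,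
    fun h _ hd => coeff_of_lt_order ((Nat.cast_lt.mpr hd).trans_le h)⟩

theorem mul_mem_vanishIdeal_degreeLT {M N : ℕ} {f g : MvPowerSeries σ R}
    (hf : f ∈ vanishIdeal (degreeLT σ M)) (hg : g ∈ vanishIdeal (degreeLT σ N)) :
    f * g ∈ vanishIdeal (degreeLT σ (M + N)) := by
  rw [mem_vanishIdeal_degreeLT] at *
  push_cast
  exact (add_le_add hf hg).trans le_order_mul

theorem mem_vanishIdeal_degreeLT_one {f : MvPowerSeries σ R} :
    f ∈ vanishIdeal (degreeLT σ 1) ↔ constantCoeff f = 0 := by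
  rw [mem_vanishIdeal_degreeLT, Nat.cast_one, one_le_order_iff_constCoeff_eq_zero]

/-- The exponents `d` with `d i < N`. -/
def indexLT (i : σ) (N : ℕ) : LowerSet (σ →₀ ℕ) where
  carrier := {d | d i < N}
  lower' := fun _ _ hba ha => lt_of_le_of_lt (hba i) ha

theorem mem_vanishIdeal_indexLT {i : σ} {N : ℕ} {f : MvPowerSeries σ R} :
    f ∈ vanishIdeal (indexLT i N) ↔ X i ^ N ∣ f := X_pow_dvd_iff.symm

theorem hasSubst [Finite σ] {a : σ → MvPowerSeries τ R} (ha : ∀ i, constantCoeff (a i) = 0) :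
    HasSubst a := hasSubst_of_constantCoeff_zero ha

theorem subst_zero_series (a : σ → MvPowerSeries τ R) :
    subst a (0 : MvPowerSeries σ R) = 0 := by
  simpa using subst_C (a := a) (0 : R)

theorem subst_one_series (a : σ → MvPowerSeries τ R) :
    subst a (1 : MvPowerSeries σ R) = 1 := by
  simpa using subst_C (a := a) (1 : R)

theorem subst_mem_vanishIdeal_degreeLT [Finite σ] {a : σ → MvPowerSeries τ R}
    (ha : ∀ i, constantCoeff (a i) = 0) {N : ℕ} {f : MvPowerSeries σ R}
    (hf : f ∈ vanishIdeal (degreeLT σ N)) : subst a f ∈ vanishIdeal (degreeLT τ N) := by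
  rw [mem_vanishIdeal_degreeLT] at *
  refine le_trans ?_ (le_order_subst (hasSubst ha) f)
  refine hf.trans (le_mul_of_one_le_left' ?_)
  exact le_iInf fun i => one_le_order_iff_constCoeff_eq_zero.mpr (ha i)

theorem pderiv_mem_vanishIdeal_degreeLT {N : ℕ} {f : MvPowerSeries σ R} (i : σ)
    (hf : f ∈ vanishIdeal (degreeLT σ (N + 1))) :
    pderiv R i f ∈ vanishIdeal (degreeLT σ N) := by
  intro d hd
  rw [coeff_pderiv, hf, zero_mul]
  rw [mem_degreeLT, map_add, Finsupp.degree_single]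
  exact Nat.add_lt_add_right hd 1

/-- A linear functional that only depends on finitely many degrees vanishes if it vanishes on
polynomials. -/
theorem eq_zero_of_polynomial [Finite σ] (T : MvPowerSeries σ R →+ R) (N : ℕ)
    (hN : ∀ f ∈ vanishIdeal (degreeLT σ N), T f = 0)
    (hp : ∀ p : MvPolynomial σ R, T p = 0) (f : MvPowerSeries σ R) : T f = 0 := by
  have : f = (f - (truncTotal N f : MvPolynomial σ R)) + (truncTotal N f : MvPolynomial σ R) := by
    ring
  rw [this, map_add, hp, add_zero]
  refine hN _ fun d hd => ?_
  rw [map_sub, MvPolynomial.coeff_coe, coeff_truncTotal _ hd, sub_self]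

/-- The chain rule. -/
theorem pderiv_subst [Fintype σ] {a : σ → MvPowerSeries τ R}
    (ha : ∀ i, constantCoeff (a i) = 0) (j : τ) (f : MvPowerSeries σ R) :
    pderiv R j (subst a f) = ∑ i, subst a (pderiv R i f) * pderiv R j (a i) := by
  classical
  have hs := hasSubst ha
  ext e
  rw [← sub_eq_zero, ← map_sub]
  let T : MvPowerSeries σ R →+ R :=
    AddMonoidHom.mk' (fun f => coeff e (pderiv R j (subst a f) -
      ∑ i, subst a (pderiv R i f) * pderiv R j (a i))) (by
        intro f g
        rw [← map_add]
        congr 1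
        simp only [subst_add hs, map_add, add_mul, Finset.sum_add_distrib]
        ring)
  -- The coefficient at `e` sees degrees up to `e.degree`, and a derivative lowers the order by one,
  -- so order `e.degree + 2` of `f` suffices for every term to vanish.
  refine eq_zero_of_polynomial T (e.degree + 2) ?_ ?_ f
  · intro f hf
    have : pderiv R j (subst a f) - ∑ i, subst a (pderiv R i f) * pderiv R j (a i) ∈
        vanishIdeal (degreeLT τ (e.degree + 1)) := by
      refine Ideal.sub_mem _ ?_ (Ideal.sum_mem _ fun i _ => Ideal.mul_mem_right _ _ ?_)
      · exact pderiv_mem_vanishIdeal_degreeLT _ (subst_mem_vanishIdeal_degreeLT ha hf)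
      · exact subst_mem_vanishIdeal_degreeLT ha (pderiv_mem_vanishIdeal_degreeLT _ hf)
    exact this e (Nat.lt_succ_self _)
  · intro p
    have : pderiv R j (subst a (p : MvPowerSeries σ R)) =
        ∑ i, subst a (pderiv R i (p : MvPowerSeries σ R)) * pderiv R j (a i) := by
      induction p using MvPolynomial.induction_on with
      | C c => simp [MvPolynomial.coe_C, subst_zero_series]
      | add p q hp hq =>
        simp only [MvPolynomial.coe_add, subst_add hs, map_add, hp, hq, add_mul,
          Finset.sum_add_distrib]
      | mul_X p k hp =>
        rw [MvPolynomial.coe_mul, MvPolynomial.coe_X, subst_mul hs, subst_X hs,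
          Derivation.leibniz, hp]
        simp only [Derivation.leibniz, subst_add hs, smul_eq_mul, subst_mul hs, subst_X hs,
          add_mul, Finset.sum_add_distrib]
        congr 1
        · rw [Finset.sum_eq_single k]
          · simp [subst_one_series]
          · intro i _ hi
            rw [pderiv_X_of_ne (Ne.symm hi), subst_zero_series]
            ring
          · simp
        · rw [Finset.mul_sum]
          exact Finset.sum_congr rfl fun i _ => by ring
    change coeff e (pderiv R j (subst a (p : MvPowerSeries σ R)) -
      ∑ i, subst a (pderiv R i (p : MvPowerSeries σ R)) * pderiv R j (a i)) = 0
    rw [this, sub_self, map_zero]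

/-- Taylor expansion to first order. -/
theorem mk_subst_add [Fintype σ] {a δ : σ → MvPowerSeries τ R}
    (ha : ∀ i, constantCoeff (a i) = 0) (hδ : ∀ i, constantCoeff (δ i) = 0)
    {S : LowerSet (τ →₀ ℕ)} (hS : ∀ i j, δ i * δ j ∈ vanishIdeal S) (f : MvPowerSeries σ R) :
    Ideal.Quotient.mk (vanishIdeal S) (subst (a + δ) f) =
      Ideal.Quotient.mk (vanishIdeal S) (subst a f + ∑ i, subst a (pderiv R i f) * δ i) := by
  classical
  have hs := hasSubst ha
  have had : ∀ i, constantCoeff ((a + δ) i) = 0 := fun i => by simp [ha, hδ]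
  have hs' := hasSubst had
  rw [mk_vanishIdeal_eq_iff]
  intro e he
  rw [← sub_eq_zero, ← map_sub]
  let T : MvPowerSeries σ R →+ R :=
    AddMonoidHom.mk' (fun f => coeff e (subst (a + δ) f -
      (subst a f + ∑ i, subst a (pderiv R i f) * δ i))) (by
        intro f g
        rw [← map_add]
        congr 1
        simp only [subst_add hs, subst_add hs', map_add, add_mul, Finset.sum_add_distrib]
        ring)
  refine eq_zero_of_polynomial T (e.degree + 2) ?_ ?_ f
  · intro f hf
    have hf' : f ∈ vanishIdeal (degreeLT σ (e.degree + 1)) :=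
      fun d hd => hf d (Nat.lt_succ_of_lt hd)
    have : subst (a + δ) f - (subst a f + ∑ i, subst a (pderiv R i f) * δ i) ∈
        vanishIdeal (degreeLT τ (e.degree + 1)) := by
      refine Ideal.sub_mem _ (subst_mem_vanishIdeal_degreeLT had hf') (Ideal.add_mem _
        (subst_mem_vanishIdeal_degreeLT ha hf')
        (Ideal.sum_mem _ fun i _ => Ideal.mul_mem_right _ _ ?_))
      exact subst_mem_vanishIdeal_degreeLT ha (pderiv_mem_vanishIdeal_degreeLT _ hf)
    exact this e (Nat.lt_succ_self _)
  · intro p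
    have : Ideal.Quotient.mk (vanishIdeal S) (subst (a + δ) (p : MvPowerSeries σ R)) =
        Ideal.Quotient.mk (vanishIdeal S) (subst a (p : MvPowerSeries σ R) +
          ∑ i, subst a (pderiv R i (p : MvPowerSeries σ R)) * δ i) := by
      induction p using MvPolynomial.induction_on with
      | C c => simp [MvPolynomial.coe_C, subst_zero_series]
      | add p q hp hq =>
        rw [MvPolynomial.coe_add, subst_add hs', map_add, hp, hq, ← map_add]
        simp only [subst_add hs, map_add, add_mul, Finset.sum_add_distrib]
        ring
      | mul_X p k hp =>
        rw [MvPolynomial.coe_mul, MvPolynomial.coe_X, subst_mul hs', subst_X hs', map_mul, hp,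
          ← map_mul]
        have hsum : ∑ i, subst a (pderiv R i ((p : MvPowerSeries σ R) * X k)) * δ i =
            subst a (p : MvPowerSeries σ R) * δ k +
              a k * ∑ i, subst a (pderiv R i (p : MvPowerSeries σ R)) * δ i := by
          simp only [Derivation.leibniz, subst_add hs, smul_eq_mul, subst_mul hs, subst_X hs,
            add_mul, Finset.sum_add_distrib]
          congr 1
          · rw [Finset.sum_eq_single k]
            · simp [subst_one_series]
            · intro i _ hi
              rw [pderiv_X_of_ne (Ne.symm hi), subst_zero_series]
              ring
            · simp
          · rw [Finset.mul_sum]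
            exact Finset.sum_congr rfl fun i _ => by ring
        rw [hsum, subst_mul hs, subst_X hs, Ideal.Quotient.eq]
        -- Multiplying the expansion of `p` by `a k + δ k` leaves only products `δ i * δ k` beyond
        -- the first-order expansion of `p * X k`, and these lie in the ideal by `hS`.
        have : (subst a (p : MvPowerSeries σ R) +
              ∑ i, subst a (pderiv R i (p : MvPowerSeries σ R)) * δ i) * (a + δ) k -
            (subst a (p : MvPowerSeries σ R) * a k + (subst a (p : MvPowerSeries σ R) * δ k +
              a k * ∑ i, subst a (pderiv R i (p : MvPowerSeries σ R)) * δ i)) =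
            ∑ i, subst a (pderiv R i (p : MvPowerSeries σ R)) * (δ i * δ k) := by
          simp only [← mul_assoc, ← Finset.sum_mul, Pi.add_apply]
          ring
        rw [this]
        exact Ideal.sum_mem _ fun i _ => Ideal.mul_mem_left _ _ (hS i k)
    change coeff e (subst (a + δ) (p : MvPowerSeries σ R) -
      (subst a (p : MvPowerSeries σ R) +
        ∑ i, subst a (pderiv R i (p : MvPowerSeries σ R)) * δ i)) = 0
    rw [map_sub, sub_eq_zero]
    exact mk_vanishIdeal_eq_iff.mp this e he

/-- Taylor expansion at the point `0` with increment `a`, read modulo degree two. -/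
theorem coeff_subst_of_degree_eq_one [Fintype σ] {a : σ → MvPowerSeries τ R}
    (ha : ∀ i, constantCoeff (a i) = 0) (f : MvPowerSeries σ R) {e : τ →₀ ℕ}
    (he : e.degree = 1) :
    coeff e (subst a f) = ∑ i, coeff (Finsupp.single i 1) f * coeff e (a i) := by
  classical
  have hz : ∀ i, constantCoeff ((0 : σ → MvPowerSeries τ R) i) = 0 := fun i => by simp
  have h := mk_subst_add (a := 0) hz ha (S := degreeLT τ 2) (fun i j =>
    mul_mem_vanishIdeal_degreeLT (M := 1) (N := 1) (mem_vanishIdeal_degreeLT_one.mpr (ha i))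
      (mem_vanishIdeal_degreeLT_one.mpr (ha j))) f
  rw [zero_add, mk_vanishIdeal_eq_iff] at h
  have key : ∀ g : MvPowerSeries σ R, subst (0 : σ → MvPowerSeries τ R) g =
      C (constantCoeff g) := fun g => by
    rw [subst_zero_eq_C_constantCoeff]
    simp
  rw [h e (by rw [mem_degreeLT, he]; norm_num), map_add, map_sum, key, coeff_C, if_neg, zero_add]
  · refine Finset.sum_congr rfl fun i _ => ?_
    rw [key, coeff_C_mul, ← coeff_zero_eq_constantCoeff_apply, coeff_pderiv]
    simp
  · rintro rfl
    simp at he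

end Congruence

/-! ### The formal inverse function theorem -/

section Inverse

variable {σ τ ι : Type*} {R : Type*} [CommRing R]

/-- The contraction principle for tuples of power series without constant term. -/
theorem exists_fixedPoint (T : (ι → MvPowerSeries σ R) → ι → MvPowerSeries σ R)
    (h0 : ∀ x, (∀ i, constantCoeff (x i) = 0) → ∀ i, constantCoeff (T x i) = 0)
    (hT : ∀ N, 1 ≤ N → ∀ x y, (∀ i, constantCoeff (x i) = 0) → (∀ i, constantCoeff (y i) = 0) →
      (∀ i, x i - y i ∈ vanishIdeal (degreeLT σ N)) →
      ∀ i, T x i - T y i ∈ vanishIdeal (degreeLT σ (N + 1))) :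
    ∃ x, (∀ i, constantCoeff (x i) = 0) ∧ T x = x := by
  let s : ℕ → ι → MvPowerSeries σ R := fun n => T^[n] 0
  have hs : ∀ n, s (n + 1) = T (s n) := fun n => Function.iterate_succ_apply' T n 0
  have hs0 : ∀ n i, constantCoeff (s n i) = 0 := by
    intro n
    induction n with
    | zero => intro i; simp [s]
    | succ n ih => rw [hs]; exact h0 _ ih
  have hstep : ∀ n i, s (n + 1) i - s n i ∈ vanishIdeal (degreeLT σ (n + 1)) := by
    intro n
    induction n with
    | zero =>
      intro i
      rw [mem_vanishIdeal_degreeLT_one, map_sub, hs0, hs0, sub_zero]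
    | succ n ih =>
      intro i
      rw [hs, hs]
      refine hT _ (Nat.le_add_left 1 n) _ _ ?_ (hs0 n) ?_ i
      · rw [← hs]; exact hs0 _
      · rw [← hs]; exact ih
  have hmn : ∀ n k i, s (n + k) i - s n i ∈ vanishIdeal (degreeLT σ (n + 1)) := by
    intro n k i
    induction k with
    | zero => simp
    | succ k ih =>
      rw [← sub_add_sub_cancel _ (s (n + k) i)]
      refine Ideal.add_mem _ (fun d hd => hstep (n + k) i d ?_) ih
      rw [mem_degreeLT] at *
      omega
  -- From index `n` on, the iterates agree in all degrees up to `n`. The limit can thus take its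
  -- coefficient at `d` from the iterate of index `d.degree`.
  let x : ι → MvPowerSeries σ R := fun i d => coeff d (s d.degree i)
  have hx : ∀ n i, x i - s n i ∈ vanishIdeal (degreeLT σ (n + 1)) := by
    intro n i d hd
    obtain ⟨k, hk⟩ := Nat.exists_eq_add_of_le (Nat.lt_succ_iff.mp (mem_degreeLT.mp hd))
    have := hmn d.degree k i d (Nat.lt_succ_self _)
    rw [← hk, map_sub, sub_eq_zero] at this
    rw [map_sub, this]
    exact sub_self (coeff d (s d.degree i))
  have hx0 : ∀ i, constantCoeff (x i) = 0 := by
    intro i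
    have := mem_vanishIdeal_degreeLT_one.mp (hx 0 i)
    rwa [map_sub, hs0, sub_zero] at this
  refine ⟨x, hx0, ?_⟩
  ext i d
  rw [← sub_eq_zero, ← map_sub]
  have h1 := hT _ (Nat.le_add_left 1 d.degree) x (s d.degree) hx0 (hs0 _) (hx _) i d
    (mem_degreeLT.mpr (by omega))
  rw [← hs] at h1
  have h2 := hx (d.degree + 1) i d (mem_degreeLT.mpr (by omega))
  rw [map_sub, sub_eq_zero] at *
  rw [h1, h2]

/-- The Jacobian matrix at `0` of a tuple of power series. -/
noncomputable def jac (a : ι → MvPowerSeries σ R) : Matrix ι σ R :=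
  Matrix.of fun i j => coeff (Finsupp.single j 1) (a i)

theorem jac_subst [Fintype σ] (a : ι → MvPowerSeries σ R) {b : σ → MvPowerSeries τ R}
    (hb : ∀ i, constantCoeff (b i) = 0) : jac (fun i => subst b (a i)) = jac a * jac b := by
  ext i j
  simp only [jac, Matrix.of_apply, Matrix.mul_apply]
  exact coeff_subst_of_degree_eq_one hb _ (Finsupp.degree_single _ _)

theorem jac_X [DecidableEq σ] : jac (X : σ → MvPowerSeries σ R) = 1 := by
  ext i j
  rw [jac, Matrix.of_apply, coeff_X, Matrix.one_apply]
  simp only [Finsupp.single_left_inj (one_ne_zero' ℕ), eq_comm]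

theorem subst_X_eq (f : MvPowerSeries σ R) : subst (X : σ → MvPowerSeries σ R) f = f :=
  congrFun subst_self f

/-- The linear part of a power series governs differences of its values. -/
theorem subst_sub_subst_mem [Fintype σ] (f : MvPowerSeries σ R)
    {x y : σ → MvPowerSeries τ R} (hx : ∀ i, constantCoeff (x i) = 0)
    (hy : ∀ i, constantCoeff (y i) = 0) {N : ℕ} (hN : 1 ≤ N)
    (hxy : ∀ i, x i - y i ∈ vanishIdeal (degreeLT τ N)) :
    subst x f - subst y f - ∑ l, C (coeff (Finsupp.single l 1) f) * (x l - y l) ∈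
      vanishIdeal (degreeLT τ (N + 1)) := by
  have hδ0 : ∀ i, constantCoeff ((x - y) i) = 0 := fun i => by simp [hx, hy]
  have h1 := mk_subst_add hy hδ0 (S := degreeLT τ (N + 1)) (fun i j d hd =>
    mul_mem_vanishIdeal_degreeLT (hxy i) (hxy j) d (by rw [mem_degreeLT] at *; omega)) f
  rw [add_sub_cancel, Ideal.Quotient.eq] at h1
  have h2 : ∑ l, (subst y (pderiv R l f) - C (coeff (Finsupp.single l 1) f)) * (x - y) l ∈
      vanishIdeal (degreeLT τ (N + 1)) := by
    refine Ideal.sum_mem _ fun l _ => ?_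
    rw [add_comm N 1]
    refine mul_mem_vanishIdeal_degreeLT ?_ (hxy l)
    have h2 : pderiv R l f - C (coeff (Finsupp.single l 1) f) ∈ vanishIdeal (degreeLT σ 1) := by
      rw [mem_vanishIdeal_degreeLT_one, map_sub, constantCoeff_C,
        ← coeff_zero_eq_constantCoeff_apply, coeff_pderiv]
      simp
    have h3 := subst_mem_vanishIdeal_degreeLT hy h2
    rwa [subst_sub (hasSubst hy), subst_C] at h3
  convert Ideal.add_mem _ h1 h2 using 1
  simp only [sub_mul, Finset.sum_sub_distrib, Pi.sub_apply]
  ring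

theorem sum_C_mul_sum_C_mul [Fintype σ] [DecidableEq σ] {A B : Matrix σ σ R} (hAB : A * B = 1)
    (v : σ → MvPowerSeries τ R) (i : σ) : ∑ j, C (A i j) * ∑ l, C (B j l) * v l = v i := by
  simp only [Finset.mul_sum, ← mul_assoc, ← map_mul]
  rw [Finset.sum_comm]
  simp only [← Finset.sum_mul, ← map_sum, ← Matrix.mul_apply, hAB, Matrix.one_apply]
  simp

/-- With `B` the inverse of the linear part of `a`, a solution of `a(x) = X` is a fixed point of `x
↦ x - B (a(x) - X)`. The linear parts cancel in differences of values of this map, so it gains one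
degree each time and the contraction principle applies. -/
theorem exists_rightInverse [Fintype σ] [DecidableEq σ] {a : σ → MvPowerSeries σ R}
    (ha : ∀ i, constantCoeff (a i) = 0) (hJ : IsUnit (jac a).det) :
    ∃ b : σ → MvPowerSeries σ R, (∀ i, constantCoeff (b i) = 0) ∧ ∀ i, subst b (a i) = X i := by
  obtain ⟨B, hBA, hAB⟩ : ∃ B, B * jac a = 1 ∧ jac a * B = 1 :=
    ⟨_, Matrix.nonsing_inv_mul _ hJ, Matrix.mul_nonsing_inv _ hJ⟩
  obtain ⟨b, hb, hTb⟩ := exists_fixedPoint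
    (fun x i => x i - ∑ j, C (B i j) * (subst x (a j) - X j)) (by
    intro x hx i
    simp only [map_sub, map_sum, map_mul, hx]
    simp [constantCoeff_subst_eq_zero (hasSubst hx) hx (ha _)]) (by
    intro N hN x y hx hy hxy i
    have h1 : ∀ j, subst x (a j) - subst y (a j) - ∑ l, C (jac a j l) * (x l - y l) ∈
      vanishIdeal (degreeLT σ (N + 1)) := fun j => subst_sub_subst_mem (a j) hx hy hN hxy
    have h2 : -∑ j, C (B i j) *
        (subst x (a j) - subst y (a j) - ∑ l, C (jac a j l) * (x l - y l)) ∈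
        vanishIdeal (degreeLT σ (N + 1)) :=
      Ideal.neg_mem_iff _ |>.mpr (Ideal.sum_mem _ fun j _ => Ideal.mul_mem_left _ _ (h1 j))
    convert h2 using 1
    simp only [mul_sub, Finset.sum_sub_distrib]
    have h3 := sum_C_mul_sum_C_mul hBA (fun l => x l - y l) i
    simp only [mul_sub, Finset.sum_sub_distrib] at h3
    linear_combination -h3)
  refine ⟨b, hb, fun i => ?_⟩
  have h1 : ∀ i, ∑ j, C (B i j) * (subst b (a j) - X j) = 0 := by
    intro i
    have := congrFun hTb i
    simpa using this
  have h2 := sum_C_mul_sum_C_mul hAB (fun l => subst b (a l) - X l) i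
  simp only [h1, mul_zero, Finset.sum_const_zero] at h2
  exact sub_eq_zero.mp h2.symm

/-- The right inverse `b` has an invertible linear part too, hence a right inverse `c` of its own.
Associativity of substitution gives `c = a`, so `b` is two-sided. -/
theorem exists_inverse [Fintype σ] [DecidableEq σ] {a : σ → MvPowerSeries σ R}
    (ha : ∀ i, constantCoeff (a i) = 0) (hJ : IsUnit (jac a).det) :
    ∃ b : σ → MvPowerSeries σ R, (∀ i, constantCoeff (b i) = 0) ∧
      (∀ i, subst b (a i) = X i) ∧ ∀ i, subst a (b i) = X i := by
  obtain ⟨b, hb, hab⟩ := exists_rightInverse ha hJ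
  have hJab : jac a * jac b = 1 := by
    rw [← jac_subst a hb, ← jac_X]
    congr 1
    exact funext hab
  have hJb : IsUnit (jac b).det := by
    rw [← Matrix.isUnit_iff_isUnit_det]
    exact IsUnit.of_mul_eq_one _ (mul_eq_one_comm.mp hJab)
  obtain ⟨c, hc, hbc⟩ := exists_rightInverse hb hJb
  have : c = a := by
    funext i
    rw [← subst_X (R := R) (hasSubst hc) i, ← hab, subst_comp_subst_apply (hasSubst hb) (hasSubst hc),
      funext hbc, subst_X_eq]
  exact ⟨b, hb, hab, this ▸ hbc⟩

theorem subst_eq_X_comm [Fintype σ] [DecidableEq σ] {a b : σ → MvPowerSeries σ R}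
    (ha : ∀ i, constantCoeff (a i) = 0) (hb : ∀ i, constantCoeff (b i) = 0)
    (hab : ∀ i, subst b (a i) = X i) : ∀ i, subst a (b i) = X i := by
  have hJab : jac a * jac b = 1 := by
    rw [← jac_subst a hb, ← jac_X]
    congr 1
    exact funext hab
  have hJa : IsUnit (jac a).det := by
    rw [← Matrix.isUnit_iff_isUnit_det]
    exact IsUnit.of_mul_eq_one _ hJab
  obtain ⟨c, hc, hac, hca⟩ := exists_inverse ha hJa
  have : b = c := by
    funext i
    have h1 := subst_comp_subst_apply (hasSubst ha) (hasSubst hb) (c i)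
    rw [hca, subst_X (hasSubst hb), funext hab, subst_X_eq] at h1
    exact h1
  exact this ▸ hca

end Inverse

/-! ### Formal conjugation -/

section Conj

variable {τ τ' : Type*}

theorem subst_vec2 {b : τ → MvPowerSeries τ' ℂ} [Finite τ] (hb : ∀ i, constantCoeff (b i) = 0)
    {x y : MvPowerSeries τ ℂ} (hx : constantCoeff x = 0) (hy : constantCoeff y = 0)
    (f : MvPowerSeries (Fin 2) ℂ) :
    subst b (subst ![x, y] f) = subst ![subst b x, subst b y] f := by
  rw [subst_comp_subst_apply (hasSubst (Fin.forall_fin_two.mpr ⟨hx, hy⟩)) (hasSubst hb)]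
  congr 1
  funext i
  fin_cases i <;> rfl

theorem subst_vec3 {b : τ → MvPowerSeries τ' ℂ} [Finite τ] (hb : ∀ i, constantCoeff (b i) = 0)
    {x y t : MvPowerSeries τ ℂ} (hx : constantCoeff x = 0) (hy : constantCoeff y = 0)
    (ht : constantCoeff t = 0) (f : MvPowerSeries (Fin 3) ℂ) :
    subst b (subst ![x, y, t] f) = subst ![subst b x, subst b y, subst b t] f := by
  rw [subst_comp_subst_apply (hasSubst (by simp [Fin.forall_fin_succ, hx, hy, ht])) (hasSubst hb)]
  congr 1
  funext i
  fin_cases i <;> rfl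

theorem swap_const (i : Fin 3) :
    constantCoeff ((![X 1, X 0, X 2] : Fin 3 → MvPowerSeries (Fin 3) ℂ) i) = 0 := by
  fin_cases i <;> simp

/-- Formal conjugation as a ring homomorphism. -/
noncomputable def conjHom : MvPowerSeries (Fin 3) ℂ →+* MvPowerSeries (Fin 3) ℂ :=
  (MvPowerSeries.map (starRingEnd ℂ)).comp
    (substAlgHom (R := ℂ) (hasSubst swap_const)).toRingHom

theorem conjHom_apply (f : MvPowerSeries (Fin 3) ℂ) : conjHom f = conj f := by
  simp [conjHom, conj]

theorem conj_add (f g : MvPowerSeries (Fin 3) ℂ) : conj (f + g) = conj f + conj g := by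
  simp only [← conjHom_apply, map_add]

theorem conj_sub (f g : MvPowerSeries (Fin 3) ℂ) : conj (f - g) = conj f - conj g := by
  simp only [← conjHom_apply, map_sub]

theorem conj_mul (f g : MvPowerSeries (Fin 3) ℂ) : conj (f * g) = conj f * conj g := by
  simp only [← conjHom_apply, map_mul]

theorem conj_pow (f : MvPowerSeries (Fin 3) ℂ) (n : ℕ) : conj (f ^ n) = conj f ^ n := by
  simp only [← conjHom_apply, map_pow]

theorem conj_one : conj 1 = 1 := by rw [← conjHom_apply, map_one]

theorem conj_C (c : ℂ) : conj (C c) = C (starRingEnd ℂ c) := by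
  rw [conj, subst_C, map_C]

theorem conj_X0 : conj (X 0) = X 1 := by
  rw [conj, subst_X (hasSubst swap_const)]; simp

theorem conj_X1 : conj (X 1) = X 0 := by
  rw [conj, subst_X (hasSubst swap_const)]; simp

theorem conj_X2 : conj (X 2) = X 2 := by
  rw [conj, subst_X (hasSubst swap_const)]; simp

theorem conj_subst [Finite τ] {a : τ → MvPowerSeries (Fin 3) ℂ}
    (ha : ∀ i, constantCoeff (a i) = 0) (f : MvPowerSeries τ ℂ) :
    conj (subst a f) = subst (fun i => conj (a i)) (MvPowerSeries.map (starRingEnd ℂ) f) := by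
  rw [conj, subst_comp_subst_apply (hasSubst ha) (hasSubst swap_const), map_subst]
  · rfl
  · exact hasSubst fun i => constantCoeff_subst_eq_zero (hasSubst swap_const) swap_const (ha i)

theorem constantCoeff_conj (f : MvPowerSeries (Fin 3) ℂ) :
    constantCoeff (conj f) = starRingEnd ℂ (constantCoeff f) := by
  have h : f = (f - C (constantCoeff f)) + C (constantCoeff f) := by ring
  rw [h, conj_add, conj_C, map_add, map_add]
  have : constantCoeff (conj (f - C (constantCoeff f))) = 0 := by
    rw [conj, ← coeff_zero_eq_constantCoeff_apply, coeff_map, coeff_zero_eq_constantCoeff_apply,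
      constantCoeff_subst_eq_zero (hasSubst swap_const) swap_const (by simp), map_zero]
  rw [this]
  simp

theorem conj_subst2 {x y : MvPowerSeries (Fin 3) ℂ} (hx : constantCoeff x = 0)
    (hy : constantCoeff y = 0) (f : MvPowerSeries (Fin 2) ℂ) :
    conj (subst ![x, y] f) = subst ![conj x, conj y] (MvPowerSeries.map (starRingEnd ℂ) f) := by
  rw [conj_subst (Fin.forall_fin_two.mpr ⟨hx, hy⟩)]
  congr 1
  funext i
  fin_cases i <;> rfl

theorem conj_subst3 {x y t : MvPowerSeries (Fin 3) ℂ} (hx : constantCoeff x = 0)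
    (hy : constantCoeff y = 0) (ht : constantCoeff t = 0) (f : MvPowerSeries (Fin 3) ℂ) :
    conj (subst ![x, y, t] f) = subst ![conj y, conj x, conj t] (conj f) := by
  have h : ∀ i, constantCoeff (![x, y, t] i) = 0 := by simp [Fin.forall_fin_succ, hx, hy, ht]
  have h' : ∀ i, constantCoeff (![conj y, conj x, conj t] i) = 0 := by
    simp [Fin.forall_fin_succ, hx, hy, ht, constantCoeff_conj]
  rw [conj_subst h, conj.eq_1 f, map_subst (hasSubst swap_const),
    subst_comp_subst_apply _ (hasSubst h')]
  · congr 1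
    funext i
    fin_cases i <;> simp [subst_X (hasSubst h')]
  · exact hasSubst fun i => by fin_cases i <;> simp

theorem map_star_map_star {σ : Type*} (f : MvPowerSeries σ ℂ) :
    MvPowerSeries.map (starRingEnd ℂ) (MvPowerSeries.map (starRingEnd ℂ) f) = f := by
  ext d
  simp

theorem vec3_X : (![X 0, X 1, X 2] : Fin 3 → MvPowerSeries (Fin 3) ℂ) = X := by
  funext i
  fin_cases i <;> rfl

theorem vec2_X : (![X 0, X 1] : Fin 2 → MvPowerSeries (Fin 2) ℂ) = X := by
  funext i
  fin_cases i <;> rfl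

theorem conj_conj (f : MvPowerSeries (Fin 3) ℂ) : conj (conj f) = f := by
  have h := conj_subst swap_const (MvPowerSeries.map (starRingEnd ℂ) f)
  have h1 : (fun i => conj ((![X 1, X 0, X 2] : Fin 3 → MvPowerSeries (Fin 3) ℂ) i)) = X := by
    funext i
    fin_cases i
    · exact conj_X1
    · exact conj_X0
    · exact conj_X2
  rw [h1, map_star_map_star, subst_X_eq] at h
  conv_rhs => rw [← h]
  congr 1
  rw [conj, map_subst (hasSubst swap_const)]
  congr 1
  funext i
  fin_cases i <;> simp

/-- The exponent of `z ^ a * z̄ ^ b * u ^ c`. -/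
noncomputable def expo (a b c : ℕ) : Fin 3 →₀ ℕ :=
  Finsupp.single 0 a + Finsupp.single 1 b + Finsupp.single 2 c

theorem coeff₃_eq (a b c : ℕ) (f : MvPowerSeries (Fin 3) ℂ) :
    coeff₃ a b c f = coeff (expo a b c) f := rfl

@[simp] theorem expo_zero (a b c : ℕ) : expo a b c 0 = a := by simp [expo]

@[simp] theorem expo_one (a b c : ℕ) : expo a b c 1 = b := by simp [expo]

@[simp] theorem expo_two (a b c : ℕ) : expo a b c 2 = c := by simp [expo]

theorem expo_eq (d : Fin 3 →₀ ℕ) : expo (d 0) (d 1) (d 2) = d := by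
  ext i
  fin_cases i <;> simp

theorem expo_inj {a b c a' b' c' : ℕ} :
    expo a b c = expo a' b' c' ↔ a = a' ∧ b = b' ∧ c = c' := by
  constructor
  · intro h
    have h0 := DFunLike.congr_fun h 0
    have h1 := DFunLike.congr_fun h 1
    have h2 := DFunLike.congr_fun h 2
    simp only [expo_zero, expo_one, expo_two] at h0 h1 h2
    exact ⟨h0, h1, h2⟩
  · rintro ⟨rfl, rfl, rfl⟩
    rfl

theorem expo_add (a b c a' b' c' : ℕ) :
    expo a b c + expo a' b' c' = expo (a + a') (b + b') (c + c') := by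
  ext i
  fin_cases i <;> simp

theorem degree_expo (a b c : ℕ) : (expo a b c).degree = a + b + c := by
  simp [expo, Finsupp.degree_single]

theorem ext_coeff₃ {f g : MvPowerSeries (Fin 3) ℂ} (h : ∀ a b c, coeff₃ a b c f = coeff₃ a b c g) :
    f = g := by
  ext d
  rw [← expo_eq d]
  exact h _ _ _

theorem coeff₃_conj (a b c : ℕ) (f : MvPowerSeries (Fin 3) ℂ) :
    coeff₃ a b c (conj f) = starRingEnd ℂ (coeff₃ b a c f) := by
  rw [coeff₃_eq, conj, coeff_map, coeff_subst (hasSubst swap_const), coeff₃_eq]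
  congr 1
  have key : ∀ d : Fin 3 →₀ ℕ,
      (d.prod fun s e => (![X 1, X 0, X 2] : Fin 3 → MvPowerSeries (Fin 3) ℂ) s ^ e) =
        monomial (expo (d 1) (d 0) (d 2)) 1 := by
    intro d
    rw [Finsupp.prod_fintype _ _ (fun i => pow_zero _), Fin.prod_univ_three]
    simp only [X_pow_eq, Matrix.cons_val_zero, Matrix.cons_val_one, Matrix.cons_val,
      monomial_mul_monomial, expo]
    rw [add_comm (Finsupp.single 1 _), mul_one, mul_one]
  rw [finsum_eq_single _ (expo b a c)]
  · rw [key]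
    simp
  · intro d hd
    rw [key, coeff_monomial_ne, smul_zero]
    intro h
    apply hd
    rw [expo_inj] at h
    rw [← expo_eq d, expo_inj]
    exact ⟨h.2.1.symm, h.1.symm, h.2.2.symm⟩

theorem rePart_add_imPart (f : MvPowerSeries (Fin 3) ℂ) :
    rePart f + C Complex.I * imPart f = f := by
  have h1 : (C (Complex.I) * C (1 / (2 * Complex.I)) : MvPowerSeries (Fin 3) ℂ) = C (1 / 2) := by
    rw [← map_mul]; congr 1; field_simp
  have h2 : (C (1 / 2) + C (1 / 2) : MvPowerSeries (Fin 3) ℂ) = 1 := by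
    rw [← map_add, ← map_one C]; norm_num
  rw [rePart, imPart]
  linear_combination (f - conj f) * h1 + f * h2

theorem rePart_sub_imPart (f : MvPowerSeries (Fin 3) ℂ) :
    rePart f - C Complex.I * imPart f = conj f := by
  have h1 : (C (Complex.I) * C (1 / (2 * Complex.I)) : MvPowerSeries (Fin 3) ℂ) = C (1 / 2) := by
    rw [← map_mul]; congr 1; field_simp
  have h2 : (C (1 / 2) + C (1 / 2) : MvPowerSeries (Fin 3) ℂ) = 1 := by
    rw [← map_add, ← map_one C]; norm_num
  rw [rePart, imPart]
  linear_combination -(f - conj f) * h1 + conj f * h2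

theorem conj_rePart (f : MvPowerSeries (Fin 3) ℂ) : conj (rePart f) = rePart f := by
  rw [rePart, conj_mul, conj_add, conj_conj, conj_C]
  simp [add_comm, map_ofNat]

theorem conj_imPart (f : MvPowerSeries (Fin 3) ℂ) : conj (imPart f) = imPart f := by
  rw [imPart, conj_mul, conj_sub, conj_conj, conj_C]
  have : (starRingEnd ℂ) (1 / (2 * Complex.I)) = -(1 / (2 * Complex.I)) := by
    simp [map_ofNat]
  rw [this, map_neg]
  ring

end Conj

/-! ### Composition of formal maps and of mappings of hypersurfaces -/

section Maps

theorem restrict_const {φ : MvPowerSeries (Fin 3) ℂ} (hφ : constantCoeff φ = 0) (i : Fin 2) :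
    constantCoeff ((![X 0, X 2 + C Complex.I * φ] : Fin 2 → MvPowerSeries (Fin 3) ℂ) i) = 0 := by
  fin_cases i <;> simp [hφ]

namespace FormalMap

theorem vec_const (Φ : FormalMap) (i : Fin 2) : constantCoeff (![Φ.F, Φ.G] i) = 0 := by
  fin_cases i
  · exact Φ.F_zero
  · exact Φ.G_zero

theorem restrict_constantCoeff {φ : MvPowerSeries (Fin 3) ℂ} (hφ : constantCoeff φ = 0)
    {f : MvPowerSeries (Fin 2) ℂ} (hf : constantCoeff f = 0) :
    constantCoeff (restrict φ f) = 0 :=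
  constantCoeff_subst_eq_zero (hasSubst (restrict_const hφ)) (restrict_const hφ) hf

theorem rePart_constantCoeff {f : MvPowerSeries (Fin 3) ℂ} (hf : constantCoeff f = 0) :
    constantCoeff (rePart f) = 0 := by
  simp [rePart, constantCoeff_conj, hf]

theorem imPart_constantCoeff {f : MvPowerSeries (Fin 3) ℂ} (hf : constantCoeff f = 0) :
    constantCoeff (imPart f) = 0 := by
  simp [imPart, constantCoeff_conj, hf]

/-- The map `(z, z̄, u) ↦ (F, F̄, Re G)` induced on the hypersurface of `φ`. -/
noncomputable def graphMap (φ : MvPowerSeries (Fin 3) ℂ) (Φ : FormalMap) :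
    Fin 3 → MvPowerSeries (Fin 3) ℂ :=
  ![restrict φ Φ.F, FormalCR.conj (restrict φ Φ.F), rePart (restrict φ Φ.G)]

theorem graphMap_const {φ : MvPowerSeries (Fin 3) ℂ} (hφ : constantCoeff φ = 0) (Φ : FormalMap)
    (i : Fin 3) : constantCoeff (graphMap φ Φ i) = 0 := by
  have h1 := restrict_constantCoeff hφ Φ.F_zero
  have h2 := rePart_constantCoeff (restrict_constantCoeff hφ Φ.G_zero)
  fin_cases i <;> simp [graphMap, h1, h2, constantCoeff_conj]

theorem sends_iff {Φ : FormalMap} {φ φ' : MvPowerSeries (Fin 3) ℂ} :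
    Φ.Sends φ φ' ↔ imPart (restrict φ Φ.G) = subst (graphMap φ Φ) φ' := Iff.rfl

theorem conj_subst_graphMap {φ : MvPowerSeries (Fin 3) ℂ} (hφ : constantCoeff φ = 0)
    (Φ : FormalMap) (f : MvPowerSeries (Fin 3) ℂ) :
    FormalCR.conj (subst (graphMap φ Φ) f) = subst (graphMap φ Φ) (FormalCR.conj f) := by
  have h1 := restrict_constantCoeff hφ Φ.F_zero
  have h2 := rePart_constantCoeff (restrict_constantCoeff hφ Φ.G_zero)
  rw [graphMap, conj_subst3 h1 (by simp [constantCoeff_conj, h1]) h2, conj_conj, conj_rePart]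

theorem rePart_subst_graphMap {φ : MvPowerSeries (Fin 3) ℂ} (hφ : constantCoeff φ = 0)
    (Φ : FormalMap) (f : MvPowerSeries (Fin 3) ℂ) :
    rePart (subst (graphMap φ Φ) f) = subst (graphMap φ Φ) (rePart f) := by
  have h := hasSubst (graphMap_const hφ Φ)
  rw [rePart, rePart, conj_subst_graphMap hφ, subst_mul h, subst_add h, subst_C]

theorem imPart_subst_graphMap {φ : MvPowerSeries (Fin 3) ℂ} (hφ : constantCoeff φ = 0)
    (Φ : FormalMap) (f : MvPowerSeries (Fin 3) ℂ) :
    imPart (subst (graphMap φ Φ) f) = subst (graphMap φ Φ) (imPart f) := by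
  have h := hasSubst (graphMap_const hφ Φ)
  rw [imPart, imPart, conj_subst_graphMap hφ, subst_mul h, subst_sub h, subst_C]

/-- On the source `G = Re G + i Im G`, and `Sends` replaces `Im G` by `φ'` pulled back by
`graphMap`. Restriction to hypersurfaces is therefore functorial, from which the statements on
compositions and inverses follow. -/
theorem Sends.restrict_subst {Φ : FormalMap} {φ φ' : MvPowerSeries (Fin 3) ℂ}
    (hs : Φ.Sends φ φ') (hφ : constantCoeff φ = 0) (hφ' : constantCoeff φ' = 0)
    (f : MvPowerSeries (Fin 2) ℂ) :
    restrict φ (subst ![Φ.F, Φ.G] f) = subst (graphMap φ Φ) (restrict φ' f) := by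
  have h := hasSubst (graphMap_const hφ Φ)
  rw [restrict, restrict, subst_vec2 (restrict_const hφ) Φ.F_zero Φ.G_zero,
    subst_vec2 (graphMap_const hφ Φ) (by simp) (by simp [hφ']), subst_X h, subst_add h,
    subst_mul h, subst_X h, subst_C, ← sends_iff.mp hs]
  change subst ![restrict φ Φ.F, restrict φ Φ.G] f = subst ![restrict φ Φ.F,
    rePart (restrict φ Φ.G) + C Complex.I * imPart (restrict φ Φ.G)] f
  rw [rePart_add_imPart]

theorem Sends.graphMap_comp {Φ Ψ : FormalMap} {φ φ' : MvPowerSeries (Fin 3) ℂ}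
    (hs : Φ.Sends φ φ') (hφ : constantCoeff φ = 0) (hφ' : constantCoeff φ' = 0) (i : Fin 3) :
    graphMap φ (Ψ.comp Φ) i = subst (graphMap φ Φ) (graphMap φ' Ψ i) := by
  have h1 := hs.restrict_subst hφ hφ' Ψ.F
  have h2 := hs.restrict_subst hφ hφ' Ψ.G
  fin_cases i
  · exact h1
  · change FormalCR.conj (restrict φ (subst ![Φ.F, Φ.G] Ψ.F)) = _
    rw [h1, conj_subst_graphMap hφ]
    rfl
  · change rePart (restrict φ (subst ![Φ.F, Φ.G] Ψ.G)) = _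
    rw [h2, rePart_subst_graphMap hφ]
    rfl

theorem Sends.comp {Φ Ψ : FormalMap} {φ φ' φ'' : MvPowerSeries (Fin 3) ℂ}
    (hΦ : Φ.Sends φ φ') (hΨ : Ψ.Sends φ' φ'') (hφ : constantCoeff φ = 0)
    (hφ' : constantCoeff φ' = 0) : (Ψ.comp Φ).Sends φ φ'' := by
  rw [sends_iff, funext (hΦ.graphMap_comp (Ψ := Ψ) hφ hφ'),
    ← subst_comp_subst_apply (hasSubst (graphMap_const hφ' Ψ)) (hasSubst (graphMap_const hφ Φ)),
    ← sends_iff.mp hΨ, ← imPart_subst_graphMap hφ, ← hΦ.restrict_subst hφ hφ']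
  rfl

theorem id_comp (Φ : FormalMap) : id.comp Φ = Φ := by
  ext1
  · exact subst_X (hasSubst Φ.vec_const) 0
  · exact subst_X (hasSubst Φ.vec_const) 1

theorem comp_id (Φ : FormalMap) : Φ.comp id = Φ := by
  ext1
  · change subst ![X 0, X 1] Φ.F = Φ.F
    rw [vec2_X, subst_X_eq]
  · change subst ![X 0, X 1] Φ.G = Φ.G
    rw [vec2_X, subst_X_eq]

theorem comp_assoc (Φ Ψ Θ : FormalMap) : (Φ.comp Ψ).comp Θ = Φ.comp (Ψ.comp Θ) := by
  ext1
  · exact subst_vec2 Θ.vec_const Ψ.F_zero Ψ.G_zero Φ.F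
  · exact subst_vec2 Θ.vec_const Ψ.F_zero Ψ.G_zero Φ.G

theorem jacobian_eq_jac (Φ : FormalMap) : Φ.jacobian = jac ![Φ.F, Φ.G] := by
  ext i j
  fin_cases i <;> fin_cases j <;> rfl

theorem jacobian_comp (Φ Ψ : FormalMap) :
    (Φ.comp Ψ).jacobian = Φ.jacobian * Ψ.jacobian := by
  rw [jacobian_eq_jac, jacobian_eq_jac, jacobian_eq_jac, ← jac_subst _ Ψ.vec_const]
  congr 1
  funext i
  fin_cases i <;> rfl

theorem jacobian_id : id.jacobian = 1 := by
  rw [jacobian_eq_jac, ← jac_X, ← vec2_X]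
  rfl

theorem invertible_id : id.Invertible := by
  simp [Invertible, jacobian_id]

theorem Invertible.comp {Φ Ψ : FormalMap} (hΦ : Φ.Invertible) (hΨ : Ψ.Invertible) :
    (Φ.comp Ψ).Invertible := by
  rw [Invertible, jacobian_comp, Matrix.det_mul]
  exact mul_ne_zero hΦ hΨ

theorem invertible_of_comp_eq_id {Φ Ψ : FormalMap} (h : Φ.comp Ψ = id) : Φ.Invertible := by
  have h1 := congrArg (fun Θ => Θ.jacobian.det) h
  simp only [jacobian_comp, Matrix.det_mul, jacobian_id, Matrix.det_one] at h1
  exact left_ne_zero_of_mul (h1 ▸ one_ne_zero)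

theorem Invertible.exists_inverse {Φ : FormalMap} (hΦ : Φ.Invertible) :
    ∃ Ψ : FormalMap, Φ.comp Ψ = id ∧ Ψ.comp Φ = id := by
  obtain ⟨b, hb, hab, hba⟩ := FormalCR.exists_inverse Φ.vec_const
    (by rw [← jacobian_eq_jac]; exact isUnit_iff_ne_zero.mpr hΦ)
  have hbv : ![b 0, b 1] = b := by
    funext i
    fin_cases i <;> rfl
  refine ⟨⟨b 0, b 1, hb 0, hb 1⟩, ?_, ?_⟩
  · ext1
    · change subst ![b 0, b 1] Φ.F = X 0
      rw [hbv]
      exact hab 0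
    · change subst ![b 0, b 1] Φ.G = X 1
      rw [hbv]
      exact hab 1
  · ext1
    · exact hba 0
    · exact hba 1

theorem conj_X2_add {φ : MvPowerSeries (Fin 3) ℂ} (hφ : FormalCR.conj φ = φ) :
    FormalCR.conj (X 2 + C Complex.I * φ) = X 2 - C Complex.I * φ := by
  rw [conj_add, conj_mul, conj_C, conj_X2, hφ, Complex.conj_I, map_neg]
  ring

theorem imPart_X2_add {φ : MvPowerSeries (Fin 3) ℂ} (hφ : FormalCR.conj φ = φ) :
    imPart (X 2 + C Complex.I * φ) = φ := by
  have hI : (C (1 / (2 * Complex.I)) * C Complex.I * C 2 : MvPowerSeries (Fin 3) ℂ) = 1 := by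
    rw [← map_mul, ← map_mul, ← map_one C]
    congr 1
    field_simp
  have h2 : (C 2 : MvPowerSeries (Fin 3) ℂ) = 1 + 1 := by
    rw [← map_one C, ← map_add]; norm_num
  rw [imPart, conj_X2_add hφ]
  rw [h2] at hI
  linear_combination φ * hI

theorem rePart_X2_add {φ : MvPowerSeries (Fin 3) ℂ} (hφ : FormalCR.conj φ = φ) :
    rePart (X 2 + C Complex.I * φ) = X 2 := by
  have := rePart_add_imPart (X 2 + C Complex.I * φ)
  rw [imPart_X2_add hφ] at this
  exact add_right_cancel this

theorem restrict_X0 {φ : MvPowerSeries (Fin 3) ℂ} (hφ : constantCoeff φ = 0) :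
    restrict φ (X 0) = X 0 := subst_X (hasSubst (restrict_const hφ)) 0

theorem restrict_X1 {φ : MvPowerSeries (Fin 3) ℂ} (hφ : constantCoeff φ = 0) :
    restrict φ (X 1) = X 2 + C Complex.I * φ := subst_X (hasSubst (restrict_const hφ)) 1

theorem graphMap_id {φ : MvPowerSeries (Fin 3) ℂ} (hφ : IsHypersurface φ) :
    graphMap φ id = X := by
  rw [graphMap, show id.F = X 0 from rfl, show id.G = X 1 from rfl, restrict_X0 hφ.zero,
    restrict_X1 hφ.zero, rePart_X2_add hφ.hermitian, conj_X0, vec3_X]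

theorem Sends.id {φ : MvPowerSeries (Fin 3) ℂ} (hφ : IsHypersurface φ) : id.Sends φ φ := by
  rw [sends_iff, graphMap_id hφ, subst_X_eq]
  exact (congrArg imPart (restrict_X1 hφ.zero)).trans (imPart_X2_add hφ.hermitian)

theorem Sends.graphMap_inverse {Φ Ψ : FormalMap} {φ φ' : MvPowerSeries (Fin 3) ℂ}
    (hs : Φ.Sends φ φ') (hφ : IsHypersurface φ) (hφ' : constantCoeff φ' = 0)
    (h : Ψ.comp Φ = FormalMap.id) (i : Fin 3) :
    subst (graphMap φ Φ) (graphMap φ' Ψ i) = X i := by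
  rw [← hs.graphMap_comp hφ.zero hφ', h, graphMap_id hφ]

/-- The maps induced on `(z, z̄, u)` are mutually inverse. The identity to be shown can thus be
pulled back by the one of `Φ`, where the second component of `Ψ ∘ Φ` is `w`, with imaginary part
`φ`. -/
theorem Sends.inverse {Φ Ψ : FormalMap} {φ φ' : MvPowerSeries (Fin 3) ℂ}
    (hs : Φ.Sends φ φ') (hφ : IsHypersurface φ) (hφ' : constantCoeff φ' = 0)
    (h : Ψ.comp Φ = FormalMap.id) : Ψ.Sends φ' φ := by
  have hc := graphMap_const hφ.zero Φ
  have hc' := graphMap_const hφ' Ψ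
  have h1 := hs.graphMap_inverse hφ hφ' h
  have h2 := subst_eq_X_comm hc' hc h1
  have h3 : ∀ f : MvPowerSeries (Fin 3) ℂ,
      subst (graphMap φ' Ψ) (subst (graphMap φ Φ) f) = f := fun f => by
    rw [subst_comp_subst_apply (hasSubst hc) (hasSubst hc'), funext h2, subst_X_eq]
  rw [sends_iff, ← h3 (imPart (restrict φ' Ψ.G)), ← imPart_subst_graphMap hφ.zero,
    ← hs.restrict_subst hφ.zero hφ', show subst ![Φ.F, Φ.G] Ψ.G = X 1 from
    congrArg FormalMap.G h, restrict_X1 hφ.zero, imPart_X2_add hφ.hermitian]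

/-- The image of a formal hypersurface is a formal hypersurface, provided that it is a graph. -/
theorem exists_sends {φ : MvPowerSeries (Fin 3) ℂ} (hφ : IsHypersurface φ) (H : FormalMap)
    (hJ : IsUnit (jac (graphMap φ H)).det) : ∃ φ', IsHypersurface φ' ∧ H.Sends φ φ' := by
  have hc := graphMap_const hφ.zero H
  obtain ⟨k, hk, h1, h2⟩ := FormalCR.exists_inverse hc hJ
  have h3 : ∀ f : MvPowerSeries (Fin 3) ℂ, subst (graphMap φ H) (subst k f) = f := fun f => by
    rw [subst_comp_subst_apply (hasSubst hk) (hasSubst hc), funext h2, subst_X_eq]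
  have h4 : ∀ f : MvPowerSeries (Fin 3) ℂ, subst k (subst (graphMap φ H) f) = f := fun f => by
    rw [subst_comp_subst_apply (hasSubst hc) (hasSubst hk), funext h1, subst_X_eq]
  refine ⟨subst k (imPart (restrict φ H.G)), ⟨?_, ?_⟩, ?_⟩
  · exact constantCoeff_subst_eq_zero (hasSubst hk) hk
      (imPart_constantCoeff (restrict_constantCoeff hφ.zero H.G_zero))
  · rw [← h4 (FormalCR.conj _), ← conj_subst_graphMap hφ.zero, h3, conj_imPart]
  · rw [sends_iff, h3]

end FormalMap

end Maps

/-! ### Normal coordinates -/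

section Normal

namespace FormalMap

/-- The map `(z, w) ↦ (z, w + q(z, w))`. -/
noncomputable def shear (q : MvPowerSeries (Fin 2) ℂ) (hq : constantCoeff q = 0) : FormalMap where
  F := X 0
  G := X 1 + q
  F_zero := by simp
  G_zero := by simp [hq]

theorem jacobian_of_F_eq_X0 {Φ : FormalMap} (hF : Φ.F = X 0) :
    Φ.jacobian 0 0 = 1 ∧ Φ.jacobian 0 1 = 0 := by
  constructor
  · change coeff (Finsupp.single 0 1) Φ.F = 1
    rw [hF]; simp
  · change coeff (Finsupp.single 1 1) Φ.F = 0
    rw [hF, coeff_X, if_neg]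
    rw [Finsupp.single_left_inj one_ne_zero]
    decide

theorem det_of_F_eq_X0 {Φ : FormalMap} (hF : Φ.F = X 0) :
    Φ.jacobian.det = Φ.jacobian 1 1 := by
  obtain ⟨h1, h2⟩ := jacobian_of_F_eq_X0 hF
  rw [Matrix.det_fin_two, h1, h2]
  ring

theorem jacobian_shear (q : MvPowerSeries (Fin 2) ℂ) (hq : constantCoeff q = 0) :
    (shear q hq).jacobian 1 1 = 1 + coeff (Finsupp.single 1 1) q := by
  change coeff (Finsupp.single 1 1) (X 1 + q) = _
  rw [map_add]; simp

/-- When the first component of `Φ` is `z`, this variable is a mere parameter, and the second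
components invert each other as functions of `w`. The form with arbitrary arguments allows
evaluation on complexified points of a hypersurface. -/
theorem subst_G_subst_G {Φ Ψ : FormalMap} (hF : Φ.F = X 0) (h : Ψ.comp Φ = id) {τ : Type*}
    [Finite τ] {x y : MvPowerSeries τ ℂ} (hx : constantCoeff x = 0) (hy : constantCoeff y = 0) :
    subst ![x, subst ![x, y] Φ.G] Ψ.G = y := by
  have hv : ∀ i, constantCoeff (![x, y] i) = 0 := Fin.forall_fin_two.mpr ⟨hx, hy⟩
  have h1 : subst ![Φ.F, Φ.G] Ψ.G = X 1 := congrArg FormalMap.G h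
  have h2 := congrArg (subst ![x, y]) h1
  rw [subst_vec2 hv Φ.F_zero Φ.G_zero, subst_X (hasSubst hv), hF, subst_X (hasSubst hv)] at h2
  exact h2

end FormalMap

open FormalMap

theorem coeff_single_eq (f : MvPowerSeries (Fin 3) ℂ) :
    coeff (Finsupp.single 0 1) f = coeff₃ 1 0 0 f ∧
    coeff (Finsupp.single 1 1) f = coeff₃ 0 1 0 f ∧
    coeff (Finsupp.single 2 1) f = coeff₃ 0 0 1 f := by
  simp [coeff₃]

theorem coeff₃_001_restrict {φ : MvPowerSeries (Fin 3) ℂ} (hφ : constantCoeff φ = 0)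
    (f : MvPowerSeries (Fin 2) ℂ) :
    coeff₃ 0 0 1 (restrict φ f) =
      coeff (Finsupp.single 1 1) f * (1 + Complex.I * coeff₃ 0 0 1 φ) := by
  rw [← (coeff_single_eq _).2.2, restrict,
    coeff_subst_of_degree_eq_one (restrict_const hφ) _ (Finsupp.degree_single _ _),
    Fin.sum_univ_two, ← (coeff_single_eq _).2.2]
  simp [coeff_X, Finsupp.single_left_inj]

theorem conj_coeff₃_of_hermitian {φ : MvPowerSeries (Fin 3) ℂ} (hφ : conj φ = φ) (a b c : ℕ) :
    starRingEnd ℂ (coeff₃ a b c φ) = coeff₃ b a c φ := by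
  conv_rhs => rw [← hφ, coeff₃_conj]

theorem one_add_I_mul_ne_zero {x : ℂ} (hx : starRingEnd ℂ x = x) : 1 + Complex.I * x ≠ 0 := by
  rw [Complex.conj_eq_iff_im] at hx
  intro h
  have := congrArg Complex.re h
  simp [hx] at this

/-- In suitable coordinates `(z, w')`, the graphing series satisfies `φ(z, 0, u) = 0`. -/
theorem exists_normal_coordinates {φ : MvPowerSeries (Fin 3) ℂ} (hφ : IsHypersurface φ) :
    ∃ (H : FormalMap) (φ' : MvPowerSeries (Fin 3) ℂ), IsCoordinateChange H φ φ' ∧ H.F = X 0 ∧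
      subst ![X 0, 0, X 2] φ' = (0 : MvPowerSeries (Fin 3) ℂ) := by
  have hφ0 := hφ.zero
  set c := coeff₃ 0 0 1 φ with hc
  have hcr : starRingEnd ℂ c = c := conj_coeff₃_of_hermitian hφ.hermitian 0 0 1
  have hc1 : 1 + Complex.I * c ≠ 0 := one_add_I_mul_ne_zero hcr
  have hc2 : 1 - Complex.I * c ≠ 0 := by
    have := one_add_I_mul_ne_zero (x := -c) (by rw [map_neg, hcr])
    rwa [mul_neg, ← sub_eq_add_neg] at this
  have hv0 : ∀ i, constantCoeff ((![X 0, 0, X 1] : Fin 3 → MvPowerSeries (Fin 2) ℂ) i) = 0 := by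
    simp [Fin.forall_fin_succ]
  have hv1 : ∀ i, constantCoeff ((![0, 0, X 1] : Fin 3 → MvPowerSeries (Fin 2) ℂ) i) = 0 := by
    simp [Fin.forall_fin_succ]
  set q₀ : MvPowerSeries (Fin 2) ℂ := subst ![X 0, 0, X 1] φ with hq₀
  set q₁ : MvPowerSeries (Fin 2) ℂ := subst ![0, 0, X 1] φ with hq₁
  have hq₀0 : constantCoeff q₀ = 0 := constantCoeff_subst_eq_zero (hasSubst hv0) hv0 hφ0
  have hq₁0 : constantCoeff q₁ = 0 := constantCoeff_subst_eq_zero (hasSubst hv1) hv1 hφ0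
  have hq₀c : coeff (Finsupp.single 1 1) q₀ = c := by
    rw [hq₀, coeff_subst_of_degree_eq_one hv0 _ (Finsupp.degree_single _ _), Fin.sum_univ_three,
      hc, ← (coeff_single_eq _).2.2]
    simp [coeff_X, Finsupp.single_left_inj]
  have hq₁c : coeff (Finsupp.single 1 1) q₁ = c := by
    rw [hq₁, coeff_subst_of_degree_eq_one hv1 _ (Finsupp.degree_single _ _), Fin.sum_univ_three,
      hc, ← (coeff_single_eq _).2.2]
    simp
  -- On `M` with `z̄ = 0` one has `w = K₃(z, u)` and `w̄ = K₁(z, u)`, so `w = K₃ ∘ K₁⁻¹` evaluated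
  -- at `(z, w̄)`. The new coordinate is defined by `w = K(z, w')` with `K = K₃ ∘ K₁⁻¹ ∘ K₂`. Since
  -- `K̄(0, t) = K₂(z, t)`, the relation on `z̄ = 0` becomes `K(z, w') = K(z, w̄')`, that is, `w' =
  -- w̄'`.
  let K₁ := shear (-(C Complex.I * q₀)) (by simp [hq₀0])
  let K₂ := shear (-(C Complex.I * q₁)) (by simp [hq₁0])
  let K₃ := shear (C Complex.I * q₀) (by simp [hq₀0])
  have hK₁F : K₁.F = X 0 := rfl
  have hK₁i : K₁.Invertible := by
    rw [FormalMap.Invertible, det_of_F_eq_X0 rfl, jacobian_shear, map_neg, coeff_C_mul, hq₀c]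
    exact hc2
  obtain ⟨K₁', h11, h11'⟩ := hK₁i.exists_inverse
  let L := K₁'.comp K₂
  have hL : K₁.comp L = K₂ := by rw [← comp_assoc, h11, id_comp]
  have hLF : L.F = X 0 := by
    have h1 : subst ![L.F, L.G] K₁.F = K₂.F := congrArg FormalMap.F hL
    rwa [hK₁F, subst_X (hasSubst L.vec_const)] at h1
  have hLw : L.jacobian 1 1 = 1 := by
    have h1 : (K₁.jacobian * L.jacobian) 1 1 = K₂.jacobian 1 1 := by
      rw [← jacobian_comp, hL]
    rw [Matrix.mul_apply, Fin.sum_univ_two, (jacobian_of_F_eq_X0 hLF).2, jacobian_shear,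
      jacobian_shear, map_neg, map_neg, coeff_C_mul, coeff_C_mul, hq₀c, hq₁c] at h1
    have h2 : (1 - Complex.I * c) * (L.jacobian 1 1 - 1) = 0 := by linear_combination h1
    exact sub_eq_zero.mp ((mul_eq_zero.mp h2).resolve_left hc2)
  let K := K₃.comp L
  have hKF : K.F = X 0 := by
    change subst ![L.F, L.G] (X 0) = _
    rw [subst_X (hasSubst L.vec_const)]
    exact hLF
  have hKw : K.jacobian 1 1 = 1 + Complex.I * c := by
    rw [jacobian_comp, Matrix.mul_apply, Fin.sum_univ_two, (jacobian_of_F_eq_X0 hLF).2, hLw,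
      jacobian_shear, coeff_C_mul, hq₀c]
    ring
  have hKi : K.Invertible := by
    rw [FormalMap.Invertible, det_of_F_eq_X0 hKF, hKw]
    exact hc1
  obtain ⟨H, hKH, hHK⟩ := hKi.exists_inverse
  have hHF : H.F = X 0 := by
    have h1 : subst ![H.F, H.G] K.F = X 0 := congrArg FormalMap.F hKH
    rwa [hKF, subst_X (hasSubst H.vec_const)] at h1
  have hHw : (1 + Complex.I * c) * H.jacobian 1 1 = 1 := by
    have h1 : (K.jacobian * H.jacobian) 1 1 = 1 := by
      rw [← jacobian_comp, hKH, jacobian_id, Matrix.one_apply_eq]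
    rwa [Matrix.mul_apply, Fin.sum_univ_two, (jacobian_of_F_eq_X0 hHF).2, hKw, mul_zero,
      zero_add] at h1
  -- The factor `1 + i c` in `K_w(0)` was arranged so that `Re H.G` has `u`-derivative `1` at the
  -- origin. Hence the image is again a graph.
  have hJ : IsUnit (jac (graphMap φ H)).det := by
    have h0 : graphMap φ H = ![X 0, X 1, rePart (restrict φ H.G)] := by
      rw [graphMap, hHF, restrict_X0 hφ0, conj_X0]
    have h2 : coeff₃ 0 0 1 (rePart (restrict φ H.G)) = 1 := by
      have h3 : coeff₃ 0 0 1 (restrict φ H.G) = 1 := by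
        rw [coeff₃_001_restrict hφ0, mul_comm]
        exact hHw
      have h4 : coeff₃ 0 0 1 (conj (restrict φ H.G)) = 1 := by
        rw [coeff₃_conj, h3, map_one]
      rw [coeff₃_eq] at *
      rw [rePart, coeff_C_mul, map_add, h3, h4]
      norm_num
    rw [← (coeff_single_eq _).2.2] at h2
    rw [h0, Matrix.det_fin_three]
    simp [jac, h2, coeff_X, Finsupp.single_left_inj]
  obtain ⟨φ', hφ', hs⟩ := exists_sends hφ H hJ
  refine ⟨H, φ', ⟨invertible_of_comp_eq_id hHK, hφ', hs⟩, hHF, ?_⟩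
  have hKs : K.Sends φ' φ := hs.inverse hφ hφ'.zero hKH
  have hv : ∀ i, constantCoeff ((![X 0, 0, X 2] : Fin 3 → MvPowerSeries (Fin 3) ℂ) i) = 0 := by
    simp [Fin.forall_fin_succ]
  have he := hasSubst hv
  set p : MvPowerSeries (Fin 3) ℂ := subst ![X 0, 0, X 2] φ' with hp
  have hp0 : constantCoeff p = 0 := constantCoeff_subst_eq_zero he hv hφ'.zero
  -- `t` is the value of `w̄'` on `z̄ = 0`, as `X 2 + i p` is that of `w'`. The goal is `p = 0`.
  set t : MvPowerSeries (Fin 3) ℂ := X 2 - C Complex.I * p with ht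
  have ht0 : constantCoeff t = 0 := by simp [ht, hp0]
  set A := restrict φ' K.G with hA
  have hA0 : constantCoeff A = 0 := restrict_constantCoeff hφ'.zero K.G_zero
  set Y : MvPowerSeries (Fin 3) ℂ := subst ![X 0, 0, X 2] (rePart A) with hY
  have hY0 : constantCoeff Y = 0 := constantCoeff_subst_eq_zero he hv (rePart_constantCoeff hA0)
  set v : MvPowerSeries (Fin 3) ℂ := subst ![X 0, 0, X 2] (imPart A) with hv'
  have hv3 : v = subst ![X 0, 0, Y] φ := by
    rw [hv', sends_iff.mp hKs, graphMap, hKF, restrict_X0 hφ'.zero, conj_X0,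
      subst_vec3 hv (by simp) (by simp) (rePart_constantCoeff hA0), subst_X he, subst_X he]
    rfl
  have hYv : Y + C Complex.I * v = subst ![X 0, X 2 + C Complex.I * p] K.G := by
    rw [hY, hv', ← subst_C (a := ![X 0, 0, X 2]), ← subst_mul he, ← subst_add he,
      rePart_add_imPart, hA, restrict, subst_vec2 hv (by simp) (by simp [hφ'.zero]), subst_X he,
      subst_add he, subst_mul he, subst_X he, subst_C]
    rfl
  have hYv' : Y - C Complex.I * v =
      subst ![0, t] (MvPowerSeries.map (starRingEnd ℂ) K.G) := by
    rw [hY, hv', ← subst_C (a := ![X 0, 0, X 2]), ← subst_mul he, ← subst_sub he,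
      rePart_sub_imPart, hA, restrict, conj_subst2 (by simp) (by simp [hφ'.zero]),
      conj_X2_add hφ'.hermitian, conj_X0, subst_vec2 hv (by simp) (by simp [hφ'.zero]),
      subst_X he, subst_sub he, subst_mul he, subst_X he, subst_C]
    rfl
  have hK₁G : ∀ {y : MvPowerSeries (Fin 3) ℂ}, constantCoeff y = 0 →
      subst ![X 0, y] K₁.G = y - C Complex.I * subst ![X 0, 0, y] φ := by
    intro y hy
    have hxy : ∀ i, constantCoeff ((![X 0, y] : Fin 2 → MvPowerSeries (Fin 3) ℂ) i) = 0 :=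
      Fin.forall_fin_two.mpr ⟨by simp, hy⟩
    have h := hasSubst hxy
    change subst ![X 0, y] (X 1 + -(C Complex.I * q₀)) = _
    rw [← sub_eq_add_neg, subst_sub h, subst_mul h, subst_X h, subst_C, hq₀,
      subst_vec3 hxy (by simp) (by simp) (by simp), subst_X h, subst_X h, subst_zero_series]
    rfl
  have hK₃G : ∀ {y : MvPowerSeries (Fin 3) ℂ}, constantCoeff y = 0 →
      subst ![X 0, y] K₃.G = y + C Complex.I * subst ![X 0, 0, y] φ := by
    intro y hy
    have hxy : ∀ i, constantCoeff ((![X 0, y] : Fin 2 → MvPowerSeries (Fin 3) ℂ) i) = 0 :=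
      Fin.forall_fin_two.mpr ⟨by simp, hy⟩
    have h := hasSubst hxy
    change subst ![X 0, y] (X 1 + (C Complex.I * q₀)) = _
    rw [subst_add h, subst_mul h, subst_X h, subst_C, hq₀,
      subst_vec3 hxy (by simp) (by simp) (by simp), subst_X h, subst_X h, subst_zero_series]
    rfl
  -- the curve `z = 0`
  have h01 : ∀ i, constantCoeff ((![0, X 1] : Fin 2 → MvPowerSeries (Fin 2) ℂ) i) = 0 := by
    simp [Fin.forall_fin_two]
  have hs01 := hasSubst h01
  have hq : subst ![0, X 1] q₀ = q₁ := by
    rw [hq₀, subst_vec3 h01 (by simp) (by simp) (by simp), subst_X hs01, subst_X hs01,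
      subst_zero_series]
    rfl
  have hq' : subst ![0, X 1] q₁ = q₁ := by
    conv_lhs => rw [hq₁, subst_vec3 h01 (by simp) (by simp) (by simp), subst_X hs01,
      subst_zero_series]
    rfl
  have hK₁c : subst ![0, X 1] K₁.G = X 1 + -(C Complex.I * q₁) := by
    change subst ![0, X 1] (X 1 + -(C Complex.I * q₀)) = _
    rw [← sub_eq_add_neg, subst_sub hs01, subst_mul hs01, subst_X hs01, subst_C, hq,
      ← sub_eq_add_neg]
    rfl
  have hK₂c : subst ![0, X 1] K₂.G = X 1 + -(C Complex.I * q₁) := by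
    change subst ![0, X 1] (X 1 + -(C Complex.I * q₁)) = _
    rw [← sub_eq_add_neg, subst_sub hs01, subst_mul hs01, subst_X hs01, subst_C, hq']
    rfl
  have hLc : subst ![(0 : MvPowerSeries (Fin 2) ℂ), X 1] L.G = X 1 := by
    change subst ![0, X 1] (subst ![X 0, K₂.G] K₁'.G) = _
    rw [subst_vec2 h01 (by simp) K₂.G_zero, subst_X hs01, hK₂c, ← hK₁c]
    exact subst_G_subst_G hK₁F h11' (by simp) (by simp)
  have hKc : subst ![(0 : MvPowerSeries (Fin 2) ℂ), X 1] K.G = X 1 + C Complex.I * q₁ := by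
    change subst ![0, X 1] (subst ![L.F, L.G] (X 1 + C Complex.I * q₀)) = _
    rw [hLF, subst_vec2 h01 (by simp) L.G_zero, subst_X hs01, hLc]
    change subst ![0, X 1] _ = _
    rw [subst_add hs01, subst_mul hs01, subst_X hs01, subst_C, hq]
    rfl
  -- `q₁` involves only coefficients `φ₀₀c`, which are real because `φ` is Hermitian.
  have hq₁r : MvPowerSeries.map (starRingEnd ℂ) q₁ = q₁ := by
    have h1 : MvPowerSeries.map (starRingEnd ℂ) φ = subst ![X 1, X 0, X 2] φ := by
      conv_lhs => rw [← hφ.hermitian]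
      rw [conj, map_star_map_star]
    rw [hq₁, map_subst (hasSubst hv1), h1,
      subst_comp_subst_apply (hasSubst swap_const) (hasSubst _)]
    · congr 1
      funext i
      have h2 : (fun i => MvPowerSeries.map (starRingEnd ℂ)
          ((![0, 0, X 1] : Fin 3 → MvPowerSeries (Fin 2) ℂ) i)) = ![0, 0, X 1] := by
        funext i; fin_cases i <;> simp
      rw [h2]
      fin_cases i
      · exact subst_X (hasSubst hv1) 1
      · exact subst_X (hasSubst hv1) 0
      · exact subst_X (hasSubst hv1) 2
    · intro i; fin_cases i <;> simp
  have hKt : subst ![0, t] (MvPowerSeries.map (starRingEnd ℂ) K.G) = subst ![X 0, t] K₂.G := by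
    have hxt : ∀ i, constantCoeff ((![X 0, t] : Fin 2 → MvPowerSeries (Fin 3) ℂ) i) = 0 :=
      Fin.forall_fin_two.mpr ⟨by simp, ht0⟩
    have h1 : subst ![0, X 1] (MvPowerSeries.map (starRingEnd ℂ) K.G) = K₂.G := by
      have h2 := congrArg (MvPowerSeries.map (starRingEnd ℂ)) hKc
      rw [map_subst hs01] at h2
      have h3 : (fun i => MvPowerSeries.map (starRingEnd ℂ)
          ((![0, X 1] : Fin 2 → MvPowerSeries (Fin 2) ℂ) i)) = ![0, X 1] := by
        funext i; fin_cases i <;> simp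
      rw [h3, map_add, map_mul, hq₁r, map_X, map_C, Complex.conj_I, map_neg, neg_mul] at h2
      exact h2
    rw [← h1, subst_vec2 hxt (by simp) (by simp), subst_X (hasSubst hxt), subst_zero_series]
    rfl
  have hYL : Y = subst ![X 0, t] L.G := by
    have hxt : ∀ i, constantCoeff ((![X 0, t] : Fin 2 → MvPowerSeries (Fin 3) ℂ) i) = 0 :=
      Fin.forall_fin_two.mpr ⟨by simp, ht0⟩
    rw [← subst_G_subst_G hK₁F h11' (x := X 0) (by simp) hY0, hK₁G hY0, ← hv3, hYv', hKt]
    change _ = subst ![X 0, t] (subst ![X 0, K₂.G] K₁'.G)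
    rw [subst_vec2 hxt (by simp) K₂.G_zero, subst_X (hasSubst hxt)]
    rfl
  -- This is `K(z, w') = K(z, w̄')` on `z̄ = 0`. Applying the inverse `H` gives `u + i p = u - i p`.
  have hfin : subst ![X 0, X 2 + C Complex.I * p] K.G = subst ![X 0, t] K.G := by
    have hxt : ∀ i, constantCoeff ((![X 0, t] : Fin 2 → MvPowerSeries (Fin 3) ℂ) i) = 0 :=
      Fin.forall_fin_two.mpr ⟨by simp, ht0⟩
    rw [← hYv, hv3, ← hK₃G hY0, hYL]
    change _ = subst ![X 0, t] (subst ![L.F, L.G] K₃.G)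
    rw [hLF, subst_vec2 hxt (by simp) L.G_zero, subst_X (hasSubst hxt)]
    rfl
  have h1 := subst_G_subst_G hKF hHK (x := (X 0 : MvPowerSeries (Fin 3) ℂ))
    (y := X 2 + C Complex.I * p) (by simp) (by simp [hp0])
  have h2 := subst_G_subst_G hKF hHK (x := (X 0 : MvPowerSeries (Fin 3) ℂ)) (y := t) (by simp) ht0
  rw [hfin, h2, ht] at h1
  have h3 : (C Complex.I + C Complex.I) * p = 0 := by linear_combination -h1
  rw [← map_add] at h3
  refine (mul_eq_zero.mp h3).resolve_left ?_
  rw [← two_mul]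
  simp

end Normal

open FormalMap

/-! ### Infinite type -/

section InfiniteType

/-- A power series in one variable, as a series in the `i`-th of two variables. -/
noncomputable def inVar (i : Fin 2) (Γ : PowerSeries ℂ) : MvPowerSeries (Fin 2) ℂ :=
  PowerSeries.subst (X i : MvPowerSeries (Fin 2) ℂ) Γ

theorem coeff_inVar (i : Fin 2) (Γ : PowerSeries ℂ) (e : Fin 2 →₀ ℕ) :
    coeff e (inVar i Γ) = if e = Finsupp.single i (e i) then PowerSeries.coeff (e i) Γ else 0 :=
  PowerSeries.coeff_subst_single i Γ e

theorem constantCoeff_inVar (i : Fin 2) (Γ : PowerSeries ℂ) :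
    constantCoeff (inVar i Γ) = PowerSeries.constantCoeff Γ := by
  rw [← coeff_zero_eq_constantCoeff_apply, coeff_inVar]
  simp

theorem inVar_const (i : Fin 2) (_ : Unit) :
    constantCoeff (X i : MvPowerSeries (Fin 2) ℂ) = 0 := by simp

theorem inVar_mul (i : Fin 2) (f g : PowerSeries ℂ) :
    inVar i (f * g) = inVar i f * inVar i g := PowerSeries.subst_mul (PowerSeries.HasSubst.X i) f g

theorem inVar_injective (i : Fin 2) {Γ : PowerSeries ℂ} (h : inVar i Γ = 0) : Γ = 0 := by
  ext n
  have := congrArg (coeff (Finsupp.single i n)) h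
  rw [coeff_inVar] at this
  simpa using this

theorem inVar_subst (i : Fin 2) {Γ₁ Γ₂ : PowerSeries ℂ} (h₁ : PowerSeries.constantCoeff Γ₁ = 0)
    (h₂ : PowerSeries.constantCoeff Γ₂ = 0) (f : MvPowerSeries (Fin 2) ℂ) :
    inVar i (subst ![Γ₁, Γ₂] f) = subst ![inVar i Γ₁, inVar i Γ₂] f :=
  subst_vec2 (τ := Unit) (inVar_const i) h₁ h₂ f

theorem exists_inVar_eq (i : Fin 2) {Γ : PowerSeries ℂ} (hΓ : Γ ≠ 0)
    (h0 : PowerSeries.constantCoeff Γ = 0) :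
    ∃ m v, 1 ≤ m ∧ inVar i Γ = X i ^ m * v ∧ constantCoeff v ≠ 0 := by
  refine ⟨Γ.order.toNat, inVar i Γ.divXPowOrder, ?_, ?_, ?_⟩
  · by_contra h
    have h1 : Γ.order.toNat = 0 := by omega
    have h2 := PowerSeries.coeff_order hΓ
    rw [h1, PowerSeries.coeff_zero_eq_constantCoeff_apply] at h2
    exact h2 h0
  · conv_lhs => rw [← PowerSeries.X_pow_order_mul_divXPowOrder (f := Γ)]
    rw [inVar_mul]
    congr 1
    rw [inVar, PowerSeries.subst_pow (PowerSeries.HasSubst.X i),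
      PowerSeries.subst_X (PowerSeries.HasSubst.X i)]
  · rw [constantCoeff_inVar]
    intro h
    exact hΓ (PowerSeries.constantCoeff_divXPowOrder_eq_zero_iff.mp h)

/-- The monomial `z ^ a * z̄ ^ b` contributes the unit multiple `v ^ a * w ^ b` of `X 0 ^ (m * a) *
X 1 ^ (n * b)`. At this exponent the other contributions come only from monomials dividing `z ^ a *
z̄ ^ b`, and their coefficients are zero by induction on `a + b`. -/
theorem coeff₃_eq_zero_of_subst_eq_zero {f : MvPowerSeries (Fin 3) ℂ} {m n : ℕ}
    {v w : MvPowerSeries (Fin 2) ℂ} (hm : 1 ≤ m) (hn : 1 ≤ n) (hv : constantCoeff v ≠ 0)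
    (hw : constantCoeff w ≠ 0) (h : subst ![X 0 ^ m * v, X 1 ^ n * w, 0] f = 0) (a b : ℕ) :
    coeff₃ a b 0 f = 0 := by
  have hc : ∀ i, constantCoeff
      ((![X 0 ^ m * v, X 1 ^ n * w, 0] : Fin 3 → MvPowerSeries (Fin 2) ℂ) i) = 0 := by
    have hm' : m ≠ 0 := by omega
    have hn' : n ≠ 0 := by omega
    simp [Fin.forall_fin_succ, hm', hn']
  obtain ⟨N, hN⟩ : ∃ N, a + b = N := ⟨_, rfl⟩
  induction N using Nat.strong_induction_on generalizing a b with
  | _ N ih =>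
    set e : Fin 2 →₀ ℕ := Finsupp.single 0 (m * a) + Finsupp.single 1 (n * b) with he
    have h1 := congrArg (coeff e) h
    rw [coeff_subst (hasSubst hc), finsum_eq_single _ (expo a b 0), map_zero] at h1
    · rw [Finsupp.prod_fintype _ _ (fun i => pow_zero _), Fin.prod_univ_three] at h1
      simp only [expo_zero, expo_one, expo_two, Matrix.cons_val_zero, Matrix.cons_val_one,
        Matrix.cons_val, pow_zero, mul_one, mul_pow, ← pow_mul] at h1
      have h2 : (X 0 ^ (m * a) * v ^ a * (X 1 ^ (n * b) * w ^ b) : MvPowerSeries (Fin 2) ℂ) =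
          monomial e 1 * (v ^ a * w ^ b) := by
        rw [he, ← one_mul (1 : ℂ), ← monomial_mul_monomial, ← X_pow_eq, ← X_pow_eq]
        ring
      have h3 := coeff_add_monomial_mul e 0 (v ^ a * w ^ b) (1 : ℂ)
      rw [add_zero] at h3
      rw [h2, h3, one_mul, coeff_zero_eq_constantCoeff_apply, map_mul, map_pow, map_pow, smul_eq_mul] at h1
      exact (mul_eq_zero.mp h1).resolve_right (mul_ne_zero (pow_ne_zero _ hv) (pow_ne_zero _ hw))
    · intro d hd
      rw [Finsupp.prod_fintype _ _ (fun i => pow_zero _), Fin.prod_univ_three]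
      simp only [Matrix.cons_val_zero, Matrix.cons_val_one, Matrix.cons_val]
      by_cases hd2 : d 2 = 0
      · by_cases hd0 : d 0 ≤ a
        · by_cases hd1 : d 1 ≤ b
          · have h3 : coeff d f = 0 := by
              rw [← expo_eq d, hd2]
              refine ih (d 0 + d 1) ?_ _ _ rfl
              rw [← hN]
              by_contra h4
              apply hd
              rw [← expo_eq d, hd2, expo_inj]
              omega
            rw [h3, zero_smul]
          · have h3 : (X 1 : MvPowerSeries (Fin 2) ℂ) ^ (n * d 1) ∣
                (X 0 ^ m * v) ^ d 0 * (X 1 ^ n * w) ^ d 1 * 0 ^ d 2 := by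
              rw [mul_pow (X 1 ^ n), ← pow_mul]
              exact Dvd.dvd.mul_right (Dvd.dvd.mul_left (Dvd.intro _ rfl) _) _
            rw [X_pow_dvd_iff.mp h3, smul_zero]
            simp only [he, Finsupp.add_apply, Finsupp.single_apply]
            simp only [zero_ne_one, if_false, if_true, zero_add]
            exact Nat.mul_lt_mul_of_pos_left (not_le.mp hd1) hn
        · have h3 : (X 0 : MvPowerSeries (Fin 2) ℂ) ^ (m * d 0) ∣
              (X 0 ^ m * v) ^ d 0 * (X 1 ^ n * w) ^ d 1 * 0 ^ d 2 := by
            rw [mul_pow (X 0 ^ m), ← pow_mul]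
            exact Dvd.dvd.mul_right (Dvd.dvd.mul_right (Dvd.intro _ rfl) _) _
          rw [X_pow_dvd_iff.mp h3, smul_zero]
          simp only [he, Finsupp.add_apply, Finsupp.single_apply]
          simp only [one_ne_zero, if_false, if_true, add_zero]
          exact Nat.mul_lt_mul_of_pos_left (not_le.mp hd0) hm
      · rw [zero_pow hd2, mul_zero, map_zero, smul_zero]

theorem isInfiniteType_iff {φ : MvPowerSeries (Fin 3) ℂ} : IsInfiniteType φ ↔
    ∃ Γ₁ Γ₂ : PowerSeries ℂ,
      PowerSeries.constantCoeff Γ₁ = 0 ∧ PowerSeries.constantCoeff Γ₂ = 0 ∧ (Γ₁ ≠ 0 ∨ Γ₂ ≠ 0) ∧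
      C (1 / (2 * Complex.I) : ℂ) *
        (inVar 0 Γ₂ - inVar 1 (PowerSeries.map (starRingEnd ℂ) Γ₂)) =
        subst ![inVar 0 Γ₁, inVar 1 (PowerSeries.map (starRingEnd ℂ) Γ₁),
          C (1 / 2 : ℂ) * (inVar 0 Γ₂ + inVar 1 (PowerSeries.map (starRingEnd ℂ) Γ₂))] φ := Iff.rfl

theorem IsInfiniteType.of_sends {φ φ' : MvPowerSeries (Fin 3) ℂ} (h : IsInfiniteType φ)
    (hφ : IsHypersurface φ) {H : FormalMap} (hH : H.Invertible) (hs : H.Sends φ φ') :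
    IsInfiniteType φ' := by
  rw [isInfiniteType_iff] at *
  obtain ⟨Γ₁, Γ₂, h1, h2, h12, hΓ⟩ := h
  have hv : ∀ i, constantCoeff ((![Γ₁, Γ₂] : Fin 2 → MvPowerSeries Unit ℂ) i) = 0 :=
    Fin.forall_fin_two.mpr ⟨h1, h2⟩
  have hz : ∀ {f : MvPowerSeries (Fin 2) ℂ}, constantCoeff f = 0 →
      PowerSeries.constantCoeff (subst ![Γ₁, Γ₂] f : MvPowerSeries Unit ℂ) = 0 := fun hf =>
    constantCoeff_subst_eq_zero (hasSubst hv) hv hf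
  refine ⟨subst ![Γ₁, Γ₂] H.F, subst ![Γ₁, Γ₂] H.G, hz H.F_zero, hz H.G_zero, ?_, ?_⟩
  · by_contra hcon
    push Not at hcon
    obtain ⟨hF, hG⟩ := hcon
    -- If the image curve were zero, applying the inverse of `H` to it would make the original curve
    -- zero.
    obtain ⟨K, -, hK⟩ := hH.exists_inverse
    have hzz : (![0, 0] : Fin 2 → MvPowerSeries Unit ℂ) = 0 := by
      funext i; fin_cases i <;> rfl
    have key : ∀ f : MvPowerSeries (Fin 2) ℂ, constantCoeff f = 0 →
        subst ![Γ₁, Γ₂] (subst ![H.F, H.G] f) = 0 := by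
      intro f hf
      rw [subst_vec2 hv H.F_zero H.G_zero, hF, hG, hzz, subst_zero_of_constantCoeff_zero hf]
    have e1 := key K.F K.F_zero
    have e2 := key K.G K.G_zero
    rw [show subst ![H.F, H.G] K.F = X 0 from congrArg FormalMap.F hK,
      subst_X (hasSubst hv)] at e1
    rw [show subst ![H.F, H.G] K.G = X 1 from congrArg FormalMap.G hK,
      subst_X (hasSubst hv)] at e2
    rcases h12 with h | h
    · exact h e1
    · exact h e2
  · set Γ₁' := PowerSeries.map (starRingEnd ℂ) Γ₁ with hΓ₁'
    set Γ₂' := PowerSeries.map (starRingEnd ℂ) Γ₂ with hΓ₂'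
    have h1' : PowerSeries.constantCoeff Γ₁' = 0 := by
      rw [hΓ₁', ← PowerSeries.coeff_zero_eq_constantCoeff_apply, PowerSeries.coeff_map,
        PowerSeries.coeff_zero_eq_constantCoeff_apply, h1, map_zero]
    have h2' : PowerSeries.constantCoeff Γ₂' = 0 := by
      rw [hΓ₂', ← PowerSeries.coeff_zero_eq_constantCoeff_apply, PowerSeries.coeff_map,
        PowerSeries.coeff_zero_eq_constantCoeff_apply, h2, map_zero]
    -- `a` parametrizes the curve in the coordinates `(z, z̄, u)`, with `t` and `t̄` independent.
    -- Along it `w` and `w̄` become `Γ₂(t)` and `Γ̄₂(t̄)`, so pulling the equation of `H` back by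
    -- `a` gives the equation of the image curve.
    set a : Fin 3 → MvPowerSeries (Fin 2) ℂ :=
      ![inVar 0 Γ₁, inVar 1 Γ₁', C (1 / 2 : ℂ) * (inVar 0 Γ₂ + inVar 1 Γ₂')] with ha
    have hac : ∀ i, constantCoeff (a i) = 0 := by
      simp [ha, Fin.forall_fin_succ, constantCoeff_inVar, h1, h1', h2, h2']
    have has := hasSubst hac
    have hI : (C Complex.I * C (1 / (2 * Complex.I)) : MvPowerSeries (Fin 2) ℂ) = C (1 / 2) := by
      rw [← map_mul]; congr 1; field_simp
    have h22 : (C (1 / 2) + C (1 / 2) : MvPowerSeries (Fin 2) ℂ) = 1 := by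
      rw [← map_add, ← map_one C]; norm_num
    have ha2 : a 2 = C (1 / 2 : ℂ) * (inVar 0 Γ₂ + inVar 1 Γ₂') := rfl
    have hplus : subst a (X 2 + C Complex.I * φ) = inVar 0 Γ₂ := by
      rw [subst_add has, subst_mul has, subst_X has, subst_C, ← hΓ, ha2]
      linear_combination (inVar 0 Γ₂ - inVar 1 Γ₂') * hI + (inVar 0 Γ₂) * h22
    have hminus : subst a (X 2 - C Complex.I * φ) = inVar 1 Γ₂' := by
      rw [subst_sub has, subst_mul has, subst_X has, subst_C, ← hΓ, ha2]
      linear_combination -(inVar 0 Γ₂ - inVar 1 Γ₂') * hI + (inVar 1 Γ₂') * h22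
    have hres : ∀ f : MvPowerSeries (Fin 2) ℂ,
        subst a (restrict φ f) = inVar 0 (subst ![Γ₁, Γ₂] f) := by
      intro f
      rw [restrict, subst_vec2 hac (by simp) (by simp [hφ.zero]), hplus, subst_X has,
        inVar_subst 0 h1 h2]
      rfl
    have hmap : ∀ f : MvPowerSeries (Fin 2) ℂ,
        PowerSeries.map (starRingEnd ℂ) (subst ![Γ₁, Γ₂] f) =
          subst ![Γ₁', Γ₂'] (MvPowerSeries.map (starRingEnd ℂ) f) := by
      intro f
      refine (map_subst (hasSubst hv) f).trans ?_
      congr 1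
      funext i
      fin_cases i <;> rfl
    have hcon : ∀ f : MvPowerSeries (Fin 2) ℂ, subst a (conj (restrict φ f)) =
        inVar 1 (PowerSeries.map (starRingEnd ℂ) (subst ![Γ₁, Γ₂] f)) := by
      intro f
      rw [restrict, conj_subst2 (by simp) (by simp [hφ.zero]), conj_X2_add hφ.hermitian, conj_X0,
        subst_vec2 hac (by simp) (by simp [hφ.zero]), hminus, subst_X has, hmap,
        inVar_subst 1 h1' h2']
      rfl
    have hfin := congrArg (subst a) (sends_iff.mp hs)
    rw [imPart, subst_mul has, subst_sub has, subst_C, hres, hcon, graphMap,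
      subst_vec3 hac (restrict_constantCoeff hφ.zero H.F_zero)
        (by rw [constantCoeff_conj, restrict_constantCoeff hφ.zero H.F_zero, map_zero])
        (rePart_constantCoeff (restrict_constantCoeff hφ.zero H.G_zero)), hres, hcon, rePart,
      subst_mul has, subst_add has, subst_C, hres, hcon] at hfin
    exact hfin

/-- In normal coordinates, a hypersurface of infinite type contains the curve `w = 0`. -/
theorem IsInfiniteType.coeff₃_eq_zero {φ : MvPowerSeries (Fin 3) ℂ} (h : IsInfiniteType φ)
    (hn : subst ![X 0, 0, X 2] φ = (0 : MvPowerSeries (Fin 3) ℂ)) (a b : ℕ) :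
    coeff₃ a b 0 φ = 0 := by
  obtain ⟨Γ₁, Γ₂, h1, h2, h12, hΓ⟩ := isInfiniteType_iff.mp h
  set Γ₁' := PowerSeries.map (starRingEnd ℂ) Γ₁ with hΓ₁'
  set Γ₂' := PowerSeries.map (starRingEnd ℂ) Γ₂ with hΓ₂'
  have h1' : PowerSeries.constantCoeff Γ₁' = 0 := by
    rw [hΓ₁', ← PowerSeries.coeff_zero_eq_constantCoeff_apply, PowerSeries.coeff_map,
      PowerSeries.coeff_zero_eq_constantCoeff_apply, h1, map_zero]
  have h2' : PowerSeries.constantCoeff Γ₂' = 0 := by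
    rw [hΓ₂', ← PowerSeries.coeff_zero_eq_constantCoeff_apply, PowerSeries.coeff_map,
      PowerSeries.coeff_zero_eq_constantCoeff_apply, h2, map_zero]
  have hc : ∀ i, constantCoeff ((![X 0, 0] : Fin 2 → MvPowerSeries (Fin 2) ℂ) i) = 0 := by
    simp [Fin.forall_fin_two]
  have hs := hasSubst hc
  have hhol : ∀ Γ : PowerSeries ℂ, subst ![X 0, 0] (inVar 0 Γ) = inVar 0 Γ := by
    intro Γ
    refine (subst_comp_subst_apply (σ := Unit) (hasSubst (inVar_const 0)) hs Γ).trans ?_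
    rw [subst_X hs]
    rfl
  have hanti : ∀ Γ : PowerSeries ℂ, PowerSeries.constantCoeff Γ = 0 →
      subst ![X 0, 0] (inVar 1 Γ) = (0 : MvPowerSeries (Fin 2) ℂ) := by
    intro Γ hΓ
    refine (subst_comp_subst_apply (σ := Unit) (hasSubst (inVar_const 1)) hs Γ).trans ?_
    rw [subst_X hs]
    exact PowerSeries.subst_zero_of_constantCoeff_zero hΓ
  -- Setting `t̄ = 0` puts `0` in the slot of `z̄`, where `φ` vanishes by normality. What remains is
  -- `Γ₂(t) / (2i) = 0`.
  have hΓ₂ : Γ₂ = 0 := by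
    have e := congrArg (subst ![(X 0 : MvPowerSeries (Fin 2) ℂ), 0]) hΓ
    rw [subst_mul hs, subst_sub hs, subst_C, hhol, hanti _ h2', subst_vec3 hc
      (by rw [constantCoeff_inVar, h1]) (by rw [constantCoeff_inVar, h1'])
      (by simp [constantCoeff_inVar, h2, h2']), hhol, hanti _ h1'] at e
    set y := subst ![(X 0 : MvPowerSeries (Fin 2) ℂ), 0] (C (1 / 2 : ℂ) * (inVar 0 Γ₂ + inVar 1 Γ₂')) with hy
    have hy0 : constantCoeff y = 0 :=
      constantCoeff_subst_eq_zero hs hc (by simp [constantCoeff_inVar, h2, h2'])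
    have hc' : ∀ i, constantCoeff
        ((![inVar 0 Γ₁, 0, y] : Fin 3 → MvPowerSeries (Fin 2) ℂ) i) = 0 := by
      simp [Fin.forall_fin_succ, constantCoeff_inVar, h1, hy0]
    have e2 := congrArg (subst ![inVar 0 Γ₁, 0, y]) hn
    rw [subst_vec3 hc' (by simp) (by simp) (by simp), subst_X (hasSubst hc'),
      subst_X (hasSubst hc'), subst_zero_series] at e2
    have e3 : C (1 / (2 * Complex.I) : ℂ) * (inVar 0 Γ₂ - 0) = 0 := e.trans e2
    rw [sub_zero, mul_eq_zero] at e3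
    refine inVar_injective 0 (e3.resolve_left ?_)
    simp
  have hΓ₂0 : Γ₂' = 0 := by rw [hΓ₂', hΓ₂, map_zero]
  have hΓ₁ : Γ₁ ≠ 0 := h12.resolve_right (by simpa using hΓ₂)
  have hΓ₁0 : Γ₁' ≠ 0 := by
    intro h0
    apply hΓ₁
    ext n
    have := congrArg (PowerSeries.coeff n) h0
    rw [hΓ₁', PowerSeries.coeff_map] at this
    simpa using this
  have hz : ∀ i, inVar i 0 = 0 := fun i =>
    subst_zero_series (σ := Unit) (fun _ => (X i : MvPowerSeries (Fin 2) ℂ))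
  rw [hΓ₂0, hΓ₂, hz, hz, sub_zero, mul_zero, add_zero, mul_zero] at hΓ
  obtain ⟨m, v, hm, hv, hv0⟩ := exists_inVar_eq 0 hΓ₁ h1
  obtain ⟨n, w, hn, hw, hw0⟩ := exists_inVar_eq 1 hΓ₁0 h1'
  rw [hv, hw] at hΓ
  exact coeff₃_eq_zero_of_subst_eq_zero hm hn hv0 hw0 hΓ.symm a b

end InfiniteType

/-! ### The Levi form and its transformation law -/

section Levi

theorem pderiv_comm {σ R : Type*} [CommRing R] (i j : σ) (f : MvPowerSeries σ R) :
    pderiv R i (pderiv R j f) = pderiv R j (pderiv R i f) := by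
  classical
  ext d
  by_cases h : i = j
  · rw [h]
  · rw [coeff_pderiv, coeff_pderiv, coeff_pderiv, coeff_pderiv, add_right_comm]
    simp [h, Ne.symm h]
    ring

theorem C_I_sq : (C Complex.I : MvPowerSeries (Fin 3) ℂ) ^ 2 = -1 := by
  rw [← map_pow, Complex.I_sq, map_neg, map_one]

/-- The coefficient `α` of the vector field `∂_z + α ∂_u` annihilating the restrictions of
antiholomorphic functions. -/
noncomputable def alpha (φ : MvPowerSeries (Fin 3) ℂ) : MvPowerSeries (Fin 3) ℂ :=
  C Complex.I * pderiv ℂ 0 φ * (1 - C Complex.I * pderiv ℂ 2 φ)⁻¹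

/-- The coefficient of the vector field `∂_z̄ + ᾱ ∂_u` annihilating the restrictions of
holomorphic functions. -/
noncomputable def alphaBar (φ : MvPowerSeries (Fin 3) ℂ) : MvPowerSeries (Fin 3) ℂ :=
  -(C Complex.I * pderiv ℂ 1 φ * (1 + C Complex.I * pderiv ℂ 2 φ)⁻¹)

theorem constantCoeff_pderiv_two (φ : MvPowerSeries (Fin 3) ℂ) :
    constantCoeff (pderiv ℂ 2 φ) = coeff₃ 0 0 1 φ := by
  rw [← coeff_zero_eq_constantCoeff_apply, coeff_pderiv, ← (coeff_single_eq _).2.2]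
  simp

theorem constantCoeff_one_add_ne_zero {φ : MvPowerSeries (Fin 3) ℂ} (hφ : conj φ = φ) :
    constantCoeff (1 + C Complex.I * pderiv ℂ 2 φ) ≠ 0 := by
  rw [map_add, map_one, map_mul, constantCoeff_C, constantCoeff_pderiv_two]
  exact one_add_I_mul_ne_zero (conj_coeff₃_of_hermitian hφ 0 0 1)

theorem constantCoeff_one_sub_ne_zero {φ : MvPowerSeries (Fin 3) ℂ} (hφ : conj φ = φ) :
    constantCoeff (1 - C Complex.I * pderiv ℂ 2 φ) ≠ 0 := by
  rw [map_sub, map_one, map_mul, constantCoeff_C, constantCoeff_pderiv_two, sub_eq_add_neg,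
    ← mul_neg]
  refine one_add_I_mul_ne_zero ?_
  rw [map_neg, conj_coeff₃_of_hermitian hφ 0 0 1]

theorem alpha_spec {φ : MvPowerSeries (Fin 3) ℂ} (hφ : conj φ = φ) :
    (1 - C Complex.I * pderiv ℂ 2 φ) * alpha φ = C Complex.I * pderiv ℂ 0 φ := by
  have h := MvPowerSeries.mul_inv_cancel _ (constantCoeff_one_sub_ne_zero hφ)
  rw [alpha]
  linear_combination (C Complex.I * pderiv ℂ 0 φ) * h

theorem alphaBar_spec {φ : MvPowerSeries (Fin 3) ℂ} (hφ : conj φ = φ) :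
    (1 + C Complex.I * pderiv ℂ 2 φ) * alphaBar φ = -(C Complex.I * pderiv ℂ 1 φ) := by
  have h := MvPowerSeries.mul_inv_cancel _ (constantCoeff_one_add_ne_zero hφ)
  rw [alphaBar]
  linear_combination -(C Complex.I * pderiv ℂ 1 φ) * h

/-- The `(1, 0)` vector field `∂_z + α ∂_u`. -/
noncomputable def crField (φ f : MvPowerSeries (Fin 3) ℂ) : MvPowerSeries (Fin 3) ℂ :=
  pderiv ℂ 0 f + alpha φ * pderiv ℂ 2 f

/-- The `(0, 1)` vector field `∂_z̄ + ᾱ ∂_u`. -/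
noncomputable def crFieldBar (φ f : MvPowerSeries (Fin 3) ℂ) : MvPowerSeries (Fin 3) ℂ :=
  pderiv ℂ 1 f + alphaBar φ * pderiv ℂ 2 f

/-- The coefficient of the commutator of the two vector fields. -/
noncomputable def crBracket (φ : MvPowerSeries (Fin 3) ℂ) : MvPowerSeries (Fin 3) ℂ :=
  crField φ (alphaBar φ) - crFieldBar φ (alpha φ)

theorem crField_comm (φ f : MvPowerSeries (Fin 3) ℂ) :
    crField φ (crFieldBar φ f) - crFieldBar φ (crField φ f) = crBracket φ * pderiv ℂ 2 f := by
  simp only [crBracket, crField, crFieldBar, map_add, Derivation.leibniz, smul_eq_mul]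
  rw [pderiv_comm 1 0, pderiv_comm 2 0, pderiv_comm 2 1]
  ring

/-- The letters `z, x, u` stand for `φ_z, φ_z̄, φ_u`, double letters for second derivatives, and `J`
for `i`. The hypotheses are the defining equations of `α` and `β = ᾱ` and their derivatives.
Clearing denominators turns the commutator computation into a polynomial identity. -/
theorem levi_algebra {A : Type*} [CommRing A] {J u z x zx zu xu uu α β αx αu βz βu : A}
    (hJ : J ^ 2 = -1) (e1 : (1 - J * u) * α = J * z)
    (e1x : (1 - J * u) * αx - J * xu * α = J * zx) (e1u : (1 - J * u) * αu - J * uu * α = J * zu)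
    (e2 : (1 + J * u) * β = -(J * x))
    (e2z : (1 + J * u) * βz + J * zu * β = -(J * zx))
    (e2u : (1 + J * u) * βu + J * uu * β = -(J * xu)) :
    ((1 - J * u) * (1 + J * u)) ^ 2 * ((βz + α * βu) - (αx + β * αu)) =
      -(2 * J) * ((1 - J * u) * (1 + J * u) * zx - J * x * (1 - J * u) * zu +
        J * z * (1 + J * u) * xu + z * x * uu) := by
  linear_combination (1 - J * u) ^ 2 * (1 + J * u) * (e2z + α * e2u) -
    (1 - J * u) * (1 + J * u) ^ 2 * (e1x + β * e1u) -
    2 * J * ((1 - J * u) * zu * e2 + (1 + J * u) * xu * e1 +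
      uu * ((1 + J * u) * β * e1 + J * z * e2)) + 2 * J * uu * z * x * hJ

/-- The factor on the left is a unit, so Levi form and commutator generate the same ideal. The
commutator is easier to follow under coordinate changes. -/
theorem crBracket_eq {φ : MvPowerSeries (Fin 3) ℂ} (hφ : conj φ = φ) :
    ((1 - C Complex.I * pderiv ℂ 2 φ) * (1 + C Complex.I * pderiv ℂ 2 φ)) ^ 2 * crBracket φ =
      C (-8 * Complex.I) * leviForm φ := by
  have e1 := alpha_spec hφ
  have e2 := alphaBar_spec hφ
  have e1x := congrArg (pderiv ℂ 1) e1
  have e1u := congrArg (pderiv ℂ 2) e1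
  have e2z := congrArg (pderiv ℂ 0) e2
  have e2u := congrArg (pderiv ℂ 2) e2
  simp only [Derivation.leibniz, map_sub, map_add, map_neg, smul_eq_mul, pderiv_C,
    Derivation.map_one_eq_zero] at e1x e1u e2z e2u
  rw [pderiv_comm 1 2] at e1x
  rw [pderiv_comm 0 1, pderiv_comm 0 2] at e2z
  have key := levi_algebra (J := C Complex.I) (u := pderiv ℂ 2 φ) (z := pderiv ℂ 0 φ)
    (x := pderiv ℂ 1 φ) (zx := pderiv ℂ 1 (pderiv ℂ 0 φ)) (zu := pderiv ℂ 2 (pderiv ℂ 0 φ))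
    (xu := pderiv ℂ 2 (pderiv ℂ 1 φ)) (uu := pderiv ℂ 2 (pderiv ℂ 2 φ))
    (α := alpha φ) (β := alphaBar φ) (αx := pderiv ℂ 1 (alpha φ)) (αu := pderiv ℂ 2 (alpha φ))
    (βz := pderiv ℂ 0 (alphaBar φ)) (βu := pderiv ℂ 2 (alphaBar φ)) C_I_sq e1
    (by linear_combination e1x) (by linear_combination e1u) e2 (by linear_combination e2z)
    (by linear_combination e2u)
  rw [crBracket, crField, crFieldBar, key, leviForm]
  have h2 : (C 2 : MvPowerSeries (Fin 3) ℂ) = 2 := map_ofNat C 2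
  have h8 : (C (-8 * Complex.I) : MvPowerSeries (Fin 3) ℂ) = -8 * C Complex.I := by
    rw [map_mul, map_neg, map_ofNat]
  have h12 : (C (1 / 2) : MvPowerSeries (Fin 3) ℂ) * 2 = 1 := by
    rw [← h2, ← map_mul, ← map_one C]; norm_num
  have h14 : (C (1 / 4) : MvPowerSeries (Fin 3) ℂ) = C (1 / 2) * C (1 / 2) := by
    rw [← map_mul]; norm_num
  rw [h8]
  simp only [h14]
  have hJ := C_I_sq
  generalize (C (1 / 2) : MvPowerSeries (Fin 3) ℂ) = r at *
  generalize (C Complex.I : MvPowerSeries (Fin 3) ℂ) = J at *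
  linear_combination -2 * J * ((1 - pderiv ℂ 2 φ ^ 2) * pderiv ℂ 1 (pderiv ℂ 0 φ) +
      pderiv ℂ 2 (pderiv ℂ 0 φ) * pderiv ℂ 1 φ * pderiv ℂ 2 φ +
      pderiv ℂ 2 (pderiv ℂ 1 φ) * pderiv ℂ 0 φ * pderiv ℂ 2 φ) * hJ +
    2 * J * (2 * r + 1) * (pderiv ℂ 1 (pderiv ℂ 0 φ) * (pderiv ℂ 2 φ ^ 2 - J ^ 2) -
      pderiv ℂ 2 (pderiv ℂ 0 φ) * pderiv ℂ 1 φ * (pderiv ℂ 2 φ + J) -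
      pderiv ℂ 2 (pderiv ℂ 1 φ) * pderiv ℂ 0 φ * (pderiv ℂ 2 φ - J) +
      pderiv ℂ 2 (pderiv ℂ 2 φ) * pderiv ℂ 0 φ * pderiv ℂ 1 φ) * h12

theorem crField_conj_restrict {φ : MvPowerSeries (Fin 3) ℂ} (hφ : IsHypersurface φ)
    (f : MvPowerSeries (Fin 2) ℂ) : crField φ (conj (restrict φ f)) = 0 := by
  have hc : ∀ i, constantCoeff
      ((![X 1, X 2 - C Complex.I * φ] : Fin 2 → MvPowerSeries (Fin 3) ℂ) i) = 0 := by
    simp [Fin.forall_fin_two, hφ.zero]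
  rw [restrict, conj_subst2 (by simp) (by simp [hφ.zero]), conj_X2_add hφ.hermitian, conj_X0,
    crField, pderiv_subst hc, pderiv_subst hc, Fin.sum_univ_two, Fin.sum_univ_two]
  simp only [Matrix.cons_val_zero, Matrix.cons_val_one, map_sub, Derivation.leibniz, smul_eq_mul,
    pderiv_C, pderiv_X_self]
  rw [pderiv_X_of_ne (by decide), pderiv_X_of_ne (by decide), pderiv_X_of_ne (by decide)]
  linear_combination (subst ![X 1, X 2 - C Complex.I * φ]
    (pderiv ℂ 1 (MvPowerSeries.map (starRingEnd ℂ) f))) * alpha_spec hφ.hermitian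

theorem crFieldBar_restrict {φ : MvPowerSeries (Fin 3) ℂ} (hφ : IsHypersurface φ)
    (f : MvPowerSeries (Fin 2) ℂ) : crFieldBar φ (restrict φ f) = 0 := by
  have hc := restrict_const hφ.zero
  rw [restrict, crFieldBar, pderiv_subst hc, pderiv_subst hc, Fin.sum_univ_two, Fin.sum_univ_two]
  simp only [Matrix.cons_val_zero, Matrix.cons_val_one, map_add, Derivation.leibniz, smul_eq_mul,
    pderiv_C, pderiv_X_self]
  rw [pderiv_X_of_ne (by decide), pderiv_X_of_ne (by decide), pderiv_X_of_ne (by decide)]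
  linear_combination (subst ![X 0, X 2 + C Complex.I * φ]
    (pderiv ℂ 1 f)) * alphaBar_spec hφ.hermitian

/-- The CR fields are normalized to have coefficient `1` at `∂_z` and `∂_z̄`. As `H` preserves `z`,
it carries those of `φ` exactly to those of `φ'`, hence also their commutators. Only the component
along `∂_u` remains, which brings in the derivative of `Re G`. -/
theorem crBracket_mul {φ φ' : MvPowerSeries (Fin 3) ℂ} (hφ : IsHypersurface φ)
    (hφ' : IsHypersurface φ') {H : FormalMap} (hF : H.F = X 0) (hs : H.Sends φ φ') :
    crBracket φ * pderiv ℂ 2 (rePart (restrict φ H.G)) =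
      subst (graphMap φ H) (crBracket φ') := by
  set U := rePart (restrict φ H.G) with hU
  set h := graphMap φ H with hh
  have hhU : h = ![X 0, X 1, U] := by
    rw [hh, graphMap, hF, restrict_X0 hφ.zero, conj_X0]
  have hc := graphMap_const hφ.zero H
  rw [← hh] at hc
  have hsub := hasSubst hc
  have hV : imPart (restrict φ H.G) = subst h φ' := sends_iff.mp hs
  have hre : restrict φ H.G = U + C Complex.I * subst h φ' := by
    rw [← hV, hU, rePart_add_imPart]
  have hco : conj (restrict φ H.G) = U - C Complex.I * subst h φ' := by
    rw [← hV, hU, rePart_sub_imPart]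
  have hD : ∀ f, crField φ (subst h f) =
      subst h (pderiv ℂ 0 f) + subst h (pderiv ℂ 2 f) * crField φ U := by
    intro f
    rw [crField, crField, pderiv_subst hc, pderiv_subst hc, Fin.sum_univ_three,
      Fin.sum_univ_three, hhU]
    simp only [Matrix.cons_val_zero, Matrix.cons_val_one, Matrix.cons_val, pderiv_X_self]
    rw [pderiv_X_of_ne (by decide), pderiv_X_of_ne (by decide), pderiv_X_of_ne (by decide)]
    ring
  have hDb : ∀ f, crFieldBar φ (subst h f) =
      subst h (pderiv ℂ 1 f) + subst h (pderiv ℂ 2 f) * crFieldBar φ U := by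
    intro f
    rw [crFieldBar, crFieldBar, pderiv_subst hc, pderiv_subst hc, Fin.sum_univ_three,
      Fin.sum_univ_three, hhU]
    simp only [Matrix.cons_val_zero, Matrix.cons_val_one, Matrix.cons_val, pderiv_X_self]
    rw [pderiv_X_of_ne (by decide), pderiv_X_of_ne (by decide), pderiv_X_of_ne (by decide)]
    ring
  -- The `(1, 0)` field annihilates `Ḡ = U - i φ'(h)`. Expanded by the chain rule, this is the
  -- defining equation of `α` for `φ'`, pulled back by `h`.
  have hDU : crField φ U = subst h (alpha φ') := by
    have h1 := crField_conj_restrict hφ H.G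
    have h2 : crField φ U - C Complex.I * crField φ (subst h φ') = 0 := by
      rw [hco] at h1
      rw [← h1]
      simp only [crField, map_sub, Derivation.leibniz, pderiv_C, smul_eq_mul]
      ring
    rw [hD] at h2
    have h3 := congrArg (subst h) (alpha_spec hφ'.hermitian)
    rw [subst_mul hsub, subst_mul hsub, subst_C] at h3
    have h4 := congrArg (subst h) (MvPowerSeries.mul_inv_cancel _
      (constantCoeff_one_sub_ne_zero hφ'.hermitian))
    rw [subst_mul hsub, subst_one_series] at h4
    have h5 : subst h (1 - C Complex.I * pderiv ℂ 2 φ') =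
        1 - C Complex.I * subst h (pderiv ℂ 2 φ') := by
      rw [subst_sub hsub, subst_mul hsub, subst_one_series, subst_C]
    rw [h5] at h3 h4
    linear_combination subst h (1 - C Complex.I * pderiv ℂ 2 φ')⁻¹ * (h2 - h3) +
      (subst h (alpha φ') - crField φ U) * h4
  have hDbU : crFieldBar φ U = subst h (alphaBar φ') := by
    have h1 := crFieldBar_restrict hφ H.G
    have h2 : crFieldBar φ U + C Complex.I * crFieldBar φ (subst h φ') = 0 := by
      rw [hre] at h1
      rw [← h1]
      simp only [crFieldBar, map_add, Derivation.leibniz, pderiv_C, smul_eq_mul]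
      ring
    rw [hDb] at h2
    have h3 := congrArg (subst h) (alphaBar_spec hφ'.hermitian)
    rw [← neg_mul, ← map_neg C, subst_mul hsub, subst_mul hsub, subst_C, map_neg] at h3
    have h4 := congrArg (subst h) (MvPowerSeries.mul_inv_cancel _
      (constantCoeff_one_add_ne_zero hφ'.hermitian))
    rw [subst_mul hsub, subst_one_series] at h4
    have h5 : subst h (1 + C Complex.I * pderiv ℂ 2 φ') =
        1 + C Complex.I * subst h (pderiv ℂ 2 φ') := by
      rw [subst_add hsub, subst_mul hsub, subst_one_series, subst_C]
    rw [h5] at h3 h4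
    linear_combination subst h (1 + C Complex.I * pderiv ℂ 2 φ')⁻¹ * (h2 - h3) +
      (subst h (alphaBar φ') - crFieldBar φ U) * h4
  rw [← crField_comm, hDbU, hDU, hD, hDb, hDbU, hDU, crBracket, crField, crFieldBar,
    subst_sub hsub, subst_add hsub, subst_add hsub, subst_mul hsub, subst_mul hsub]
  ring

/-- First order vanishing of the Levi form at `0` is invariant under changes of coordinates
preserving `z`. -/
theorem leviForm_mem_of_sends {φ φ' : MvPowerSeries (Fin 3) ℂ} (hφ : IsHypersurface φ)
    (hφ' : IsHypersurface φ') {H : FormalMap} (hH : H.Invertible) (hF : H.F = X 0)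
    (hs : H.Sends φ φ') (hL : leviForm φ' ∈ vanishIdeal (degreeLT (Fin 3) 2)) :
    leviForm φ ∈ vanishIdeal (degreeLT (Fin 3) 2) := by
  obtain ⟨K, -, hK⟩ := hH.exists_inverse
  have hc := graphMap_const hφ.zero H
  have hb' : crBracket φ' ∈ vanishIdeal (degreeLT (Fin 3) 2) := by
    have h1 := crBracket_eq hφ'.hermitian
    set q := (1 - C Complex.I * pderiv ℂ 2 φ') * (1 + C Complex.I * pderiv ℂ 2 φ') with hq
    have hq0 : constantCoeff (q ^ 2) ≠ 0 := by
      rw [map_pow, hq, map_mul]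
      exact pow_ne_zero _ (mul_ne_zero (constantCoeff_one_sub_ne_zero hφ'.hermitian)
        (constantCoeff_one_add_ne_zero hφ'.hermitian))
    have h2 := MvPowerSeries.inv_mul_cancel _ hq0
    have h3 : crBracket φ' = ((q ^ 2)⁻¹ * C (-8 * Complex.I)) * leviForm φ' := by
      linear_combination (q ^ 2)⁻¹ * h1 - crBracket φ' * h2
    rw [h3]
    exact Ideal.mul_mem_left _ _ hL
  have hb : crBracket φ ∈ vanishIdeal (degreeLT (Fin 3) 2) := by
    have h1 := crBracket_mul hφ hφ' hF hs
    -- Differentiating the inverse relation in `u` shows that the `u`-derivative of `Re G` is a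
    -- unit, so it can be cancelled from `crBracket_mul`.
    have h2 := congrArg (pderiv ℂ 2) (hs.graphMap_inverse hφ hφ'.zero hK 2)
    rw [pderiv_subst hc, Fin.sum_univ_three, pderiv_X_self] at h2
    have h3 : graphMap φ H = ![X 0, X 1, rePart (restrict φ H.G)] := by
      rw [graphMap, hF, restrict_X0 hφ.zero, conj_X0]
    have h30 : pderiv ℂ 2 (graphMap φ H 0) = 0 := by
      rw [h3]; exact pderiv_X_of_ne (by decide)
    have h31 : pderiv ℂ 2 (graphMap φ H 1) = 0 := by
      rw [h3]; exact pderiv_X_of_ne (by decide)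
    have h32 : graphMap φ H 2 = rePart (restrict φ H.G) := rfl
    rw [h30, h31, h32, mul_zero, mul_zero, zero_add, zero_add] at h2
    have h4 : crBracket φ = subst (graphMap φ H) (pderiv ℂ 2 (graphMap φ' K 2)) *
        subst (graphMap φ H) (crBracket φ') := by
      linear_combination -crBracket φ * h2 +
        subst (graphMap φ H) (pderiv ℂ 2 (graphMap φ' K 2)) * h1
    rw [h4]
    exact Ideal.mul_mem_left _ _ (subst_mem_vanishIdeal_degreeLT hc hb')
  have h5 := crBracket_eq hφ.hermitian
  have h6 : (C (-1 / (8 * Complex.I)) * C (-8 * Complex.I) : MvPowerSeries (Fin 3) ℂ) = 1 := by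
    rw [← map_mul, ← map_one C]
    congr 1
    field_simp
  have h7 : leviForm φ = C (-1 / (8 * Complex.I)) *
      (((1 - C Complex.I * pderiv ℂ 2 φ) * (1 + C Complex.I * pderiv ℂ 2 φ)) ^ 2) *
        crBracket φ := by
    linear_combination -leviForm φ * h6 - C (-1 / (8 * Complex.I)) * h5
  rw [h7]
  exact Ideal.mul_mem_left _ _ hb

theorem not_leviForm_mem {φ : MvPowerSeries (Fin 3) ℂ} (h : LeviVanishesToFirstOrder φ) :
    leviForm φ ∉ vanishIdeal (degreeLT (Fin 3) 2) := by
  obtain ⟨z, u, hz, hu, h1⟩ := h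
  intro hL
  apply h1
  have hc : ∀ i, constantCoeff ((![z, PowerSeries.map (starRingEnd ℂ) z,
      PowerSeries.map Complex.ofRealHom u] : Fin 3 → MvPowerSeries Unit ℂ) i) = 0 := by
    intro i
    have hu' : PowerSeries.constantCoeff (PowerSeries.map Complex.ofRealHom u) = 0 := by
      rw [← PowerSeries.coeff_zero_eq_constantCoeff_apply, PowerSeries.coeff_map,
        PowerSeries.coeff_zero_eq_constantCoeff_apply, hu, map_zero]
    have hz' : PowerSeries.constantCoeff (PowerSeries.map (starRingEnd ℂ) z) = 0 := by
      rw [← PowerSeries.coeff_zero_eq_constantCoeff_apply, PowerSeries.coeff_map,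
        PowerSeries.coeff_zero_eq_constantCoeff_apply, hz, map_zero]
    fin_cases i
    · exact hz
    · exact hz'
    · exact hu'
  refine (coeff_subst_of_degree_eq_one hc (leviForm φ) (e := Finsupp.single () 1)
    (Finsupp.degree_single _ _)).trans ?_
  refine Finset.sum_eq_zero fun i _ => ?_
  rw [hL _ (mem_degreeLT.mpr (by rw [Finsupp.degree_single]; norm_num)), zero_mul]

/-- Every monomial of `φ` is divisible by `z z̄ u`. Thus `φ_z` and `φ_z̄` have order at least two,
and the only possible linear term of `φ_{z z̄}` is `φ₁₁₁ u`. -/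
theorem leviForm_mem {φ : MvPowerSeries (Fin 3) ℂ} (h0 : ∀ a b, coeff₃ a b 0 φ = 0)
    (hl : ∀ a c, coeff₃ a 0 c φ = 0) (hr : ∀ b c, coeff₃ 0 b c φ = 0)
    (h1 : coeff₃ 1 1 1 φ = 0) : leviForm φ ∈ vanishIdeal (degreeLT (Fin 3) 2) := by
  have s0 : (Finsupp.single 0 1 : Fin 3 →₀ ℕ) = expo 1 0 0 := by simp [expo]
  have s1 : (Finsupp.single 1 1 : Fin 3 →₀ ℕ) = expo 0 1 0 := by simp [expo]
  have hz : pderiv ℂ 0 φ ∈ vanishIdeal (degreeLT (Fin 3) 2) := by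
    intro d hd
    rw [← expo_eq d, mem_degreeLT, degree_expo] at hd
    rw [coeff_pderiv, ← expo_eq d, s0, expo_add, ← coeff₃_eq]
    by_cases h : d 1 = 0
    · rw [h, add_zero, hl, zero_mul]
    · rw [show d 2 + 0 = 0 by omega, h0, zero_mul]
  have hx : pderiv ℂ 1 φ ∈ vanishIdeal (degreeLT (Fin 3) 2) := by
    intro d hd
    rw [← expo_eq d, mem_degreeLT, degree_expo] at hd
    rw [coeff_pderiv, ← expo_eq d, s1, expo_add, ← coeff₃_eq]
    by_cases h : d 0 = 0
    · rw [h, add_zero, hr, zero_mul]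
    · rw [show d 2 + 0 = 0 by omega, h0, zero_mul]
  have hzx : pderiv ℂ 1 (pderiv ℂ 0 φ) ∈ vanishIdeal (degreeLT (Fin 3) 2) := by
    intro d hd
    rw [← expo_eq d, mem_degreeLT, degree_expo] at hd
    rw [coeff_pderiv, coeff_pderiv, ← expo_eq d, s1, s0, expo_add, expo_add, ← coeff₃_eq]
    by_cases h : d 2 = 0
    · rw [h, h0]; ring
    · rw [show d 0 = 0 by omega, show d 1 = 0 by omega, show d 2 = 1 by omega]
      simp [h1]
  rw [leviForm]
  refine Ideal.add_mem _ (Ideal.sub_mem _ (Ideal.sub_mem _ ?_ ?_) ?_) ?_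
  · exact Ideal.mul_mem_right _ _ hzx
  · exact Ideal.mul_mem_left _ _ hx
  · exact Ideal.mul_mem_right _ _ (Ideal.mul_mem_left _ _ hz)
  · exact Ideal.mul_mem_left _ _ (Ideal.mul_mem_right _ _ hz)

end Levi

/-! ### Prenormalization -/

section Prenormalization

/-- The variables in `s`, and `0` in place of the others. -/
noncomputable def keep {σ : Type*} (s : Finset σ) [DecidableEq σ] (i : σ) : MvPowerSeries σ ℂ :=
  if i ∈ s then X i else 0

theorem keep_const {σ : Type*} (s : Finset σ) [DecidableEq σ] (i : σ) :
    constantCoeff (keep s i) = 0 := by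
  rw [keep]
  split_ifs <;> simp

theorem coeff_subst_keep {σ : Type*} [Fintype σ] [DecidableEq σ] (s : Finset σ)
    (f : MvPowerSeries σ ℂ) (d : σ →₀ ℕ) :
    coeff d (subst (keep s) f) = if ∀ i, i ∉ s → d i = 0 then coeff d f else 0 := by
  have key : ∀ e : σ →₀ ℕ, (e.prod fun i n => keep s i ^ n) =
      if ∀ i, i ∉ s → e i = 0 then monomial e (1 : ℂ) else 0 := by
    intro e
    rw [Finsupp.prod_fintype _ _ (fun i => pow_zero _)]
    split_ifs with h
    · rw [monomial_one_eq, Finsupp.prod_fintype _ _ (fun i => pow_zero _)]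
      refine Finset.prod_congr rfl fun i _ => ?_
      by_cases hi : i ∈ s
      · rw [keep, if_pos hi]
      · rw [h i hi, pow_zero, pow_zero]
    · push Not at h
      obtain ⟨i, hi, hi'⟩ := h
      refine Finset.prod_eq_zero (Finset.mem_univ i) ?_
      rw [keep, if_neg hi, zero_pow hi']
  rw [coeff_subst (hasSubst (keep_const s)), finsum_eq_single _ d]
  · rw [key]
    split_ifs <;> simp
  · intro e he
    rw [key]
    split_ifs
    · rw [coeff_monomial_ne he.symm, smul_zero]
    · rw [map_zero, smul_zero]

theorem keep_zero_two : (keep {0, 2} : Fin 3 → MvPowerSeries (Fin 3) ℂ) = ![X 0, 0, X 2] := by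
  funext i
  fin_cases i <;> simp [keep]

theorem keep_two : (keep {2} : Fin 3 → MvPowerSeries (Fin 3) ℂ) = ![0, 0, X 2] := by
  funext i
  fin_cases i <;> simp [keep]

theorem keep_zero : (keep {0} : Fin 3 → MvPowerSeries (Fin 3) ℂ) = ![X 0, 0, 0] := by
  funext i
  fin_cases i <;> simp [keep]

theorem keep_zero_one : (keep {0, 1} : Fin 3 → MvPowerSeries (Fin 3) ℂ) = ![X 0, X 1, 0] := by
  funext i
  fin_cases i <;> simp [keep]

theorem coeff₃_subst_zero_two (f : MvPowerSeries (Fin 3) ℂ) (a b c : ℕ) :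
    coeff₃ a b c (subst ![X 0, 0, X 2] f) = if b = 0 then coeff₃ a b c f else 0 := by
  rw [coeff₃_eq, ← keep_zero_two, coeff_subst_keep, coeff₃_eq]
  simp [Fin.forall_fin_succ]

theorem coeff₃_subst_two (f : MvPowerSeries (Fin 3) ℂ) (a b c : ℕ) :
    coeff₃ a b c (subst ![0, 0, X 2] f) = if a = 0 ∧ b = 0 then coeff₃ a b c f else 0 := by
  rw [coeff₃_eq, ← keep_two, coeff_subst_keep, coeff₃_eq]
  simp [Fin.forall_fin_succ]

theorem coeff₃_subst_zero_one (f : MvPowerSeries (Fin 3) ℂ) (a b c : ℕ) :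
    coeff₃ a b c (subst ![X 0, X 1, 0] f) = if c = 0 then coeff₃ a b c f else 0 := by
  rw [coeff₃_eq, ← keep_zero_one, coeff_subst_keep, coeff₃_eq]
  simp [Fin.forall_fin_succ]

theorem coeff₃_subst_zero (f : MvPowerSeries (Fin 3) ℂ) (a b c : ℕ) :
    coeff₃ a b c (subst ![X 0, 0, 0] f) = if b = 0 ∧ c = 0 then coeff₃ a b c f else 0 := by
  rw [coeff₃_eq, ← keep_zero, coeff_subst_keep, coeff₃_eq]
  simp [Fin.forall_fin_succ]

/-- The exponent of `z ^ a * w ^ c`. -/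
noncomputable def expo₂ (a c : ℕ) : Fin 2 →₀ ℕ := Finsupp.single 0 a + Finsupp.single 1 c

@[simp] theorem expo₂_zero (a c : ℕ) : expo₂ a c 0 = a := by simp [expo₂]

@[simp] theorem expo₂_one (a c : ℕ) : expo₂ a c 1 = c := by simp [expo₂]

theorem expo₂_eq (d : Fin 2 →₀ ℕ) : expo₂ (d 0) (d 1) = d := by
  ext i
  fin_cases i <;> simp

theorem coeff₃_X2_mul (a b c : ℕ) (f : MvPowerSeries (Fin 3) ℂ) :
    coeff₃ a b (c + 1) (X 2 * f) = coeff₃ a b c f := by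
  have e : expo a b (c + 1) = Finsupp.single 2 1 + expo a b c := by
    ext i
    fin_cases i <;> simp [add_comm]
  rw [coeff₃_eq, e, X, coeff_add_monomial_mul, one_mul, coeff₃_eq]

theorem coeff₃_X2_mul_zero (a b : ℕ) (f : MvPowerSeries (Fin 3) ℂ) :
    coeff₃ a b 0 (X 2 * f) = 0 := by
  rw [coeff₃_eq, X, coeff_monomial_mul, if_neg]
  intro h
  simpa using h 2

theorem coeff₃_subst_vec02 (f : MvPowerSeries (Fin 2) ℂ) (a b c : ℕ) :
    coeff₃ a b c (subst ![X 0, X 2] f) = if b = 0 then coeff (expo₂ a c) f else 0 := by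
  have hc : ∀ i, constantCoeff ((![X 0, X 2] : Fin 2 → MvPowerSeries (Fin 3) ℂ) i) = 0 := by
    simp [Fin.forall_fin_two]
  have key : ∀ d : Fin 2 →₀ ℕ,
      (d.prod fun s e => (![X 0, X 2] : Fin 2 → MvPowerSeries (Fin 3) ℂ) s ^ e) =
        monomial (expo (d 0) 0 (d 1)) 1 := by
    intro d
    rw [Finsupp.prod_fintype _ _ (fun i => pow_zero _), Fin.prod_univ_two]
    simp only [X_pow_eq, Matrix.cons_val_zero, Matrix.cons_val_one, monomial_mul_monomial, expo]
    simp
  rw [coeff₃_eq, coeff_subst (hasSubst hc), finsum_eq_single _ (expo₂ a c)]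
  · rw [key, coeff_monomial]
    simp [expo_inj]
  · intro d hd
    rw [key, coeff_monomial_ne, smul_zero]
    rw [Ne, expo_inj]
    rintro ⟨rfl, rfl, rfl⟩
    exact hd (expo₂_eq d).symm

theorem constantCoeff_subst_eq {σ τ : Type*} [Finite σ] {a : σ → MvPowerSeries τ ℂ}
    (ha : ∀ i, constantCoeff (a i) = 0) (f : MvPowerSeries σ ℂ) :
    constantCoeff (subst a f) = constantCoeff f := by
  have h := constantCoeff_subst_eq_zero (hasSubst ha) ha (f := f - C (constantCoeff f)) (by simp)
  rw [subst_sub (hasSubst ha), subst_C, map_sub, constantCoeff_C] at h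
  exact sub_eq_zero.mp h

theorem eq_zero_of_subst_eq_zero {σ : Type*} [Fintype σ] [DecidableEq σ]
    {a : σ → MvPowerSeries σ ℂ} (ha : ∀ i, constantCoeff (a i) = 0) (hJ : IsUnit (jac a).det)
    {f : MvPowerSeries σ ℂ} (h : subst a f = 0) : f = 0 := by
  obtain ⟨b, hb, hab, -⟩ := exists_inverse ha hJ
  rw [← subst_X_eq f, ← funext hab, ← subst_comp_subst_apply (hasSubst ha) (hasSubst hb), h,
    subst_zero_series]

theorem coeff_restrict_of_degree_one {φ : MvPowerSeries (Fin 3) ℂ} (hφ : constantCoeff φ = 0)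
    (f : MvPowerSeries (Fin 2) ℂ) (j : Fin 3) :
    coeff (Finsupp.single j 1) (restrict φ f) = coeff (Finsupp.single 0 1) f *
      coeff (Finsupp.single j 1) (X 0 : MvPowerSeries (Fin 3) ℂ) + coeff (Finsupp.single 1 1) f *
        coeff (Finsupp.single j 1) (X 2 + C Complex.I * φ) := by
  rw [restrict, coeff_subst_of_degree_eq_one (restrict_const hφ) _ (Finsupp.degree_single _ _),
    Fin.sum_univ_two]
  rfl

/-- Let `u b(z, u)` be the coefficient of `z̄` in `φ`, where `b = r z + ...` with `r = φ₁₁₁` real.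
Take `z' = F = s b(z, w)` and keep `w`. The `z̄`-linear part then becomes `z' z̄' u` times a series
in `u` alone, so all `φ'_{l1k}` with `l ≥ 2` vanish, which is more than required. The new `φ₁₁₁` is
`1 / (s² r)`, and `s = |r| ^ (-1/2)` makes it `± 1`. -/
theorem exists_prenormalized_of_normal {φ : MvPowerSeries (Fin 3) ℂ} (hφ : IsHypersurface φ)
    (hinf : IsInfiniteType φ) (h0 : ∀ a b, coeff₃ a b 0 φ = 0)
    (hn : subst ![X 0, 0, X 2] φ = (0 : MvPowerSeries (Fin 3) ℂ))
    (h1 : coeff₃ 1 1 1 φ ≠ 0) :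
    ∃ (H : FormalMap) (φ' : MvPowerSeries (Fin 3) ℂ),
      IsCoordinateChange H φ φ' ∧ IsPrenormalized φ' := by
  obtain ⟨r, hr⟩ : ∃ r : ℝ, coeff₃ 1 1 1 φ = r :=
    ⟨_, (Complex.conj_eq_iff_re.mp (conj_coeff₃_of_hermitian hφ.hermitian 1 1 1)).symm⟩
  have hr0 : r ≠ 0 := by rintro rfl; exact h1 (by simpa using hr)
  set s : ℝ := (√|r|)⁻¹ with hs
  have hs0 : (s : ℂ) ≠ 0 := by
    rw [hs]
    simpa using hr0
  have hsR : s ≠ 0 := by exact_mod_cast hs0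
  have hss : s * s = |r|⁻¹ := by
    rw [hs, ← mul_inv, Real.mul_self_sqrt (abs_nonneg r)]
  have hl : ∀ a c, coeff₃ a 0 c φ = 0 := fun a c => by
    have := congrArg (coeff₃ a 0 c) hn
    rw [coeff₃_subst_zero_two, if_pos rfl] at this
    simpa [coeff₃] using this
  have hrt : ∀ b c, coeff₃ 0 b c φ = 0 := fun b c => by
    rw [← conj_coeff₃_of_hermitian hφ.hermitian, hl, map_zero]
  let F : MvPowerSeries (Fin 2) ℂ := fun d => s * coeff₃ (d 0) 1 (d 1 + 1) φ
  have hF : ∀ d, coeff d F = s * coeff₃ (d 0) 1 (d 1 + 1) φ := fun d => rfl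
  have hF0 : constantCoeff F = 0 := by
    rw [← coeff_zero_eq_constantCoeff_apply, hF]
    simp [hrt]
  have hFz : coeff (Finsupp.single 0 1) F = s * r := by
    rw [hF, ← hr]
    simp
  have hFw : coeff (Finsupp.single 1 1) F = 0 := by
    rw [hF]
    simp [hrt]
  have hsr : (s : ℂ) * r ≠ 0 := mul_ne_zero hs0 (by exact_mod_cast hr0)
  let H : FormalMap := ⟨F, X 1, hF0, by simp⟩
  have hHi : H.Invertible := by
    rw [FormalMap.Invertible, Matrix.det_fin_two]
    change coeff (Finsupp.single 0 1) F * coeff (Finsupp.single 1 1) (X 1) -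
      coeff (Finsupp.single 1 1) F * _ ≠ 0
    rw [hFz, hFw, coeff_X, if_pos rfl]
    simpa using hsr
  have hg : graphMap φ H = ![restrict φ F, conj (restrict φ F), X 2] := by
    rw [graphMap, show H.G = X 1 from rfl, restrict_X1 hφ.zero, rePart_X2_add hφ.hermitian]
  have hlin : ∀ j, coeff (Finsupp.single j 1) (restrict φ F) = if j = 0 then (s * r : ℂ) else 0 := by
    intro j
    rw [coeff_restrict_of_degree_one hφ.zero, hFz, hFw, coeff_X]
    simp [Finsupp.single_left_inj]
  have hlin' : coeff (Finsupp.single 0 1) (conj (restrict φ F)) = 0 ∧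
      coeff (Finsupp.single 1 1) (conj (restrict φ F)) = s * r ∧
      coeff (Finsupp.single 2 1) (conj (restrict φ F)) = 0 := by
    rw [(coeff_single_eq _).1, (coeff_single_eq _).2.1, (coeff_single_eq _).2.2, coeff₃_conj,
      coeff₃_conj, coeff₃_conj, ← (coeff_single_eq _).1, ← (coeff_single_eq _).2.1,
      ← (coeff_single_eq _).2.2, hlin, hlin, hlin]
    simp
  have hJ : IsUnit (jac (graphMap φ H)).det := by
    rw [hg, Matrix.det_fin_three]
    simp only [jac, Matrix.of_apply, Matrix.cons_val_zero, Matrix.cons_val_one, Matrix.cons_val,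
      hlin, hlin'.1, hlin'.2.1, hlin'.2.2, coeff_X, Finsupp.single_left_inj (one_ne_zero' ℕ)]
    simpa using ⟨hsR, hr0⟩
  obtain ⟨φ', hφ', hsend⟩ := exists_sends hφ H hJ
  have hsub : subst (graphMap φ H) φ' = φ := by
    rw [← sends_iff.mp hsend, show H.G = X 1 from rfl, restrict_X1 hφ.zero,
      imPart_X2_add hφ.hermitian]
  -- On `z̄ = 0` the induced map is `(F(z, u), 0, u)`, because `F(0, w) = 0`. It is only applied to
  -- series in `z` and `u`, so the middle entry may be replaced by `X 1`, which makes `m`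
  -- invertible.
  set m : Fin 3 → MvPowerSeries (Fin 3) ℂ := ![subst ![X 0, X 2] F, X 1, X 2] with hm
  have h02 : ∀ i, constantCoeff ((![X 0, X 2] : Fin 2 → MvPowerSeries (Fin 3) ℂ) i) = 0 := by
    simp [Fin.forall_fin_two]
  have hm0 : constantCoeff (subst ![X 0, X 2] F : MvPowerSeries (Fin 3) ℂ) = 0 := by
    rw [constantCoeff_subst_eq h02, hF0]
  have hmc : ∀ i, constantCoeff (m i) = 0 := by
    simp [hm, Fin.forall_fin_succ, hm0]
  have hms := hasSubst hmc
  have hmJ : IsUnit (jac m).det := by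
    rw [Matrix.det_fin_three]
    have e0 : coeff (Finsupp.single 0 1) (m 0) = s * r := by
      rw [(coeff_single_eq _).1]
      change coeff₃ 1 0 0 (subst ![X 0, X 2] F) = _
      rw [coeff₃_subst_vec02, if_pos rfl, ← hFz]
      simp [expo₂]
    have e1 : m 1 = X 1 := rfl
    have e2 : m 2 = X 2 := rfl
    simp only [jac, Matrix.of_apply, e0, e1, e2, coeff_X, Finsupp.single_left_inj (one_ne_zero' ℕ)]
    simpa using ⟨hsR, hr0⟩
  have hec : ∀ i, constantCoeff ((![X 0, 0, X 2] : Fin 3 → MvPowerSeries (Fin 3) ℂ) i) = 0 := by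
    simp [Fin.forall_fin_succ]
  have hes := hasSubst hec
  have hresF0 := restrict_constantCoeff hφ.zero hF0
  -- restriction of the map to `z̄ = 0`
  have hFbar0 : ∀ c, coeff (expo₂ 0 c) (MvPowerSeries.map (starRingEnd ℂ) F) = 0 := by
    intro c
    rw [coeff_map, hF]
    simp [hrt]
  have h0F : ∀ f : MvPowerSeries (Fin 2) ℂ, (∀ c, coeff (expo₂ 0 c) f = 0) →
      subst ![0, X 2] f = (0 : MvPowerSeries (Fin 3) ℂ) := by
    intro f hf
    have e : (subst ![0, X 2] f : MvPowerSeries (Fin 3) ℂ) =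
        subst ![(0 : MvPowerSeries (Fin 3) ℂ), 0, X 2]
          (subst ![(X 0 : MvPowerSeries (Fin 3) ℂ), X 2] f) := by
      have hc2 : ∀ i, constantCoeff ((![0, 0, X 2] : Fin 3 → MvPowerSeries (Fin 3) ℂ) i) = 0 := by
        simp [Fin.forall_fin_succ]
      rw [subst_vec2 hc2 (by simp) (by simp), subst_X (hasSubst hc2), subst_X (hasSubst hc2)]
      rfl
    rw [e]
    refine ext_coeff₃ fun a b c => ?_
    rw [coeff₃_subst_two, coeff₃_subst_vec02]
    split_ifs with h h'
    · rw [h.1, hf]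
      simp [coeff₃]
    · simp [coeff₃]
    · simp [coeff₃]
  have heh0 : subst ![X 0, 0, X 2] (restrict φ F) =
      (subst ![X 0, X 2] F : MvPowerSeries (Fin 3) ℂ) := by
    rw [restrict, subst_vec2 hec (by simp) (by simp [hφ.zero]), subst_add hes, subst_mul hes, hn,
      mul_zero, add_zero, subst_X hes, subst_X hes]
    rfl
  have hconj : conj (restrict φ F) =
      subst ![X 1, X 2 - C Complex.I * φ] (MvPowerSeries.map (starRingEnd ℂ) F) := by
    rw [restrict, conj_subst2 (by simp) (by simp [hφ.zero]), conj_X2_add hφ.hermitian, conj_X0]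
  have hevec : ∀ f : MvPowerSeries (Fin 2) ℂ, subst ![X 0, 0, X 2]
      (subst ![(X 1 : MvPowerSeries (Fin 3) ℂ), X 2 - C Complex.I * φ] f) =
        (subst ![0, X 2] f : MvPowerSeries (Fin 3) ℂ) := by
    intro f
    rw [subst_vec2 hec (by simp) (by simp [hφ.zero]), subst_sub hes, subst_mul hes, hn,
      mul_zero, sub_zero, subst_X hes, subst_X hes]
    rfl
  have heh1 : subst ![X 0, 0, X 2] (conj (restrict φ F)) = (0 : MvPowerSeries (Fin 3) ℂ) := by
    rw [hconj, hevec, h0F _ hFbar0]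
  have heh : ∀ f : MvPowerSeries (Fin 3) ℂ, subst ![X 0, 0, X 2] (subst (graphMap φ H) f) =
      subst m (subst ![(X 0 : MvPowerSeries (Fin 3) ℂ), 0, X 2] f) := by
    intro f
    rw [hg, subst_vec3 hec hresF0 (by rw [constantCoeff_conj, hresF0, map_zero]) (by simp), heh0,
      heh1, subst_vec3 hmc (by simp) (by simp) (by simp), subst_X hes, subst_X hms, subst_X hms,
      subst_zero_series]
    rfl
  have hn' : subst ![X 0, 0, X 2] φ' = (0 : MvPowerSeries (Fin 3) ℂ) := by
    refine eq_zero_of_subst_eq_zero hmc hmJ ?_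
    rw [← heh, hsub, hn]
  have hl' : ∀ a c, coeff₃ a 0 c φ' = 0 := fun a c => by
    have := congrArg (coeff₃ a 0 c) hn'
    rw [coeff₃_subst_zero_two, if_pos rfl] at this
    simpa [coeff₃] using this
  have hrt' : ∀ b c, coeff₃ 0 b c φ' = 0 := fun b c => by
    rw [← conj_coeff₃_of_hermitian hφ'.hermitian, hl', map_zero]
  -- the terms that are linear in `z̄`
  have s0e : (Finsupp.single 0 1 : Fin 3 →₀ ℕ) = expo 1 0 0 := by simp [expo]
  have s1e : (Finsupp.single 1 1 : Fin 3 →₀ ℕ) = expo 0 1 0 := by simp [expo]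
  set p : MvPowerSeries (Fin 3) ℂ := subst ![X 0, 0, X 2] (pderiv ℂ 1 φ') with hp
  have hpc : ∀ a c, coeff₃ a 0 c p = coeff₃ a 1 c φ' := by
    intro a c
    rw [hp, coeff₃_subst_zero_two, if_pos rfl, coeff₃_eq, coeff_pderiv, s1e, expo_add,
      ← coeff₃_eq]
    simp
  set β : MvPowerSeries (Fin 3) ℂ :=
    subst ![0, X 2] (pderiv ℂ 0 (MvPowerSeries.map (starRingEnd ℂ) F)) with hβ
  have hβ0 : constantCoeff β = s * r := by
    rw [hβ, constantCoeff_subst_eq (by simp [Fin.forall_fin_two]),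
      ← coeff_zero_eq_constantCoeff_apply, coeff_pderiv, zero_add, coeff_map, hFz]
    simp
  -- Differentiate `φ'(h) = φ` in `z̄` and set `z̄ = 0`. Only the component `F̄` contributes: `φ'_z`
  -- vanishes on `z̄ = 0`, and the third component is `u`.
  have ha : subst ![(X 0 : MvPowerSeries (Fin 3) ℂ), 0, X 2] (pderiv ℂ 1 φ) = subst m p * β := by
    have e := congrArg (fun f => subst ![(X 0 : MvPowerSeries (Fin 3) ℂ), 0, X 2] (pderiv ℂ 1 f)) hsub
    rw [← e, pderiv_subst (graphMap_const hφ.zero H), Fin.sum_univ_three, subst_add hes,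
      subst_add hes, subst_mul hes, subst_mul hes, subst_mul hes, heh, heh, heh]
    have e0 : subst ![X 0, 0, X 2] (pderiv ℂ 0 φ') = (0 : MvPowerSeries (Fin 3) ℂ) := by
      refine ext_coeff₃ fun a b c => ?_
      rw [coeff₃_subst_zero_two]
      split_ifs with h
      · rw [h, coeff₃_eq, coeff_pderiv, s0e, expo_add, ← coeff₃_eq, hl']
        simp [coeff₃]
      · simp [coeff₃]
    have e2 : pderiv ℂ 1 (graphMap φ H 2) = 0 := by
      rw [hg]
      exact pderiv_X_of_ne (by decide)
    have e1 : subst ![X 0, 0, X 2] (pderiv ℂ 1 (graphMap φ H 1)) = β := by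
      rw [hg]
      change subst ![X 0, 0, X 2] (pderiv ℂ 1 (conj (restrict φ F))) = β
      rw [hconj, pderiv_subst (by simp [Fin.forall_fin_two, hφ.zero]), Fin.sum_univ_two,
        subst_add hes, subst_mul hes, subst_mul hes, hevec, hevec]
      simp only [Matrix.cons_val_zero, Matrix.cons_val_one, pderiv_X_self, subst_one_series]
      have e3 : subst ![0, X 2] (pderiv ℂ 1 (MvPowerSeries.map (starRingEnd ℂ) F)) =
          (0 : MvPowerSeries (Fin 3) ℂ) := by
        refine h0F _ fun c => ?_
        have : expo₂ 0 c + Finsupp.single 1 1 = expo₂ 0 (c + 1) := by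
          simp [expo₂]
        rw [coeff_pderiv, this, hFbar0, zero_mul]
      rw [e3, zero_mul, add_zero, mul_one]
    rw [e0, e1, e2, subst_zero_series, subst_zero_series]
    ring
  -- This is the choice of `F`. Together with `ha` it determines `p` once `m` is cancelled.
  have ha' : C (s : ℂ) * subst ![X 0, 0, X 2] (pderiv ℂ 1 φ) =
      (X 2 * subst ![X 0, X 2] F : MvPowerSeries (Fin 3) ℂ) := by
    refine ext_coeff₃ fun a b c => ?_
    rw [coeff₃_eq, coeff_C_mul, ← coeff₃_eq, coeff₃_subst_zero_two]
    rcases c with _ | c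
    · rw [coeff₃_X2_mul_zero]
      split_ifs with hb
      · rw [hb, coeff₃_eq, coeff_pderiv, s1e, expo_add, ← coeff₃_eq, h0]
        simp
      · rw [mul_zero]
    · rw [coeff₃_X2_mul, coeff₃_subst_vec02]
      split_ifs with hb
      · rw [hb, coeff₃_eq, coeff_pderiv, s1e, expo_add, ← coeff₃_eq, hF]
        simp
      · rw [mul_zero]
  have hmβ : subst m β = β := by
    rw [hβ, subst_vec2 hmc (by simp) (by simp), subst_X hms, subst_zero_series]
    rfl
  have hfin : C (s : ℂ) * p * β = X 0 * X 2 := by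
    rw [← sub_eq_zero]
    refine eq_zero_of_subst_eq_zero hmc hmJ ?_
    rw [subst_sub hms, subst_mul hms, subst_mul hms, subst_mul hms, subst_X hms, subst_X hms,
      subst_C, hmβ, mul_assoc, ← ha, ha']
    change X 2 * _ - _ * X 2 = 0
    rw [mul_comm, sub_eq_zero]
    rfl
  have h2c : ∀ i, constantCoeff ((![0, 0, X 2] : Fin 3 → MvPowerSeries (Fin 3) ℂ) i) = 0 := by
    simp [Fin.forall_fin_succ]
  have h2s := hasSubst h2c
  have hβ2 : subst ![0, 0, X 2] β = β := by
    rw [hβ, subst_vec2 h2c (by simp) (by simp), subst_X h2s, subst_zero_series]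
    rfl
  -- Setting `z = z̄ = 0` in `β⁻¹` changes nothing, as `β` depends only on `u`, but it makes visible
  -- that the inverse does too.
  set γ : MvPowerSeries (Fin 3) ℂ := subst ![0, 0, X 2] β⁻¹ with hγ
  have hβγ : β * γ = 1 := by
    rw [hγ, ← hβ2, ← subst_mul h2s, hβ2, MvPowerSeries.mul_inv_cancel _ (by rw [hβ0]; exact hsr),
      subst_one_series]
  have hpγ : C (s : ℂ) * p = monomial (expo 1 0 1) 1 * γ := by
    have : (X 0 * X 2 : MvPowerSeries (Fin 3) ℂ) = monomial (expo 1 0 1) 1 := by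
      rw [X, X, monomial_mul_monomial, one_mul]
      simp [expo]
    rw [← this, ← hfin]
    linear_combination -(C (s : ℂ) * p) * hβγ
  have hcoef : ∀ l k, s * coeff₃ l 1 k φ' =
      if expo 1 0 1 ≤ expo l 0 k then coeff (expo l 0 k - expo 1 0 1) γ else 0 := by
    intro l k
    rw [← hpc, coeff₃_eq, ← coeff_C_mul, hpγ, coeff_monomial_mul, one_mul]
  have hge : ∀ l k, 2 ≤ l → coeff₃ l 1 k φ' = 0 := by
    intro l k hl2
    have e := hcoef l k
    have e2 : coeff (expo l 0 k - expo 1 0 1) γ = 0 := by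
      have e3 : expo l 0 k - expo 1 0 1 = expo (l - 1) 0 (k - 1) := by
        ext i
        fin_cases i <;> simp
      rw [e3, ← coeff₃_eq, hγ, coeff₃_subst_two, if_neg (by omega)]
    rw [e2, ite_self] at e
    exact (mul_eq_zero.mp e).resolve_left hs0
  refine ⟨H, φ', ⟨hHi, hφ', hsend⟩, ?_, hl', hrt', ?_, fun l hl2 => hge l 1 hl2,
    fun l k hl3 _ => hge l k (by omega)⟩
  · exact (hinf.of_sends hφ hHi hsend).coeff₃_eq_zero hn'
  · have e := hcoef 1 1
    rw [if_pos le_rfl, tsub_self, coeff_zero_eq_constantCoeff_apply] at e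
    have e2 : constantCoeff γ = (s * r : ℂ)⁻¹ := by
      have := congrArg constantCoeff hβγ
      rw [map_mul, hβ0, map_one] at this
      exact eq_inv_of_mul_eq_one_right this
    rw [e2] at e
    have e3 : coeff₃ 1 1 1 φ' = (((s * s) * r)⁻¹ : ℝ) := by
      have hr0' : (r : ℂ) ≠ 0 := by exact_mod_cast hr0
      push_cast
      field_simp at e ⊢
      linear_combination e
    rw [e3, hss]
    rcases abs_choice r with h | h
    · left
      rw [h, inv_mul_cancel₀ hr0]
      simp
    · right
      rw [h, ← neg_inv, neg_mul, inv_mul_cancel₀ hr0]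
      norm_num

/-- A hypersurface of infinite type whose Levi form vanishes to first order can be
prenormalized. -/
theorem exists_prenormalized {φ : MvPowerSeries (Fin 3) ℂ} (hφ : IsHypersurface φ)
    (hinf : IsInfiniteType φ) (hL : LeviVanishesToFirstOrder φ) :
    ∃ (H : FormalMap) (φ' : MvPowerSeries (Fin 3) ℂ),
      IsCoordinateChange H φ φ' ∧ IsPrenormalized φ' := by
  obtain ⟨H₁, φ₁, ⟨hi₁, hφ₁, hs₁⟩, hF₁, hn₁⟩ := exists_normal_coordinates hφ
  have hinf₁ := hinf.of_sends hφ hi₁ hs₁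
  have h0 := hinf₁.coeff₃_eq_zero hn₁
  have hl : ∀ a c, coeff₃ a 0 c φ₁ = 0 := fun a c => by
    have := congrArg (coeff₃ a 0 c) hn₁
    rw [coeff₃_subst_zero_two, if_pos rfl] at this
    simpa [coeff₃] using this
  have hrt : ∀ b c, coeff₃ 0 b c φ₁ = 0 := fun b c => by
    rw [← conj_coeff₃_of_hermitian hφ₁.hermitian, hl, map_zero]
  have h1 : coeff₃ 1 1 1 φ₁ ≠ 0 := fun h =>
    not_leviForm_mem hL (leviForm_mem_of_sends hφ hφ₁ hi₁ hF₁ hs₁ (leviForm_mem h0 hl hrt h))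
  obtain ⟨H₂, φ₂, ⟨hi₂, hφ₂, hs₂⟩, hpre⟩ := exists_prenormalized_of_normal hφ₁ hinf₁ h0 hn₁ h1
  exact ⟨H₂.comp H₁, φ₂, ⟨hi₂.comp hi₁, hφ₂, hs₁.comp hs₂ hφ.zero hφ₁.zero⟩, hpre⟩

end Prenormalization

/-! ### Coefficients on `u = 0` -/

section Boundary

theorem coeff₃_add (a b c : ℕ) (f g : MvPowerSeries (Fin 3) ℂ) :
    coeff₃ a b c (f + g) = coeff₃ a b c f + coeff₃ a b c g := map_add _ _ _

theorem coeff₃_sub (a b c : ℕ) (f g : MvPowerSeries (Fin 3) ℂ) :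
    coeff₃ a b c (f - g) = coeff₃ a b c f - coeff₃ a b c g := map_sub _ _ _

theorem coeff₃_C_mul (a b c : ℕ) (r : ℂ) (f : MvPowerSeries (Fin 3) ℂ) :
    coeff₃ a b c (C r * f) = r * coeff₃ a b c f := coeff_C_mul _ _ _

theorem coeff₃_one (a b c : ℕ) :
    coeff₃ a b c 1 = if a = 0 ∧ b = 0 ∧ c = 0 then 1 else 0 := by
  have h : (0 : Fin 3 →₀ ℕ) = expo 0 0 0 := by simp [expo]
  rw [coeff₃_eq, coeff_one, h]
  simp [expo_inj]

theorem coeff₃_X0 (a b c : ℕ) :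
    coeff₃ a b c (X 0) = if a = 1 ∧ b = 0 ∧ c = 0 then 1 else 0 := by
  have h : (Finsupp.single 0 1 : Fin 3 →₀ ℕ) = expo 1 0 0 := by simp [expo]
  rw [coeff₃_eq, coeff_X, h]
  simp [expo_inj]

theorem coeff₃_imPart (a b c : ℕ) (f : MvPowerSeries (Fin 3) ℂ) :
    coeff₃ a b c (imPart f) =
      1 / (2 * Complex.I) * (coeff₃ a b c f - starRingEnd ℂ (coeff₃ b a c f)) := by
  rw [imPart, coeff₃_C_mul, coeff₃_sub, coeff₃_conj]

theorem coeff₃_rePart (a b c : ℕ) (f : MvPowerSeries (Fin 3) ℂ) :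
    coeff₃ a b c (rePart f) =
      1 / 2 * (coeff₃ a b c f + starRingEnd ℂ (coeff₃ b a c f)) := by
  rw [rePart, coeff₃_C_mul, coeff₃_add, coeff₃_conj]

theorem coeff₃_mul (a b : ℕ) (f g : MvPowerSeries (Fin 3) ℂ) :
    coeff₃ a b 0 (f * g) = ∑ x ∈ Finset.HasAntidiagonal.antidiagonal a, ∑ y ∈ Finset.HasAntidiagonal.antidiagonal b,
      coeff₃ x.1 y.1 0 f * coeff₃ x.2 y.2 0 g := by
  classical
  rw [coeff₃_eq, coeff_mul, ← Finset.sum_product']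
  refine Finset.sum_nbij' (fun d => ((d.1 0, d.2 0), (d.1 1, d.2 1)))
    (fun x => (expo x.1.1 x.2.1 0, expo x.1.2 x.2.2 0)) ?_ ?_ ?_ ?_ ?_
  · intro d hd
    rw [Finset.HasAntidiagonal.mem_antidiagonal] at hd
    simp [← Finsupp.add_apply, hd]
  · intro x hx
    simp only [Finset.mem_product, Finset.HasAntidiagonal.mem_antidiagonal] at hx
    rw [Finset.HasAntidiagonal.mem_antidiagonal, expo_add, hx.1, hx.2]
  · intro d hd
    rw [Finset.HasAntidiagonal.mem_antidiagonal] at hd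
    have h2 := DFunLike.congr_fun hd 2
    simp only [Finsupp.add_apply, expo_two, Nat.add_eq_zero_iff] at h2
    ext i
    · fin_cases i <;> simp [h2]
    · fin_cases i <;> simp [h2]
  · intro x _
    simp
  · intro d hd
    rw [Finset.HasAntidiagonal.mem_antidiagonal] at hd
    have h2 := DFunLike.congr_fun hd 2
    simp only [Finsupp.add_apply, expo_two, Nat.add_eq_zero_iff] at h2
    have e1 : expo (d.1 0) (d.1 1) 0 = d.1 := by rw [← h2.1, expo_eq]
    have e2 : expo (d.2 0) (d.2 1) 0 = d.2 := by rw [← h2.2, expo_eq]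
    simp only [coeff₃_eq, e1, e2]

theorem X2_dvd_iff {f : MvPowerSeries (Fin 3) ℂ} : X 2 ∣ f ↔ ∀ a b, coeff₃ a b 0 f = 0 := by
  rw [X_dvd_iff]
  constructor
  · intro h a b
    exact h _ (by simp)
  · intro h d hd
    rw [← expo_eq d, hd]
    exact h _ _

theorem X2_ne_zero : (X 2 : MvPowerSeries (Fin 3) ℂ) ≠ 0 := by
  intro h
  have := congrArg (coeff (Finsupp.single 2 1)) h
  simp at this

theorem X1_dvd_iff {f : MvPowerSeries (Fin 3) ℂ} : X 1 ∣ f ↔ ∀ a c, coeff₃ a 0 c f = 0 := by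
  rw [X_dvd_iff]
  constructor
  · intro h a c
    exact h _ (by simp)
  · intro h d hd
    rw [← expo_eq d, hd]
    exact h _ _

theorem X1_dvd_iff₂ {f : MvPowerSeries (Fin 2) ℂ} : X 1 ∣ f ↔ ∀ a, coeff (expo₂ a 0) f = 0 := by
  rw [X_dvd_iff]
  constructor
  · intro h a
    exact h _ (by simp)
  · intro h d hd
    rw [← expo₂_eq d, hd]
    exact h _

theorem exists_eq_X1_mul_add_X2_mul {f : MvPowerSeries (Fin 3) ℂ}
    (hf : ∀ a, coeff₃ a 0 0 f = 0) : ∃ s t, f = X 1 * s + X 2 * t := by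
  have h1 : X 1 ∣ f - subst ![(X 0 : MvPowerSeries (Fin 3) ℂ), 0, X 2] f := by
    refine X1_dvd_iff.mpr fun a c => ?_
    rw [coeff₃_sub, coeff₃_subst_zero_two, if_pos rfl, sub_self]
  have h2 : X 2 ∣ subst ![(X 0 : MvPowerSeries (Fin 3) ℂ), 0, X 2] f := by
    refine X2_dvd_iff.mpr fun a b => ?_
    rw [coeff₃_subst_zero_two]
    split_ifs with hb
    · rw [hb, hf]
    · rfl
  obtain ⟨s, hs⟩ := h1
  obtain ⟨t, ht⟩ := h2
  exact ⟨s, t, by rw [← hs, ← ht]; ring⟩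

/-- For `φ = u p` the function `w = u (1 + i p)` vanishes on `u = 0`, so only `f(z, 0)` is left
there. -/
theorem coeff₃_restrict_X2_mul (p : MvPowerSeries (Fin 3) ℂ) (f : MvPowerSeries (Fin 2) ℂ)
    (a b : ℕ) :
    coeff₃ a b 0 (restrict (X 2 * p) f) = if b = 0 then coeff (expo₂ a 0) f else 0 := by
  have h1 : ∀ i, constantCoeff ((![X 0, X 1, 0] : Fin 3 → MvPowerSeries (Fin 3) ℂ) i) = 0 := by
    simp [Fin.forall_fin_succ]
  have h2 : ∀ i, constantCoeff ((![X 0, 0, 0] : Fin 3 → MvPowerSeries (Fin 3) ℂ) i) = 0 := by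
    simp [Fin.forall_fin_succ]
  have e : subst ![(X 0 : MvPowerSeries (Fin 3) ℂ), X 1, 0] (restrict (X 2 * p) f) =
      subst ![(X 0 : MvPowerSeries (Fin 3) ℂ), 0, 0]
        (subst ![(X 0 : MvPowerSeries (Fin 3) ℂ), X 2] f) := by
    have hs := hasSubst h1
    rw [restrict, subst_vec2 h1 (by simp) (by simp), subst_add hs, subst_mul hs, subst_mul hs,
      subst_X hs, subst_X hs, subst_vec2 h2 (by simp) (by simp), subst_X (hasSubst h2),
      subst_X (hasSubst h2)]
    simp
  have h := congrArg (coeff₃ a b 0) e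
  rw [coeff₃_subst_zero_one, if_pos rfl, coeff₃_subst_zero, coeff₃_subst_vec02] at h
  rw [h]
  split_ifs <;> simp_all

theorem restrict_mul {φ : MvPowerSeries (Fin 3) ℂ} (hφ : constantCoeff φ = 0)
    (f g : MvPowerSeries (Fin 2) ℂ) : restrict φ (f * g) = restrict φ f * restrict φ g :=
  subst_mul (hasSubst (restrict_const hφ)) f g

theorem restrict_add {φ : MvPowerSeries (Fin 3) ℂ} (hφ : constantCoeff φ = 0)
    (f g : MvPowerSeries (Fin 2) ℂ) : restrict φ (f + g) = restrict φ f + restrict φ g :=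
  subst_add (hasSubst (restrict_const hφ)) f g

theorem restrict_pow {φ : MvPowerSeries (Fin 3) ℂ} (hφ : constantCoeff φ = 0)
    (f : MvPowerSeries (Fin 2) ℂ) (n : ℕ) : restrict φ (f ^ n) = restrict φ f ^ n :=
  subst_pow (hasSubst (restrict_const hφ)) f n

theorem imPart_add (f g : MvPowerSeries (Fin 3) ℂ) : imPart (f + g) = imPart f + imPart g := by
  simp only [imPart, conj_add]
  ring

theorem rePart_add (f g : MvPowerSeries (Fin 3) ℂ) : rePart (f + g) = rePart f + rePart g := by
  simp only [rePart, conj_add]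
  ring

theorem imPart_X2_pow_mul (n : ℕ) (f : MvPowerSeries (Fin 3) ℂ) :
    imPart (X 2 ^ n * f) = X 2 ^ n * imPart f := by
  rw [imPart, imPart, conj_mul, conj_pow, conj_X2]
  ring

theorem rePart_X2_pow_mul (n : ℕ) (f : MvPowerSeries (Fin 3) ℂ) :
    rePart (X 2 ^ n * f) = X 2 ^ n * rePart f := by
  rw [rePart, rePart, conj_mul, conj_pow, conj_X2]
  ring

/-- The Levi-flat locus `u = 0` can be factored out of a prenormalized series. -/
theorem IsPrenormalized.exists_eq_X2_mul {φ : MvPowerSeries (Fin 3) ℂ} (hφ : IsHypersurface φ)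
    (hp : IsPrenormalized φ) : ∃ p, φ = X 2 * p ∧ conj p = p ∧ X 1 ∣ p ∧
      ∀ a b, coeff₃ a b 0 p = coeff₃ a b 1 φ := by
  obtain ⟨p, rfl⟩ := X2_dvd_iff.mpr hp.infinite_type
  refine ⟨p, rfl, ?_, X1_dvd_iff.mpr fun a c => ?_, fun a b => (coeff₃_X2_mul a b 0 p).symm⟩
  · have h := hφ.hermitian
    rw [conj_mul, conj_X2] at h
    exact mul_left_cancel₀ X2_ne_zero h
  · rw [← coeff₃_X2_mul, hp.left]

end Boundary

/-! ### The linear part of an automorphism -/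

section LinearPart

/-- Everything is read off on `u = 0`. The terms without `z̄` give `G(z, 0) = 0`. After division by
`u` they show that `g(z, 0)` is a real constant `m`. The equation then says that `p` is invariant
under `z ↦ F(z, 0)`, and its `z̄`-linear terms `ε F(z, 0) * conj F_z(0) = ε z` give the form of
`F(z, 0)`. -/
theorem IsPrenormalized.linear_part {φ : MvPowerSeries (Fin 3) ℂ} (hφ : IsHypersurface φ)
    (hp : IsPrenormalized φ) {Φ : FormalMap} (hΦ : Φ ∈ Aut₀ φ) :
    ∃ (l : ℂ) (m : ℝ), l * starRingEnd ℂ l = 1 ∧ m ≠ 0 ∧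
      (∀ a, coeff (expo₂ a 0) Φ.F = if a = 1 then l else 0) ∧
      ∃ g, Φ.G = X 1 * g ∧ ∀ a, coeff (expo₂ a 0) g = if a = 0 then (m : ℂ) else 0 := by
  obtain ⟨p, rfl, hpc, ⟨q, hq⟩, hpφ⟩ := hp.exists_eq_X2_mul hφ
  set φ : MvPowerSeries (Fin 3) ℂ := X 2 * p with hφp
  obtain ⟨hinv, hsend⟩ := hΦ
  have hconst := graphMap_const hφ.zero Φ
  have hs := hasSubst hconst
  have hF := coeff₃_restrict_X2_mul p Φ.F
  have hF1 : ∀ a b, coeff₃ a b 0 (conj (restrict φ Φ.F)) =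
      if a = 0 then starRingEnd ℂ (coeff (expo₂ b 0) Φ.F) else 0 := by
    intro a b
    rw [coeff₃_conj, hF]
    split_ifs <;> simp
  have hF0 : coeff (expo₂ 0 0) Φ.F = 0 := by
    rw [← Φ.F_zero, ← coeff_zero_eq_constantCoeff_apply]
    simp [expo₂]
  have hG0 : coeff (expo₂ 0 0) Φ.G = 0 := by
    rw [← Φ.G_zero, ← coeff_zero_eq_constantCoeff_apply]
    simp [expo₂]
  have hg1 : graphMap φ Φ 1 = conj (restrict φ Φ.F) := rfl
  -- Since `p = z̄ q`, its pullback is divisible by `F̄`, which vanishes for `z̄ = u = 0`.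
  have hsp : subst (graphMap φ Φ) p = conj (restrict φ Φ.F) * subst (graphMap φ Φ) q := by
    rw [hq, subst_mul hs, subst_X hs, hg1]
  have hsp0 : ∀ a (f : MvPowerSeries (Fin 3) ℂ),
      coeff₃ a 0 0 (f * subst (graphMap φ Φ) p) = 0 := by
    intro a f
    rw [hsp, mul_left_comm, coeff₃_mul]
    refine Finset.sum_eq_zero fun x _ => ?_
    simp only [Finset.Nat.antidiagonal_zero, Finset.sum_singleton, hF1, hF0, map_zero, ite_self,
      zero_mul]
  have hsφ : imPart (restrict φ Φ.G) = rePart (restrict φ Φ.G) * subst (graphMap φ Φ) p := by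
    rw [sends_iff.mp hsend, hφp, subst_mul hs, subst_X hs]
    rfl
  have hGa : X 1 ∣ Φ.G := by
    refine X1_dvd_iff₂.mpr fun a => ?_
    have h := congrArg (coeff₃ a 0 0) hsφ
    rw [hsp0, coeff₃_imPart, coeff₃_restrict_X2_mul, coeff₃_restrict_X2_mul, if_pos rfl, hG0,
      ite_self, map_zero, sub_zero] at h
    exact (mul_eq_zero.mp h).resolve_left (by simp)
  obtain ⟨g, hg⟩ := hGa
  set W : MvPowerSeries (Fin 3) ℂ := 1 + C Complex.I * p with hW
  have hrG : restrict φ Φ.G = X 2 ^ 1 * (W * restrict φ g) := by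
    rw [hg, restrict_mul hφ.zero, restrict_X1 hφ.zero, hφp, hW]
    ring
  have hcancel : imPart (W * restrict φ g) =
      rePart (W * restrict φ g) * subst (graphMap φ Φ) p := by
    rw [hrG, imPart_X2_pow_mul, rePart_X2_pow_mul, mul_assoc] at hsφ
    exact mul_left_cancel₀ (pow_ne_zero 1 X2_ne_zero) hsφ
  have hp0 : ∀ a, coeff₃ a 0 0 p = 0 := fun a => by rw [hpφ, hp.left]
  have hp0' : ∀ b, coeff₃ 0 b 0 p = 0 := fun b => by rw [hpφ, hp.right]
  have hWg : ∀ a b, coeff₃ a b 0 (W * restrict φ g) =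
      (if b = 0 then coeff (expo₂ a 0) g else 0) +
        Complex.I * ∑ x ∈ Finset.HasAntidiagonal.antidiagonal a, coeff₃ x.1 b 0 p * coeff (expo₂ x.2 0) g := by
    intro a b
    rw [hW, add_mul, one_mul, mul_assoc, coeff₃_add, coeff₃_C_mul, coeff₃_restrict_X2_mul,
      coeff₃_mul]
    congr 2
    refine Finset.sum_congr rfl fun x _ => ?_
    rw [Finset.sum_eq_single (b, 0)]
    · rw [coeff₃_restrict_X2_mul, if_pos rfl]
    · intro y hy hyb
      rw [coeff₃_restrict_X2_mul, if_neg, mul_zero]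
      rintro h
      rw [Finset.HasAntidiagonal.mem_antidiagonal] at hy
      exact hyb (Prod.ext (by omega) h)
    · simp
  have hWa : ∀ a, coeff₃ a 0 0 (W * restrict φ g) = coeff (expo₂ a 0) g := by
    intro a
    simp [hWg, hp0]
  have hW0 : ∀ b, coeff₃ 0 b 0 (W * restrict φ g) =
      if b = 0 then coeff (expo₂ 0 0) g else 0 := by
    intro b
    simp [hWg, hp0']
  have hga : ∀ a, coeff (expo₂ a 0) g =
      if a = 0 then starRingEnd ℂ (coeff (expo₂ 0 0) g) else 0 := by
    intro a
    have h := congrArg (coeff₃ a 0 0) hcancel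
    rw [hsp0, coeff₃_imPart, hWa, hW0] at h
    have h' := sub_eq_zero.mp ((mul_eq_zero.mp h).resolve_left (by simp))
    rw [h']
    split_ifs <;> simp
  obtain ⟨m, hm⟩ : ∃ m : ℝ, coeff (expo₂ 0 0) g = m :=
    ⟨_, (Complex.conj_eq_iff_re.mp (by simpa using (hga 0).symm)).symm⟩
  have hgm : ∀ a, coeff (expo₂ a 0) g = if a = 0 then (m : ℂ) else 0 := by
    intro a
    rw [hga, hm, Complex.conj_ofReal]
  have hjG0 : coeff (Finsupp.single 0 1) Φ.G = 0 := by
    rw [hg, X, coeff_monomial_mul, if_neg]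
    intro h
    simpa using h 1
  have hjG1 : coeff (Finsupp.single 1 1) Φ.G = m := by
    have h := coeff_add_monomial_mul (Finsupp.single 1 1) 0 g (1 : ℂ)
    rw [add_zero, one_mul, ← X_def, ← hg] at h
    rw [h]
    simpa [expo₂] using hgm 0
  have hdet : Φ.jacobian 0 0 * m ≠ 0 := by
    have h := hinv
    rw [FormalMap.Invertible, Matrix.det_fin_two] at h
    change Φ.jacobian 0 0 * coeff (Finsupp.single 1 1) Φ.G -
      Φ.jacobian 0 1 * coeff (Finsupp.single 0 1) Φ.G ≠ 0 at h
    rw [hjG0, hjG1] at h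
    simpa using h
  have hm0 : m ≠ 0 := by
    rintro rfl
    simp at hdet
  have hmC : (m : ℂ) ≠ 0 := by exact_mod_cast hm0
  -- comparison of the terms that are linear in `z̄`
  have hWm : ∀ a b, coeff₃ a b 0 (W * restrict φ g) =
      m * ((if a = 0 ∧ b = 0 then 1 else 0) + Complex.I * coeff₃ a b 0 p) := by
    intro a b
    rw [hWg, Finset.sum_eq_single (a, 0)]
    · rw [hgm, hgm, if_pos rfl]
      split_ifs with h1 h2 h3 h4 <;> first | (exfalso; tauto) | ring
    · intro x hx hxa
      rw [hgm, if_neg, mul_zero]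
      rintro h
      rw [Finset.HasAntidiagonal.mem_antidiagonal] at hx
      exact hxa (Prod.ext (by omega) h)
    · simp
  have hpstar : ∀ a b, starRingEnd ℂ (coeff₃ a b 0 p) = coeff₃ b a 0 p :=
    fun a b => conj_coeff₃_of_hermitian hpc a b 0
  have him : ∀ a b, coeff₃ a b 0 (imPart (W * restrict φ g)) = m * coeff₃ a b 0 p := by
    intro a b
    rw [coeff₃_imPart, hWm, hWm]
    simp only [map_mul, map_add, Complex.conj_ofReal, Complex.conj_I, hpstar]
    have : (starRingEnd ℂ (if b = 0 ∧ a = 0 then (1 : ℂ) else 0)) =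
        if a = 0 ∧ b = 0 then 1 else 0 := by
      simp [and_comm]
    rw [this]
    field_simp
    ring
  have hre : ∀ a b, coeff₃ a b 0 (rePart (W * restrict φ g)) =
      if a = 0 ∧ b = 0 then (m : ℂ) else 0 := by
    intro a b
    rw [coeff₃_rePart, hWm, hWm]
    simp only [map_mul, map_add, Complex.conj_ofReal, Complex.conj_I, hpstar]
    have : (starRingEnd ℂ (if b = 0 ∧ a = 0 then (1 : ℂ) else 0)) =
        if a = 0 ∧ b = 0 then 1 else 0 := by
      simp [and_comm]
    rw [this]
    split_ifs <;> ring
  -- On `u = 0` the two sides of `hcancel` are `m p` and `m` times the pullback of `p`.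
  have hpp : ∀ a b, coeff₃ a b 0 (subst (graphMap φ Φ) p) = coeff₃ a b 0 p := by
    intro a b
    have h := congrArg (coeff₃ a b 0) hcancel
    rw [him, coeff₃_mul, Finset.sum_eq_single (0, a), Finset.sum_eq_single (0, b), hre,
      if_pos ⟨rfl, rfl⟩] at h
    · exact (mul_left_cancel₀ hmC h).symm
    · intro y hy hyb
      rw [hre, if_neg, zero_mul]
      rintro ⟨-, h⟩
      rw [Finset.HasAntidiagonal.mem_antidiagonal] at hy
      exact hyb (Prod.ext h (by omega))
    · simp
    · intro x hx hxa
      refine Finset.sum_eq_zero fun y _ => ?_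
      rw [hre, if_neg, zero_mul]
      rintro ⟨h, -⟩
      rw [Finset.HasAntidiagonal.mem_antidiagonal] at hx
      exact hxa (Prod.ext h (by omega))
    · simp
  set ε : ℂ := coeff₃ 1 1 1 φ with hε
  have hε0 : ε ≠ 0 := by
    rcases hp.levi with h | h <;> rw [hε, h] <;> simp
  have hpa : ∀ a, coeff₃ a 1 0 p = if a = 1 then ε else 0 := by
    intro a
    rw [hpφ]
    split_ifs with h
    · rw [h]
    · rcases Nat.eq_zero_or_pos a with rfl | ha
      · exact hp.right _ _
      · exact hp.first _ (by omega)
  have hqa : ∀ a, coeff₃ a 0 0 q = if a = 1 then ε else 0 := by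
    intro a
    have e : expo a 1 0 = Finsupp.single 1 1 + expo a 0 0 := by
      ext i
      fin_cases i <;> simp
    rw [← hpa, coeff₃_eq, coeff₃_eq, hq, X, e, coeff_add_monomial_mul, one_mul]
  -- On `z̄ = u = 0` the series `q` is `ε z`. The remainder lies in the ideal `(z̄, u)`, which the
  -- induced map preserves, so the pullback of `q` is `ε F(z, 0)` there.
  obtain ⟨s, t, hst⟩ := exists_eq_X1_mul_add_X2_mul (f := q - C ε * X 0) (by
    intro a
    rw [coeff₃_sub, coeff₃_C_mul, coeff₃_X0, hqa]
    simp)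
  have hg2 : X 2 ∣ graphMap φ Φ 2 := by
    refine ⟨rePart (W * restrict φ g), ?_⟩
    change rePart (restrict φ Φ.G) = _
    rw [hrG, rePart_X2_pow_mul, pow_one]
  have hsq : ∀ a, coeff₃ a 0 0 (subst (graphMap φ Φ) q) = ε * coeff (expo₂ a 0) Φ.F := by
    intro a
    rw [← sub_add_cancel q (C ε * X 0), hst, subst_add hs, subst_add hs, subst_mul hs,
      subst_mul hs, subst_mul hs, subst_C, subst_X hs, subst_X hs, subst_X hs, hg1, coeff₃_add,
      coeff₃_add, coeff₃_C_mul, show graphMap φ Φ 0 = restrict φ Φ.F from rfl, hF, if_pos rfl,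
      X2_dvd_iff.mp (hg2.mul_right _), coeff₃_mul]
    simp [hF1, hF0]
  have hfin : ∀ a, ε * coeff (expo₂ a 0) Φ.F * starRingEnd ℂ (coeff (expo₂ 1 0) Φ.F) =
      if a = 1 then ε else 0 := by
    intro a
    rw [← hpa, ← hpp, hsp, coeff₃_mul, Finset.sum_eq_single (0, a)]
    · simp [Finset.Nat.antidiagonal_succ, hF1, hF0, hsq, mul_comm, mul_left_comm]
    · intro x hx hxa
      refine Finset.sum_eq_zero fun y _ => ?_
      rw [hF1, if_neg, zero_mul]
      intro h
      rw [Finset.HasAntidiagonal.mem_antidiagonal] at hx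
      exact hxa (Prod.ext h (by omega))
    · simp
  have hl : coeff (expo₂ 1 0) Φ.F * starRingEnd ℂ (coeff (expo₂ 1 0) Φ.F) = 1 := by
    have := hfin 1
    rw [if_pos rfl, mul_assoc] at this
    exact mul_left_cancel₀ hε0 (this.trans (mul_one ε).symm)
  refine ⟨coeff (expo₂ 1 0) Φ.F, m, hl, hm0, ?_, g, hg, hgm⟩
  intro a
  split_ifs with h
  · rw [h]
  · have := hfin a
    rw [if_neg h, mul_assoc] at this
    exact (mul_eq_zero.mp ((mul_eq_zero.mp this).resolve_left hε0)).resolve_right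
      (right_ne_zero_of_mul_eq_one hl)

end LinearPart

/-! ### The linearized equation -/

section Linearization

theorem coeff₃_pderiv_zero (a b c : ℕ) (f : MvPowerSeries (Fin 3) ℂ) :
    coeff₃ a b c (pderiv ℂ 0 f) = (a + 1) * coeff₃ (a + 1) b c f := by
  have h : expo a b c + Finsupp.single 0 1 = expo (a + 1) b c := by
    ext i
    fin_cases i <;> simp
  rw [coeff₃_eq, coeff_pderiv, h, ← coeff₃_eq, expo_zero, mul_comm]

theorem conj_pderiv_zero (f : MvPowerSeries (Fin 3) ℂ) :
    conj (pderiv ℂ 0 f) = pderiv ℂ 1 (conj f) := by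
  refine ext_coeff₃ fun a b c => ?_
  have h : expo a b c + Finsupp.single 1 1 = expo a (b + 1) c := by
    ext i
    fin_cases i <;> simp
  rw [coeff₃_conj, coeff₃_pderiv_zero, coeff₃_eq (f := pderiv ℂ 1 _), coeff_pderiv, h, ← coeff₃_eq,
    coeff₃_conj, expo_one]
  simp [mul_comm]

/-- For real `p`, multiplication by `1 + i p` turns `Im V` into `Im V + p Re V` and `Re V` into `Re
V - p Im V`. The terms with `Re V` cancel. -/
theorem imPart_sub_mul_rePart {p : MvPowerSeries (Fin 3) ℂ} (hp : conj p = p)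
    (V : MvPowerSeries (Fin 3) ℂ) :
    imPart ((1 + C Complex.I * p) * V) - p * rePart ((1 + C Complex.I * p) * V) =
      (1 + p * p) * imPart V := by
  have h1 : (C Complex.I * C Complex.I : MvPowerSeries (Fin 3) ℂ) = -1 := by
    rw [← map_mul, Complex.I_mul_I]
    simp
  have h2 : (C (1 / 2) : MvPowerSeries (Fin 3) ℂ) = C (1 / (2 * Complex.I)) * C Complex.I := by
    rw [← map_mul]
    congr 1
    field_simp
  rw [imPart, rePart, imPart, conj_mul, conj_add, conj_mul, conj_C, conj_one, hp, h2,
    Complex.conj_I, map_neg]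
  linear_combination (-C (1 / (2 * Complex.I)) * p * p * (V - conj V)) * h1

/-- Here `x` is `u`, the order is `n = m + 1`, and `T` is the pullback of `p`. Cancelling `x ^ (m +
1)` leaves the linear terms. The `p_u` term and the products of increments keep a factor `x`, the
latter because `n ≥ 1`. -/
theorem first_order_term {R : Type*} [CommRing R] [NoZeroDivisors R] {x p T t A A' pz pc pu im re : R}
    (hx : x ≠ 0) (m : ℕ) (h : p + x ^ (m + 1) * im = (1 + x ^ (m + 1) * re) * T)
    (hT : T - (p + (pz * (x ^ (m + 1) * A) + pc * (x ^ (m + 1) * A') +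
      pu * (x ^ (m + 2) * re))) = x ^ (m + 2) * t) : x ∣ im - p * re - (pz * A + pc * A') := by
  refine ⟨pu * re + t + x ^ m * re * (pz * A + pc * A' + x * (pu * re + t)), ?_⟩
  refine mul_left_cancel₀ (pow_ne_zero (m + 1) hx) ?_
  linear_combination h + (1 + x ^ (m + 1) * re) * hT

/-- The real and imaginary parts on the hypersurface of a map that agrees with the identity to
order `n` in `z` and `n + 1` in `w`. -/
theorem graphMap_perturbation {φ p : MvPowerSeries (Fin 3) ℂ} (hφ : IsHypersurface φ)
    (hφp : φ = X 2 * p) {Φ : FormalMap} {n : ℕ} {f g : MvPowerSeries (Fin 2) ℂ}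
    (hF : Φ.F = X 0 + X 1 ^ n * f) (hG : Φ.G = X 1 + X 1 ^ (n + 1) * g)
    {A B : MvPowerSeries (Fin 3) ℂ} (hA : A = (1 + C Complex.I * p) ^ n * restrict φ f)
    (hB : B = (1 + C Complex.I * p) * ((1 + C Complex.I * p) ^ n * restrict φ g)) :
    imPart (restrict φ Φ.G) = φ + X 2 ^ (n + 1) * imPart B ∧
      graphMap φ Φ = X + ![X 2 ^ n * A, X 2 ^ n * conj A, X 2 ^ (n + 1) * rePart B] := by
  have hXW : X 2 + C Complex.I * φ = X 2 * (1 + C Complex.I * p) := by rw [hφp]; ring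
  have hrF : restrict φ Φ.F = X 0 + X 2 ^ n * A := by
    rw [hF, restrict_add hφ.zero, restrict_mul hφ.zero, restrict_pow hφ.zero, restrict_X0 hφ.zero,
      restrict_X1 hφ.zero, hXW, hA, mul_pow, mul_assoc]
  have hrG : restrict φ Φ.G = X 2 + C Complex.I * φ + X 2 ^ (n + 1) * B := by
    rw [hG, restrict_add hφ.zero, restrict_mul hφ.zero, restrict_pow hφ.zero,
      restrict_X1 hφ.zero, hXW, hB, mul_pow, ← mul_assoc (1 + C Complex.I * p), ← pow_succ',
      mul_assoc]
  have hre : rePart (restrict φ Φ.G) = X 2 + X 2 ^ (n + 1) * rePart B := by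
    rw [hrG, rePart_add, rePart_X2_pow_mul, rePart_X2_add hφ.hermitian]
  have hc : conj (restrict φ Φ.F) = X 1 + X 2 ^ n * conj A := by
    rw [hrF, conj_add, conj_mul, conj_pow, conj_X0, conj_X2]
  constructor
  · rw [hrG, imPart_add, imPart_X2_pow_mul, imPart_X2_add hφ.hermitian]
  · rw [graphMap, hc, hrF, hre]
    funext i
    fin_cases i <;> rfl

/-- The quadratic terms of the Taylor expansion are divisible by `X 2 ^ (2 * n)`, and `2 * n ≥ n +
1`. -/
theorem subst_X_add_congr {n : ℕ} (hn : 1 ≤ n) {δ : Fin 3 → MvPowerSeries (Fin 3) ℂ}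
    (hδn : ∀ i, X 2 ^ n ∣ δ i) (p : MvPowerSeries (Fin 3) ℂ) :
    X 2 ^ (n + 1) ∣ subst (X + δ) p -
      (p + (pderiv ℂ 0 p * δ 0 + pderiv ℂ 1 p * δ 1 + pderiv ℂ 2 p * δ 2)) := by
  have hδ0 : ∀ i, constantCoeff (δ i) = 0 := by
    intro i
    obtain ⟨t, ht⟩ := hδn i
    rw [ht, map_mul, map_pow, constantCoeff_X, zero_pow (by omega), zero_mul]
  have hδδ : ∀ i j, δ i * δ j ∈ vanishIdeal (indexLT (2 : Fin 3) (n + 1)) := by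
    intro i j
    rw [mem_vanishIdeal_indexLT]
    have h := mul_dvd_mul (hδn i) (hδn j)
    rw [← pow_add] at h
    exact (pow_dvd_pow _ (by omega)).trans h
  have hT := mk_subst_add (a := (X : Fin 3 → MvPowerSeries (Fin 3) ℂ)) (by simp) hδ0 hδδ p
  rw [Ideal.Quotient.eq, mem_vanishIdeal_indexLT, Fin.sum_univ_three] at hT
  simpa only [subst_X_eq] using hT

/-- On `M` one has `w = u (1 + i p)`, so `w ^ n f` contributes `u ^ n (1 + i p) ^ n f`. Divide `Im G
= Re G * p(h)` by `u` and compare the terms of order `n` in `u`. The increment of `Re G` has order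
`n + 1`, so `p_u` does not enter. -/
theorem Sends.linearized {φ p : MvPowerSeries (Fin 3) ℂ} (hφ : IsHypersurface φ)
    (hφp : φ = X 2 * p) (hp : conj p = p) {Φ : FormalMap} (hΦ : Φ.Sends φ φ) {n : ℕ} (hn : 1 ≤ n)
    {f g : MvPowerSeries (Fin 2) ℂ} (hF : Φ.F = X 0 + X 1 ^ n * f)
    (hG : Φ.G = X 1 + X 1 ^ (n + 1) * g) :
    X 2 ∣ (1 + p * p) * imPart ((1 + C Complex.I * p) ^ n * restrict φ g) -
      (pderiv ℂ 0 p * ((1 + C Complex.I * p) ^ n * restrict φ f) +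
        conj (pderiv ℂ 0 p * ((1 + C Complex.I * p) ^ n * restrict φ f))) := by
  obtain ⟨A, hA⟩ : ∃ A, A = (1 + C Complex.I * p) ^ n * restrict φ f := ⟨_, rfl⟩
  obtain ⟨B, hB⟩ : ∃ B, B = (1 + C Complex.I * p) * ((1 + C Complex.I * p) ^ n * restrict φ g) :=
    ⟨_, rfl⟩
  obtain ⟨him, hh⟩ := graphMap_perturbation hφ hφp hF hG hA hB
  obtain ⟨t, ht⟩ := subst_X_add_congr hn
    (δ := ![X 2 ^ n * A, X 2 ^ n * conj A, X 2 ^ (n + 1) * rePart B]) (by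
      intro i
      fin_cases i
      · exact dvd_mul_right _ _
      · exact dvd_mul_right _ _
      · exact (pow_dvd_pow _ n.le_succ).mul_right _) p
  simp only [Matrix.cons_val] at ht
  have hs := hasSubst (graphMap_const hφ.zero Φ)
  have hmul : subst (graphMap φ Φ) φ = graphMap φ Φ 2 * subst (graphMap φ Φ) p := by
    rw [← subst_X (R := ℂ) hs 2, ← subst_mul hs, ← hφp]
  have hsend := (sends_iff.mp hΦ).trans hmul
  rw [him, hh] at hsend
  simp only [Pi.add_apply, Matrix.cons_val] at hsend
  have hcanc : p + X 2 ^ n * imPart B = (1 + X 2 ^ n * rePart B) *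
      subst (X + ![X 2 ^ n * A, X 2 ^ n * conj A, X 2 ^ (n + 1) * rePart B]) p := by
    refine mul_left_cancel₀ X2_ne_zero ?_
    linear_combination hsend - hφp
  rw [← imPart_sub_mul_rePart hp, ← hA, ← hB, conj_mul, conj_pderiv_zero, hp]
  obtain ⟨m, rfl⟩ := Nat.exists_eq_add_of_le' hn
  exact first_order_term X2_ne_zero m hcanc ht

end Linearization

/-! ### The coefficients of the linearized equation -/

section Coefficients

theorem coeff₃_mul_restrict (p W : MvPowerSeries (Fin 3) ℂ) (f : MvPowerSeries (Fin 2) ℂ)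
    (a b : ℕ) : coeff₃ a b 0 (W * restrict (X 2 * p) f) =
      ∑ x ∈ Finset.HasAntidiagonal.antidiagonal a, coeff₃ x.1 b 0 W * coeff (expo₂ x.2 0) f := by
  rw [coeff₃_mul]
  refine Finset.sum_congr rfl fun x _ => ?_
  rw [Finset.sum_eq_single (b, 0)]
  · rw [coeff₃_restrict_X2_mul, if_pos rfl]
  · intro y hy hyb
    rw [coeff₃_restrict_X2_mul, if_neg, mul_zero]
    rintro h
    rw [Finset.HasAntidiagonal.mem_antidiagonal] at hy
    exact hyb (Prod.ext (by omega) h)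
  · simp

/-- The low order terms of `(1 + i p) ^ n`. -/
theorem coeff₃_one_add_pow {p : MvPowerSeries (Fin 3) ℂ} {ε : ℂ} (hε : ε * ε = 1)
    (h0 : ∀ a, coeff₃ a 0 0 p = 0) (h0' : ∀ b, coeff₃ 0 b 0 p = 0) (h11 : coeff₃ 1 1 0 p = ε)
    (h1 : ∀ a, coeff₃ (a + 2) 1 0 p = 0) (h1' : ∀ b, coeff₃ 1 (b + 2) 0 p = 0) (n : ℕ) :
    let W := (1 + C Complex.I * p) ^ n
    (∀ a, coeff₃ a 0 0 W = if a = 0 then 1 else 0) ∧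
    (∀ b, coeff₃ 0 b 0 W = if b = 0 then 1 else 0) ∧
    coeff₃ 1 1 0 W = n * Complex.I * ε ∧
    coeff₃ 2 1 0 W = 0 ∧ coeff₃ 3 1 0 W = 0 ∧ coeff₃ 1 2 0 W = 0 ∧ coeff₃ 1 3 0 W = 0 ∧
    coeff₃ 2 2 0 W = n * Complex.I * coeff₃ 2 2 0 p - n * (n - 1) / 2 ∧
    coeff₃ 3 2 0 W = n * Complex.I * coeff₃ 3 2 0 p ∧
    coeff₃ 2 3 0 W = n * Complex.I * coeff₃ 2 3 0 p ∧
    coeff₃ 3 3 0 W = n * Complex.I * coeff₃ 3 3 0 p - n * (n - 1) * ε * coeff₃ 2 2 0 p -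
      n * (n - 1) * (n - 2) / 6 * Complex.I * ε := by
  have h21 := h1 0
  have h31 := h1 1
  have h12 := h1' 0
  have h13 := h1' 1
  simp only [zero_add, Nat.reduceAdd] at h21 h31 h12 h13
  have hI := Complex.I_mul_I
  induction n with
  | zero => simp [coeff₃_one]
  | succ n ih =>
    obtain ⟨i0, i0', i11, i21, i31, i12, i13, i22, i32, i23, i33⟩ := ih
    have key : ∀ a b, coeff₃ a b 0 ((1 + C Complex.I * p) ^ (n + 1)) =
        coeff₃ a b 0 ((1 + C Complex.I * p) ^ n) +
          Complex.I * coeff₃ a b 0 ((1 + C Complex.I * p) ^ n * p) := by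
      intro a b
      rw [← coeff₃_C_mul, ← coeff₃_add]
      congr 1
      ring
    have z0 : ∀ a, coeff₃ a 0 0 ((1 + C Complex.I * p) ^ n * p) = 0 := by
      intro a
      rw [coeff₃_mul]
      simp [h0]
    have z0' : ∀ b, coeff₃ 0 b 0 ((1 + C Complex.I * p) ^ n * p) = 0 := by
      intro b
      rw [coeff₃_mul]
      simp [h0']
    refine ⟨fun a => ?_, fun b => ?_, ?_, ?_, ?_, ?_, ?_, ?_, ?_, ?_, ?_⟩
    · rw [key, z0, i0, mul_zero, add_zero]
    · rw [key, z0', i0', mul_zero, add_zero]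
    all_goals
      rw [key, coeff₃_mul]
      simp only [Finset.Nat.sum_antidiagonal_eq_sum_range_succ_mk, Finset.sum_range_succ,
        Finset.sum_range_zero, Nat.succ_eq_add_one, Nat.reduceAdd, Nat.reduceSub, zero_add,
        Nat.sub_self, tsub_zero,
        h0, h0', h11, h21, h31, h12, h13, i0, i0', i11, i21, i31, i12, i13, i22, i32, i23, i33]
      push_cast
    · simp
      ring
    · simp
    · simp
    · simp
    · simp
    · simp
      linear_combination (n * ε * ε) * hI - n * hε
    · simp
      ring
    · simp
      ring
    · simp
      linear_combination (2 * n * ε * coeff₃ 2 2 0 p) * hI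

end Coefficients

/-! ### The resonance system for the lowest order terms -/

section Equations

/-- The linear system in the lowest order terms of an automorphism that is tangent to the identity
to order `n + 1` along the Levi-flat locus. -/
theorem resonance_rows {ε n r22 r33 γ : ℝ} (hε : ε * ε = 1) {a b c f₀ f₁ f₂ : ℂ}
    (e11 : (n * ε * γ : ℂ) = ε * (f₁ + starRingEnd ℂ f₁))
    (e21 : ε * f₂ = (2 * n * Complex.I - 2 * r22) * starRingEnd ℂ f₀)
    (e22 : (n * r22 * γ : ℂ) = (n * Complex.I + 2 * r22) * f₁ + 3 * a * f₀ +
      starRingEnd ℂ ((n * Complex.I + 2 * r22) * f₁ + 3 * a * f₀))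
    (e32 : n * a * γ + ((n * Complex.I * r22 - n * (n - 1) / 2) * ε * starRingEnd ℂ f₀ +
        ε * starRingEnd ℂ f₀) =
      (n * Complex.I + 2 * r22) * f₂ + 3 * a * f₁ + 4 * b * f₀ +
        starRingEnd ℂ (ε * (n * Complex.I * r22 - n * (n - 1) / 2) * f₀ + 2 * r22 * n * Complex.I * ε * f₀ +
          2 * starRingEnd ℂ a * f₁ + 3 * r33 * f₀))
    (e33 : (n * r33 - n * (n - 1) * (n - 2) / 6 * ε) * γ +
        n * ε * (starRingEnd ℂ a * starRingEnd ℂ f₀ * Complex.I - a * f₀ * Complex.I) +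
        n * ε * γ =
      ε * ((n * Complex.I * r22 - n * (n - 1) / 2) * f₁ + n * Complex.I * a * f₀) + 2 * r22 * n * Complex.I * ε * f₁ +
        3 * a * n * Complex.I * ε * f₀ + 2 * starRingEnd ℂ a * f₂ + 3 * r33 * f₁ + 4 * c * f₀ +
        starRingEnd ℂ (ε * ((n * Complex.I * r22 - n * (n - 1) / 2) * f₁ + n * Complex.I * a * f₀) +
          2 * r22 * n * Complex.I * ε * f₁ +
        3 * a * n * Complex.I * ε * f₀ + 2 * starRingEnd ℂ a * f₂ + 3 * r33 * f₁ + 4 * c * f₀)) :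
    -6 * a.re * f₀.re + 6 * a.im * f₀.im - 2 * r22 * f₁.re + 2 * n * f₁.im = 0 ∧
    (ε * (2 * n ^ 2 + 1 + 4 * r22 ^ 2) - 3 * r33 - 4 * b.re) * f₀.re +
      (2 * ε * n * r22 + 4 * b.im) * f₀.im - 3 * a.re * f₁.re + a.im * f₁.im = 0 ∧
    (2 * ε * n * r22 - 4 * b.im) * f₀.re -
      (ε * (2 * n ^ 2 + 1 + 4 * r22 ^ 2) - 3 * r33 + 4 * b.re) * f₀.im -
      3 * a.im * f₁.re - a.re * f₁.im = 0 ∧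
    (ε * (8 * r22 * a.re + 2 * n * a.im) - 8 * c.re) * f₀.re +
      (ε * (-8 * r22 * a.im + 2 * n * a.re) + 8 * c.im) * f₀.im +
      (2 / 3 * ε * (n ^ 2 + 2) - 4 * r33) * f₁.re + 6 * ε * n * r22 * f₁.im = 0 := by
  have hε0 : ε ≠ 0 := by rintro rfl; simp at hε
  -- `e21` eliminates `f₂`, and below `e11` eliminates `γ` through `n γ = 2 Re f₁`. The four rows
  -- are then `e22`, the real and imaginary parts of `e32`, and `e33`.
  have hf₂ : f₂ = ε * ((2 * n * Complex.I - 2 * r22) * starRingEnd ℂ f₀) := by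
    rw [← e21, ← mul_assoc, ← Complex.ofReal_mul, hε, Complex.ofReal_one, one_mul]
  obtain ⟨x₁, x₂⟩ := f₀
  obtain ⟨y₁, y₂⟩ := f₁
  obtain ⟨a₁, a₂⟩ := a
  obtain ⟨b₁, b₂⟩ := b
  obtain ⟨c₁, c₂⟩ := c
  subst hf₂
  have h1 := congrArg Complex.re e11
  have h2 := congrArg Complex.re e22
  have h3 := congrArg Complex.re e32
  have h4 := congrArg Complex.im e32
  have h5 := congrArg Complex.re e33
  simp [map_ofNat] at h1 h2 h3 h4 h5
  have hγ : n * γ = 2 * y₁ := mul_left_cancel₀ hε0 (by linear_combination h1)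
  refine ⟨?_, ?_, ?_, ?_⟩
  · linear_combination h2 - r22 * hγ
  · linear_combination h3 - a₁ * hγ
  · linear_combination h4 - a₂ * hγ
  · linear_combination h5 - (r33 - (n - 1) * (n - 2) / 6 * ε + ε) * hγ

/-- Besides `ε z z̄`, `p` has no terms of degree at most one in `z` or in `z̄`. So `p²` begins with
`z² z̄²`, and its `z³ z̄³` term is the cross term with `φ₂₂`. -/
theorem coeff₃_one_add_sq {p : MvPowerSeries (Fin 3) ℂ} {ε : ℂ} (hε : ε * ε = 1)
    (h0 : ∀ a, coeff₃ a 0 0 p = 0) (h0' : ∀ b, coeff₃ 0 b 0 p = 0) (h11 : coeff₃ 1 1 0 p = ε)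
    (h1 : ∀ a, coeff₃ (a + 2) 1 0 p = 0) (h1' : ∀ b, coeff₃ 1 (b + 2) 0 p = 0) :
    (∀ a, coeff₃ a 0 0 (1 + p * p) = if a = 0 then 1 else 0) ∧
    (∀ b, coeff₃ 0 b 0 (1 + p * p) = if b = 0 then 1 else 0) ∧
    coeff₃ 1 1 0 (1 + p * p) = 0 ∧ coeff₃ 2 1 0 (1 + p * p) = 0 ∧
    coeff₃ 3 1 0 (1 + p * p) = 0 ∧ coeff₃ 1 2 0 (1 + p * p) = 0 ∧
    coeff₃ 1 3 0 (1 + p * p) = 0 ∧ coeff₃ 2 2 0 (1 + p * p) = 1 ∧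
    coeff₃ 3 2 0 (1 + p * p) = 0 ∧ coeff₃ 2 3 0 (1 + p * p) = 0 ∧
    coeff₃ 3 3 0 (1 + p * p) = 2 * ε * coeff₃ 2 2 0 p := by
  have h21 := h1 0
  have h31 := h1 1
  have h12 := h1' 0
  have h13 := h1' 1
  simp only [zero_add, Nat.reduceAdd] at h21 h31 h12 h13
  refine ⟨fun a => ?_, fun b => ?_, ?_, ?_, ?_, ?_, ?_, ?_, ?_, ?_, ?_⟩
  · rw [coeff₃_add, coeff₃_one, coeff₃_mul]
    simp [h0]
  · rw [coeff₃_add, coeff₃_one, coeff₃_mul]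
    simp [h0']
  all_goals
    rw [coeff₃_add, coeff₃_one, coeff₃_mul]
    simp only [Finset.Nat.sum_antidiagonal_eq_sum_range_succ_mk, Finset.sum_range_succ,
      Finset.sum_range_zero, Nat.succ_eq_add_one, Nat.reduceAdd, Nat.reduceSub, zero_add,
      Nat.sub_self, tsub_zero, h0, h0', h11, h21, h31, h12, h13]
    simp
  · exact hε
  · ring

/-- The hypothesis `hdet` is the injectivity of `B` at `k = n + 1`, written out in rows. The terms
without `z̄` show that `g(z, 0) = γ + 2 i ε f̄₀ z` with `γ` real. Five further coefficients give the
system for `f₀` and `f₁`. When these vanish, so does `g(z, 0)`, and the `z̄`-linear terms reduce to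
`ε f(z, 0) = 0`. -/
theorem X1_dvd_of_linearized {p : MvPowerSeries (Fin 3) ℂ} {ε : ℝ} (hε : ε * ε = 1)
    (hp : conj p = p) (h0 : ∀ a, coeff₃ a 0 0 p = 0) (h11 : coeff₃ 1 1 0 p = ε)
    (h1 : ∀ a, coeff₃ (a + 2) 1 0 p = 0) {n : ℕ} (hn : n ≠ 0) {f g : MvPowerSeries (Fin 2) ℂ}
    (hdet : ∀ x₁ x₂ y₁ y₂ : ℝ,
      -6 * (coeff₃ 3 2 0 p).re * x₁ + 6 * (coeff₃ 3 2 0 p).im * x₂ -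
        2 * (coeff₃ 2 2 0 p).re * y₁ + 2 * n * y₂ = 0 →
      (ε * (2 * n ^ 2 + 1 + 4 * (coeff₃ 2 2 0 p).re ^ 2) - 3 * (coeff₃ 3 3 0 p).re -
          4 * (coeff₃ 4 2 0 p).re) * x₁ +
        (2 * ε * n * (coeff₃ 2 2 0 p).re + 4 * (coeff₃ 4 2 0 p).im) * x₂ -
        3 * (coeff₃ 3 2 0 p).re * y₁ + (coeff₃ 3 2 0 p).im * y₂ = 0 →
      (2 * ε * n * (coeff₃ 2 2 0 p).re - 4 * (coeff₃ 4 2 0 p).im) * x₁ -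
        (ε * (2 * n ^ 2 + 1 + 4 * (coeff₃ 2 2 0 p).re ^ 2) - 3 * (coeff₃ 3 3 0 p).re +
          4 * (coeff₃ 4 2 0 p).re) * x₂ -
        3 * (coeff₃ 3 2 0 p).im * y₁ - (coeff₃ 3 2 0 p).re * y₂ = 0 →
      (ε * (8 * (coeff₃ 2 2 0 p).re * (coeff₃ 3 2 0 p).re + 2 * n * (coeff₃ 3 2 0 p).im) -
          8 * (coeff₃ 4 3 0 p).re) * x₁ +
        (ε * (-8 * (coeff₃ 2 2 0 p).re * (coeff₃ 3 2 0 p).im + 2 * n * (coeff₃ 3 2 0 p).re) +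
          8 * (coeff₃ 4 3 0 p).im) * x₂ +
        (2 / 3 * ε * (n ^ 2 + 2) - 4 * (coeff₃ 3 3 0 p).re) * y₁ +
        6 * ε * n * (coeff₃ 2 2 0 p).re * y₂ = 0 →
      x₁ = 0 ∧ x₂ = 0 ∧ y₁ = 0 ∧ y₂ = 0)
    (h : X 2 ∣ (1 + p * p) * imPart ((1 + C Complex.I * p) ^ n * restrict (X 2 * p) g) -
      (pderiv ℂ 0 p * ((1 + C Complex.I * p) ^ n * restrict (X 2 * p) f) +
        conj (pderiv ℂ 0 p * ((1 + C Complex.I * p) ^ n * restrict (X 2 * p) f)))) :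
    X 1 ∣ f ∧ X 1 ∣ g := by
  have hps : ∀ a b, starRingEnd ℂ (coeff₃ a b 0 p) = coeff₃ b a 0 p :=
    fun a b => conj_coeff₃_of_hermitian hp a b 0
  have h0' : ∀ b, coeff₃ 0 b 0 p = 0 := fun b => by rw [← hps, h0, map_zero]
  have h1' : ∀ b, coeff₃ 1 (b + 2) 0 p = 0 := fun b => by rw [← hps, h1, map_zero]
  have hεC : (ε : ℂ) * ε = 1 := by exact_mod_cast hε
  have hε0 : (ε : ℂ) ≠ 0 := left_ne_zero_of_mul_eq_one hεC
  have hnC : (n : ℂ) ≠ 0 := by exact_mod_cast hn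
  obtain ⟨i0, i0', i11, i21, i31, i12, i13, i22, i32, i23, i33⟩ :=
    coeff₃_one_add_pow hεC h0 h0' h11 h1 h1' n
  obtain ⟨q0, q0', q11, q21, q31, q12, q13, q22, q32, q23, q33⟩ :=
    coeff₃_one_add_sq hεC h0 h0' h11 h1 h1'
  have h21 := h1 0
  have h31 := h1 1
  have h12 := h1' 0
  have h13 := h1' 1
  have h41 := h1 2
  simp only [zero_add, Nat.reduceAdd] at h21 h31 h12 h13 h41
  obtain ⟨r22, hr22⟩ : ∃ r : ℝ, coeff₃ 2 2 0 p = r :=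
    ⟨_, (Complex.conj_eq_iff_re.mp (hps 2 2)).symm⟩
  obtain ⟨r33, hr33⟩ : ∃ r : ℝ, coeff₃ 3 3 0 p = r :=
    ⟨_, (Complex.conj_eq_iff_re.mp (hps 3 3)).symm⟩
  have hA := coeff₃_mul_restrict p ((1 + C Complex.I * p) ^ n) f
  have hV := coeff₃_mul_restrict p ((1 + C Complex.I * p) ^ n) g
  generalize (1 + C Complex.I * p) ^ n * restrict (X 2 * p) f = A at *
  generalize (1 + C Complex.I * p) ^ n * restrict (X 2 * p) g = V at *
  generalize (1 + C Complex.I * p) ^ n = W at *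
  have hE : ∀ a b, coeff₃ a b 0 ((1 + p * p) * imPart V) =
      coeff₃ a b 0 (pderiv ℂ 0 p * A) + starRingEnd ℂ (coeff₃ b a 0 (pderiv ℂ 0 p * A)) := by
    intro a b
    have := X2_dvd_iff.mp h a b
    rw [coeff₃_sub, coeff₃_add, coeff₃_conj] at this
    exact sub_eq_zero.mp this
  have hsum : ∀ (F : ℕ × ℕ → ℂ), (∑ x ∈ Finset.HasAntidiagonal.antidiagonal 0, F x = F (0, 0)) ∧
      (∑ x ∈ Finset.HasAntidiagonal.antidiagonal 1, F x = F (0, 1) + F (1, 0)) ∧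
      (∑ x ∈ Finset.HasAntidiagonal.antidiagonal 2, F x = F (0, 2) + F (1, 1) + F (2, 0)) ∧
      (∑ x ∈ Finset.HasAntidiagonal.antidiagonal 3, F x =
        F (0, 3) + F (1, 2) + F (2, 1) + F (3, 0)) := by
    intro F
    simp [Finset.Nat.sum_antidiagonal_eq_sum_range_succ_mk, Finset.sum_range_succ]
  have hside : ∀ (c : ℕ → ℂ) (F : ℕ × ℕ → ℂ) (a : ℕ), (∀ i, c i = if i = 0 then 1 else 0) →
      ∑ x ∈ Finset.HasAntidiagonal.antidiagonal a, c x.1 * F x = F (0, a) := by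
    intro c F a hc
    rw [Finset.sum_eq_single (0, a)]
    · rw [hc, if_pos rfl, one_mul]
    · intro x hx hxa
      rw [hc, if_neg, zero_mul]
      rintro h
      rw [Finset.HasAntidiagonal.mem_antidiagonal] at hx
      exact hxa (Prod.ext h (by omega))
    · simp
  have A0 : ∀ b, coeff₃ 0 b 0 A = if b = 0 then coeff (expo₂ 0 0) f else 0 := by
    intro b
    simp [hA, i0']
  have A0' : ∀ a, coeff₃ a 0 0 A = coeff (expo₂ a 0) f := fun a => by
    rw [hA, hside (fun i => coeff₃ i 0 0 W) (fun x => coeff (expo₂ x.2 0) f) a i0]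
  have V0 : ∀ b, coeff₃ 0 b 0 V = if b = 0 then coeff (expo₂ 0 0) g else 0 := by
    intro b
    simp [hV, i0']
  have V0' : ∀ a, coeff₃ a 0 0 V = coeff (expo₂ a 0) g := fun a => by
    rw [hV, hside (fun i => coeff₃ i 0 0 W) (fun x => coeff (expo₂ x.2 0) g) a i0]
  -- the terms without `z̄`
  have hZ0 : ∀ a, coeff₃ a 0 0 (pderiv ℂ 0 p * A) = 0 := by
    intro a
    rw [coeff₃_mul]
    simp [coeff₃_pderiv_zero, h0]
  have hZ0' : ∀ b, coeff₃ 0 b 0 (pderiv ℂ 0 p * A) =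
      if b = 1 then ε * coeff (expo₂ 0 0) f else 0 := by
    intro b
    rw [coeff₃_mul, Finset.Nat.antidiagonal_zero, Finset.sum_singleton, Finset.sum_eq_single (b, 0)]
    · rw [coeff₃_pderiv_zero, A0, if_pos rfl]
      split_ifs with hb
      · rw [hb, zero_add, h11]
        simp
      · rcases b with _ | _ | b
        · simp [h0]
        · simp at hb
        · simp [h1']
    · intro y hy hyb
      rw [A0, if_neg, mul_zero]
      rintro h
      rw [Finset.HasAntidiagonal.mem_antidiagonal] at hy
      exact hyb (Prod.ext (by omega) h)
    · simp
  -- Coefficients of `z ^ a`: on the right only the conjugate term survives, and only for `a = 1`,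
  -- where it comes from `ε z̄` in `p_z`.
  have ea : ∀ a, 1 / (2 * Complex.I) * (coeff (expo₂ a 0) g -
      if a = 0 then starRingEnd ℂ (coeff (expo₂ 0 0) g) else 0) =
        if a = 1 then ε * starRingEnd ℂ (coeff (expo₂ 0 0) f) else 0 := by
    intro a
    have e := hE a 0
    rw [hZ0, hZ0', coeff₃_mul] at e
    simp only [(hsum _).1] at e
    rw [hside (fun i => coeff₃ i 0 0 (1 + p * p)) (fun x => coeff₃ x.2 0 0 (imPart V)) a q0,
      coeff₃_imPart, V0, V0'] at e
    rw [apply_ite (starRingEnd ℂ), map_zero, apply_ite (starRingEnd ℂ), map_zero, map_mul,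
      Complex.conj_ofReal, zero_add] at e
    exact e
  obtain ⟨γ, hγ⟩ : ∃ γ : ℝ, coeff (expo₂ 0 0) g = γ := by
    have e := ea 0
    rw [if_pos rfl, if_neg zero_ne_one] at e
    exact ⟨_, (Complex.conj_eq_iff_re.mp
      (sub_eq_zero.mp ((mul_eq_zero.mp e).resolve_left (by simp))).symm).symm⟩
  have hg1 : coeff (expo₂ 1 0) g = 2 * Complex.I * ε * starRingEnd ℂ (coeff (expo₂ 0 0) f) := by
    have e := ea 1
    rw [if_neg one_ne_zero, if_pos rfl, sub_zero] at e
    field_simp at e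
    linear_combination e
  have hga : ∀ a, coeff (expo₂ (a + 2) 0) g = 0 := by
    intro a
    have e := ea (a + 2)
    rw [if_neg (by omega), if_neg (by omega), sub_zero] at e
    exact (mul_eq_zero.mp e).resolve_left (by simp)
  have hg2 := hga 0
  have hg3 := hga 1
  simp only [zero_add, Nat.reduceAdd] at hg2 hg3
  -- the terms that determine the lowest order coefficients
  have e11 := hE 1 1
  have e21 := hE 2 1
  have e22 := hE 2 2
  have e32 := hE 3 2
  have e33 := hE 3 3
  simp only [coeff₃_mul, (hsum _).2.1, (hsum _).2.2.1, (hsum _).2.2.2, q0, q0', q11, q21, q31, q12,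
    q13, q22, q32, q23, q33, coeff₃_imPart, h0, h11, h21, h31, h12, h13, h41, coeff₃_pderiv_zero,
    zero_add, Nat.reduceAdd, hA, hV, i0, i0', i11, i21, i31, i12, i13, i22, i32,
    i23, i33, hγ, hg1, hg2, hg3, hr22, hr33]
    at e11 e21 e22 e32 e33
  simp [hps, map_ofNat, hγ, i0'] at e11 e21 e22 e32 e33
  rw [hr22, hr33] at hdet
  simp only [Complex.ofReal_re] at hdet
  have hI := Complex.I_mul_I
  have rows := resonance_rows (n := n) (r22 := r22) (r33 := r33) (γ := γ) hε
    (a := coeff₃ 3 2 0 p) (b := coeff₃ 4 2 0 p) (c := coeff₃ 4 3 0 p)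
    (f₀ := coeff (expo₂ 0 0) f) (f₁ := coeff (expo₂ 1 0) f) (f₂ := coeff (expo₂ 2 0) f)
    (by
      push_cast
      linear_combination e11 + (n * ε * γ) * hI)
    (by
      push_cast
      linear_combination -e21 - n * starRingEnd ℂ (coeff (expo₂ 0 0) f) * Complex.I * ε * ε * hI +
        2 * n * starRingEnd ℂ (coeff (expo₂ 0 0) f) * Complex.I * hεC)
    (by
      push_cast
      simp only [map_add, map_mul, Complex.conj_ofReal, Complex.conj_I, map_natCast, map_ofNat, hps]
      linear_combination e22 + n * r22 * γ * hI + n * Complex.I * (coeff (expo₂ 1 0) f -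
        starRingEnd ℂ (coeff (expo₂ 1 0) f)) * hεC)
    (by
      push_cast
      simp only [map_add, map_mul, map_sub, map_div₀, map_one, Complex.conj_ofReal, Complex.conj_I,
        map_natCast, map_ofNat, hps]
      linear_combination e32 + n * Complex.I * coeff (expo₂ 2 0) f * hεC +
        ((n * Complex.I * r22 - n * (n - 1) / 2) * ε * starRingEnd ℂ (coeff (expo₂ 0 0) f) +
          n * coeff₃ 3 2 0 p * γ + ε * starRingEnd ℂ (coeff (expo₂ 0 0) f)) * hI)
    (by
      push_cast
      simp only [map_add, map_mul, map_sub, map_div₀, map_one, Complex.conj_ofReal, Complex.conj_I,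
        map_natCast, map_ofNat, hps]
      linear_combination e33 + (Complex.I * n * ε * (coeff₃ 2 3 0 p *
        starRingEnd ℂ (coeff (expo₂ 0 0) f) - coeff₃ 3 2 0 p * coeff (expo₂ 0 0) f) +
          (n * r33 - n * (n - 1) * (n - 2) / 6 * ε) * γ + n * ε * γ) * hI)
  obtain ⟨hx₁, hx₂, hy₁, hy₂⟩ := hdet _ _ _ _ rows.1 rows.2.1 rows.2.2.1 rows.2.2.2
  have hf0 : coeff (expo₂ 0 0) f = 0 := Complex.ext hx₁ hx₂
  have hf1 : coeff (expo₂ 1 0) f = 0 := Complex.ext hy₁ hy₂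
  have hg0 : coeff (expo₂ 0 0) g = 0 := by
    have e : (n * ε : ℂ) * γ = 0 := by
      rw [hf1, map_zero] at e11
      linear_combination e11 + (n * ε * γ) * hI
    rw [hγ, (mul_eq_zero.mp e).resolve_left (mul_ne_zero hnC hε0)]
  have hg : ∀ a, coeff (expo₂ a 0) g = 0 := by
    rintro (_ | _ | a)
    · exact hg0
    · rw [zero_add, hg1, hf0, map_zero, mul_zero]
    · exact hga a
  refine ⟨X1_dvd_iff₂.mpr fun a => ?_, X1_dvd_iff₂.mpr hg⟩
  have hV0 : ∀ a b, coeff₃ a b 0 V = 0 := fun a b => by simp [hV, hg]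
  have e := hE a 1
  have hL : coeff₃ a 1 0 ((1 + p * p) * imPart V) = 0 := by
    simp [coeff₃_mul, coeff₃_imPart, hV0]
  -- Degree one in `z` involves only `f₀` and `f₁`, which are already zero. So the conjugate term
  -- drops out of the coefficient of `z ^ a * z̄`.
  have hR : coeff₃ 1 a 0 (pderiv ℂ 0 p * A) = 0 := by
    rw [coeff₃_mul]
    refine Finset.sum_eq_zero fun x hx => Finset.sum_eq_zero fun y _ => ?_
    rw [Finset.HasAntidiagonal.mem_antidiagonal] at hx
    have hx2 : x.2 = 0 ∨ x.2 = 1 := by omega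
    rcases hx2 with h | h <;>
      simp [hA, h, Finset.Nat.antidiagonal_succ, hf0, hf1]
  have hM : coeff₃ a 1 0 (pderiv ℂ 0 p * A) = ε * coeff (expo₂ a 0) f := by
    rw [coeff₃_mul]
    simp only [(hsum _).2.1, coeff₃_pderiv_zero, h0, mul_zero, zero_mul, zero_add, A0']
    rw [Finset.sum_eq_single (0, a)]
    · simp [h11]
    · intro x hx hxa
      rw [Finset.HasAntidiagonal.mem_antidiagonal] at hx
      obtain ⟨m, hm⟩ : ∃ m, x.1 = m + 1 := Nat.exists_eq_succ_of_ne_zero fun h =>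
        hxa (Prod.ext h (by simp only; omega))
      rw [hm, h1]
      ring
    · simp
  rw [hL, hR, hM, map_zero, add_zero] at e
  exact (mul_eq_zero.mp e.symm).resolve_left hε0

end Equations

/-! ### Uniqueness of automorphisms -/

section Uniqueness

theorem resonance_injective {φ : MvPowerSeries (Fin 3) ℂ} {k : ℝ}
    (hk : (resonanceMatrix φ).det.eval k ≠ 0) {v : Fin 4 → ℝ}
    (hv : ((resonanceMatrix φ).map (Polynomial.eval k)).mulVec v = 0) : v = 0 := by
  refine Matrix.eq_zero_of_mulVec_eq_zero ?_ hv
  rw [← Polynomial.coe_evalRingHom] at hk ⊢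
  rw [RingHom.map_det] at hk
  exact hk

/-- Order `n` corresponds to `k = n + 1 ≥ 2`. The characteristic polynomial is a multiple of `det
B`, so a zero of the determinant is a root of it whatever the constant is. -/
theorem IsNonresonant.det_ne_zero {φ φ' : MvPowerSeries (Fin 3) ℂ} (h : IsNonresonant φ)
    {H : FormalMap} (hH : IsCoordinateChange H φ φ') (hp : IsPrenormalized φ') {n : ℕ}
    (hn : 1 ≤ n) : (resonanceMatrix φ').det.eval (n + 1 : ℝ) ≠ 0 := by
  intro h0
  refine h (n + 1) ⟨by omega, H, φ', hH, hp, ?_⟩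
  rw [characteristicPolynomial, Polynomial.IsRoot, Polynomial.eval_mul]
  push_cast
  rw [h0, mul_zero]

/-- The two divisibilities start the induction on the order of contact with the identity when `l = m
= 1`. -/
theorem IsPrenormalized.jacobian {φ : MvPowerSeries (Fin 3) ℂ} (hφ : IsHypersurface φ)
    (hp : IsPrenormalized φ) {Φ : FormalMap} (hΦ : Φ ∈ Aut₀ φ) :
    ∃ (l : Circle) (m : ℝˣ), Φ.jacobian 0 0 = l ∧ Φ.jacobian 1 1 = ((m : ℝ) : ℂ) ∧
      Φ.jacobian 1 0 = 0 ∧ X 1 ∣ Φ.F - C (l : ℂ) * X 0 ∧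
      X 1 ^ 2 ∣ Φ.G - C ((m : ℝ) : ℂ) * X 1 := by
  obtain ⟨l, m, hl, hm, hF, g, hG, hg⟩ := hp.linear_part hφ hΦ
  have hX0 : ∀ a, coeff (expo₂ a 0) (X 0 : MvPowerSeries (Fin 2) ℂ) = if a = 1 then 1 else 0 := by
    intro a
    have e : expo₂ a 0 = Finsupp.single 0 a := by simp [expo₂]
    rw [coeff_X, e]
    simp [(Finsupp.single_injective (0 : Fin 2)).eq_iff]
  refine ⟨⟨l, ?_⟩, Units.mk0 m hm, ?_, ?_, ?_, ?_, ?_⟩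
  · refine mem_sphere_zero_iff_norm.mpr ?_
    rw [Complex.mul_conj, Complex.normSq_eq_norm_sq] at hl
    exact (pow_eq_one_iff_of_nonneg (norm_nonneg l) two_ne_zero).mp (by exact_mod_cast hl)
  · change coeff (Finsupp.single 0 1) Φ.F = l
    simpa [expo₂] using hF 1
  · change coeff (Finsupp.single 1 1) Φ.G = m
    have h := coeff_add_monomial_mul (Finsupp.single 1 1) 0 g (1 : ℂ)
    rw [add_zero, one_mul, ← X_def, ← hG] at h
    rw [h]
    simpa [expo₂] using hg 0
  · change coeff (Finsupp.single 0 1) Φ.G = 0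
    rw [hG, X, coeff_monomial_mul, if_neg]
    intro h
    simpa using h 1
  · refine X1_dvd_iff₂.mpr fun a => ?_
    rw [map_sub, coeff_C_mul, hF, hX0]
    simp
  · have h : X 1 ∣ g - C (m : ℂ) := by
      refine X1_dvd_iff₂.mpr fun a => ?_
      have e : expo₂ a 0 = Finsupp.single 0 a := by simp [expo₂]
      rw [map_sub, hg, coeff_C, e]
      simp
    obtain ⟨t, ht⟩ := h
    refine ⟨t, ?_⟩
    rw [hG, Units.val_mk0]
    linear_combination X 1 * ht

theorem eq_of_forall_X1_pow_dvd {f g : MvPowerSeries (Fin 2) ℂ}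
    (h : ∀ n, 1 ≤ n → X 1 ^ n ∣ f - g) : f = g := by
  refine sub_eq_zero.mp (MvPowerSeries.ext fun d => ?_)
  exact X_pow_dvd_iff.mp (h (d 1 + 1) (by omega)) d (Nat.lt_succ_self _)

/-- A prenormalized nonresonant hypersurface has no automorphisms tangent to the identity. -/
theorem IsPrenormalized.eq_id {φ : MvPowerSeries (Fin 3) ℂ} (hφ : IsHypersurface φ)
    (hp : IsPrenormalized φ)
    (hk : ∀ n : ℕ, 1 ≤ n → (resonanceMatrix φ).det.eval (n + 1 : ℝ) ≠ 0) {Φ : FormalMap}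
    (hΦ : Φ ∈ Aut₀ φ) (h0 : Φ.jacobian 0 0 = 1) (h1 : Φ.jacobian 1 1 = 1) :
    Φ = FormalMap.id := by
  obtain ⟨l, m, hl, hm, -, hF, hG⟩ := hp.jacobian hφ hΦ
  rw [← hl, h0, map_one, one_mul] at hF
  rw [← hm, h1, map_one, one_mul] at hG
  obtain ⟨p, hφp, hpc, hp1, hpφ⟩ := hp.exists_eq_X2_mul hφ
  obtain ⟨ε, hε, hε1⟩ : ∃ ε : ℝ, coeff₃ 1 1 1 φ = ε ∧ ε * ε = 1 := by
    rcases hp.levi with h | h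
    · exact ⟨1, by simpa using h, by norm_num⟩
    · exact ⟨-1, by simpa using h, by norm_num⟩
  have key : ∀ n, 1 ≤ n → X 1 ^ n ∣ Φ.F - X 0 ∧ X 1 ^ (n + 1) ∣ Φ.G - X 1 := by
    intro n hn
    induction n, hn using Nat.le_induction with
    | base => exact ⟨by rwa [pow_one], hG⟩
    | succ n hn ih =>
      obtain ⟨⟨f, hf⟩, ⟨g, hg⟩⟩ := ih
      have hlin := Sends.linearized hφ hφp hpc hΦ.2 hn (f := f) (g := g)
        (by rw [← hf]; ring) (by rw [← hg]; ring)
      rw [hφp] at hlin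
      obtain ⟨h2, h3⟩ := X1_dvd_of_linearized hε1 hpc (fun a => X1_dvd_iff.mp hp1 a 0)
        (by rw [hpφ, hε]) (fun a => by rw [hpφ, hp.first _ (by omega)]) (by omega) (by
        intro x₁ x₂ y₁ y₂ r₁ r₂ r₃ r₄
        simp only [hpφ] at r₁ r₂ r₃ r₄
        -- With `k = n + 1` one has `2k² - 4k + 3 = 2n² + 1` and `k² - 2k + 3 = n² + 2`, which
        -- matches the rows with those of `resonanceMatrix`.
        have hv := resonance_injective (hk n hn) (v := ![x₁, x₂, y₁, y₂]) (by
          funext i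
          fin_cases i
          · simp [resonanceMatrix, Matrix.mulVec, dotProduct, Fin.sum_univ_four, hε]
            linear_combination r₁
          · simp [resonanceMatrix, Matrix.mulVec, dotProduct, Fin.sum_univ_four, hε]
            linear_combination r₂
          · simp [resonanceMatrix, Matrix.mulVec, dotProduct, Fin.sum_univ_four, hε]
            linear_combination r₃
          · simp [resonanceMatrix, Matrix.mulVec, dotProduct, Fin.sum_univ_four, hε]
            linear_combination r₄)
        exact ⟨congrFun hv 0, congrFun hv 1, congrFun hv 2, congrFun hv 3⟩) hlin
      exact ⟨by rw [hf, pow_succ]; exact mul_dvd_mul_left _ h2,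
        by rw [hg, pow_succ _ (n + 1)]; exact mul_dvd_mul_left _ h3⟩
  ext1
  · exact eq_of_forall_X1_pow_dvd fun n hn => (key n hn).1
  · exact eq_of_forall_X1_pow_dvd fun n hn => (pow_dvd_pow _ n.le_succ).trans (key n hn).2

end Uniqueness

/-! ### The stability group -/

section StabilityGroup

theorem id_mem_aut {φ : MvPowerSeries (Fin 3) ℂ} (hφ : IsHypersurface φ) :
    FormalMap.id ∈ Aut₀ φ :=
  ⟨invertible_id, Sends.id hφ⟩

theorem comp_mem_aut {φ : MvPowerSeries (Fin 3) ℂ} (hφ : IsHypersurface φ) {Φ Ψ : FormalMap}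
    (hΦ : Φ ∈ Aut₀ φ) (hΨ : Ψ ∈ Aut₀ φ) : Φ.comp Ψ ∈ Aut₀ φ :=
  ⟨FormalMap.Invertible.comp hΦ.1 hΨ.1, hΨ.2.comp hΦ.2 hφ.zero hφ.zero⟩

theorem exists_inverse_mem_aut {φ : MvPowerSeries (Fin 3) ℂ} (hφ : IsHypersurface φ)
    {Φ : FormalMap} (hΦ : Φ ∈ Aut₀ φ) :
    ∃ Ψ ∈ Aut₀ φ, Φ.comp Ψ = FormalMap.id ∧ Ψ.comp Φ = FormalMap.id := by
  obtain ⟨Ψ, h1, h2⟩ := FormalMap.Invertible.exists_inverse hΦ.1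
  exact ⟨Ψ, ⟨invertible_of_comp_eq_id h2, hΦ.2.inverse hφ hφ.zero h2⟩, h1, h2⟩

theorem conjugate_mem_aut {φ φ' : MvPowerSeries (Fin 3) ℂ} (hφ : IsHypersurface φ)
    {H K : FormalMap} (hH : IsCoordinateChange H φ φ') (h2 : K.comp H = FormalMap.id)
    {Φ : FormalMap} (hΦ : Φ ∈ Aut₀ φ) : H.comp (Φ.comp K) ∈ Aut₀ φ' := by
  have hK := hH.2.2.inverse hφ hH.2.1.zero h2
  exact ⟨FormalMap.Invertible.comp hH.1 (FormalMap.Invertible.comp hΦ.1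
    (invertible_of_comp_eq_id h2)),
    (hK.comp hΦ.2 hH.2.1.zero hφ.zero).comp hH.2.2 hH.2.1.zero hφ.zero⟩

theorem IsPrenormalized.isTangential {φ : MvPowerSeries (Fin 3) ℂ} (hp : IsPrenormalized φ) :
    IsTangential φ :=
  ⟨hp.infinite_type 1 0, hp.infinite_type 0 1, hp.left 0 1⟩

/-- Both complex tangent lines at the origin are `w = 0`. To first order the right side of `Im G =
φ'` vanishes, while the coefficient of `z` on the left is `G_z(0) / (2i)`. -/
theorem Sends.jacobian_one_zero {φ φ' : MvPowerSeries (Fin 3) ℂ} (hφ : IsHypersurface φ)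
    (ht : IsTangential φ) (ht' : IsTangential φ') {Φ : FormalMap} (hs : Φ.Sends φ φ') :
    Φ.jacobian 1 0 = 0 := by
  change coeff (Finsupp.single 0 1) Φ.G = 0
  have e := congrArg (coeff₃ 1 0 0) (sends_iff.mp hs)
  have hr : coeff₃ 1 0 0 (subst (graphMap φ Φ) φ') = 0 := by
    rw [← (coeff_single_eq _).1, coeff_subst_of_degree_eq_one (graphMap_const hφ.zero Φ) _
      (Finsupp.degree_single _ _), Fin.sum_univ_three, (coeff_single_eq φ').1,
      (coeff_single_eq φ').2.1, (coeff_single_eq φ').2.2, ht'.1, ht'.2.1, ht'.2.2]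
    ring
  have hX2 : ∀ a b, coeff₃ a b 0 (X 2) = 0 := X2_dvd_iff.mp dvd_rfl
  have h10 : coeff₃ 1 0 0 (restrict φ Φ.G) = coeff (Finsupp.single 0 1) Φ.G := by
    rw [← (coeff_single_eq _).1, coeff_restrict_of_degree_one hφ.zero, (coeff_single_eq _).1,
      (coeff_single_eq _).1, coeff₃_add, coeff₃_C_mul, ht.1, coeff₃_X0, hX2]
    simp
  have h01 : coeff₃ 0 1 0 (restrict φ Φ.G) = 0 := by
    rw [← (coeff_single_eq _).2.1, coeff_restrict_of_degree_one hφ.zero, (coeff_single_eq _).2.1,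
      (coeff_single_eq _).2.1, coeff₃_add, coeff₃_C_mul, ht.2.1, coeff₃_X0, hX2]
    simp
  rw [hr, coeff₃_imPart, h10, h01, map_zero, sub_zero] at e
  exact (mul_eq_zero.mp e).resolve_left (by simp)

theorem jacobian_comp_diag {Φ Ψ : FormalMap} (hΦ : Φ.jacobian 1 0 = 0)
    (hΨ : Ψ.jacobian 1 0 = 0) :
    (Φ.comp Ψ).jacobian 0 0 = Φ.jacobian 0 0 * Ψ.jacobian 0 0 ∧
      (Φ.comp Ψ).jacobian 1 1 = Φ.jacobian 1 1 * Ψ.jacobian 1 1 := by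
  rw [jacobian_comp]
  simp [Matrix.mul_apply, Fin.sum_univ_two, hΦ, hΨ]

theorem jacobian_diag_ne_zero {Φ : FormalMap} (hi : Φ.Invertible) (hΦ : Φ.jacobian 1 0 = 0) :
    Φ.jacobian 0 0 ≠ 0 ∧ Φ.jacobian 1 1 ≠ 0 := by
  rw [FormalMap.Invertible, Matrix.det_fin_two, hΦ, mul_zero, sub_zero] at hi
  exact mul_ne_zero_iff.mp hi

theorem conjugate_comp {H K Φ Ψ : FormalMap} (h2 : K.comp H = FormalMap.id) :
    (H.comp (Φ.comp K)).comp (H.comp (Ψ.comp K)) = H.comp ((Φ.comp Ψ).comp K) := by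
  rw [comp_assoc, comp_assoc, ← comp_assoc K, h2, id_comp, ← comp_assoc Φ]

end StabilityGroup

end FormalCR

/-! ### The embedding of the stability group -/

open FormalCR FormalCR.FormalMap

theorem corollary1p2 (φ : MvPowerSeries (Fin 3) ℂ)
    (hφ : FormalCR.IsHypersurface φ)
    (h₁ : FormalCR.IsInfiniteType φ)
    (h₂ : FormalCR.LeviVanishesToFirstOrder φ)
    (h₃ : FormalCR.IsNonresonant φ) :
    -- the stability group is a group under composition
    FormalCR.FormalMap.id ∈ FormalCR.Aut₀ φ ∧
    (∀ Φ ∈ FormalCR.Aut₀ φ, ∀ Ψ ∈ FormalCR.Aut₀ φ, Φ.comp Ψ ∈ FormalCR.Aut₀ φ) ∧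
    (∀ Φ ∈ FormalCR.Aut₀ φ, ∃ Ψ ∈ FormalCR.Aut₀ φ,
      Φ.comp Ψ = FormalCR.FormalMap.id ∧ Ψ.comp Φ = FormalCR.FormalMap.id) ∧
    -- coordinates with `dφ'(0) = 0` exist
    (∃ (H : FormalCR.FormalMap) (φ' : MvPowerSeries (Fin 3) ℂ),
      FormalCR.IsCoordinateChange H φ φ' ∧ FormalCR.IsTangential φ') ∧
    -- the embedding into `S¹ × ℝ*`, which is `(F, G) ↦ (F_z(0), G_w(0))` in all such coordinates
    (∃ ρ : FormalCR.Aut₀ φ → Circle × ℝˣ,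
      Function.Injective ρ ∧
      (∀ Φ Ψ Θ : FormalCR.Aut₀ φ, Θ.1 = Φ.1.comp Ψ.1 → ρ Θ = ρ Φ * ρ Ψ) ∧
      (∀ (H : FormalCR.FormalMap) (φ' : MvPowerSeries (Fin 3) ℂ),
        FormalCR.IsCoordinateChange H φ φ' → FormalCR.IsTangential φ' →
        ∀ Φ : FormalCR.Aut₀ φ, ∃ Φ' ∈ FormalCR.Aut₀ φ',
          Φ'.comp H = H.comp Φ.1 ∧
          Φ'.jacobian 0 0 = ((ρ Φ).1 : ℂ) ∧
          Φ'.jacobian 1 1 = (((ρ Φ).2 : ℝ) : ℂ))) ∧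
    -- automorphisms are determined by their 1-jets at `0`
    (∀ Φ ∈ FormalCR.Aut₀ φ, ∀ Ψ ∈ FormalCR.Aut₀ φ, Φ.jacobian = Ψ.jacobian → Φ = Ψ) := by
  obtain ⟨H₀, φ₀, hH₀, hp₀⟩ := exists_prenormalized hφ h₁ h₂
  obtain ⟨K₀, hHK, hKH⟩ := FormalMap.Invertible.exists_inverse hH₀.1
  have ht₀ := hp₀.isTangential
  have hmem : ∀ Φ ∈ Aut₀ φ, H₀.comp (Φ.comp K₀) ∈ Aut₀ φ₀ := fun Φ hΦ =>
    conjugate_mem_aut hφ hH₀ hKH hΦ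
  have hz : ∀ Φ ∈ Aut₀ φ, (H₀.comp (Φ.comp K₀)).jacobian 1 0 = 0 := fun Φ hΦ =>
    Sends.jacobian_one_zero hH₀.2.1 ht₀ ht₀ (hmem Φ hΦ).2
  -- Equal diagonals in the prenormalized coordinates give `Φ ∘ Ψ⁻¹` the diagonal `(1, 1)` there. By
  -- `IsPrenormalized.eq_id` its conjugate is the identity.
  have hinj : ∀ Φ ∈ Aut₀ φ, ∀ Ψ ∈ Aut₀ φ,
      (H₀.comp (Φ.comp K₀)).jacobian 0 0 = (H₀.comp (Ψ.comp K₀)).jacobian 0 0 →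
      (H₀.comp (Φ.comp K₀)).jacobian 1 1 = (H₀.comp (Ψ.comp K₀)).jacobian 1 1 → Φ = Ψ := by
    intro Φ hΦ Ψ hΨ h0 h1
    obtain ⟨Θ, hΘ, -, hΘΨ⟩ := exists_inverse_mem_aut hφ hΨ
    have hd := jacobian_comp_diag (hz _ (comp_mem_aut hφ hΦ hΘ)) (hz Ψ hΨ)
    have hne := jacobian_diag_ne_zero (hmem Ψ hΨ).1 (hz Ψ hΨ)
    rw [conjugate_comp hKH, comp_assoc Φ, hΘΨ, comp_id, h0, h1] at hd
    have hid := hp₀.eq_id hH₀.2.1 (fun n hn => h₃.det_ne_zero hH₀ hp₀ hn)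
      (hmem _ (comp_mem_aut hφ hΦ hΘ)) (right_eq_mul₀ hne.1 |>.mp hd.1)
      (right_eq_mul₀ hne.2 |>.mp hd.2)
    have e : Φ.comp Θ = FormalMap.id := by
      calc Φ.comp Θ = (K₀.comp H₀).comp ((Φ.comp Θ).comp (K₀.comp H₀)) := by
            rw [hKH, id_comp, comp_id]
        _ = K₀.comp ((H₀.comp ((Φ.comp Θ).comp K₀)).comp H₀) := by
            rw [comp_assoc, comp_assoc H₀, comp_assoc (Φ.comp Θ)]
        _ = FormalMap.id := by rw [hid, id_comp, hKH]
    calc Φ = Φ.comp (Θ.comp Ψ) := by rw [hΘΨ, comp_id]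
      _ = Ψ := by rw [← comp_assoc, e, id_comp]
  have hex : ∀ Φ : Aut₀ φ, ∃ r : Circle × ℝˣ,
      (H₀.comp (Φ.1.comp K₀)).jacobian 0 0 = (r.1 : ℂ) ∧
        (H₀.comp (Φ.1.comp K₀)).jacobian 1 1 = ((r.2 : ℝ) : ℂ) := by
    intro Φ
    obtain ⟨l, m, hl, hm, -⟩ := hp₀.jacobian hH₀.2.1 (hmem Φ.1 Φ.2)
    exact ⟨(l, m), hl, hm⟩
  -- `ρ` is the diagonal of the Jacobian in the prenormalized coordinates. Independence of the
  -- coordinates is shown below.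
  choose ρ hρ₁ hρ₂ using hex
  refine ⟨id_mem_aut hφ, fun Φ hΦ Ψ hΨ => comp_mem_aut hφ hΦ hΨ,
    fun Φ hΦ => exists_inverse_mem_aut hφ hΦ, ⟨H₀, φ₀, hH₀, ht₀⟩, ⟨ρ, ?_, ?_, ?_⟩, ?_⟩
  · intro Φ Ψ h
    exact Subtype.ext (hinj Φ.1 Φ.2 Ψ.1 Ψ.2 (by rw [hρ₁, hρ₁, h]) (by rw [hρ₂, hρ₂, h]))
  · intro Φ Ψ Θ h
    have hd := jacobian_comp_diag (hz Φ.1 Φ.2) (hz Ψ.1 Ψ.2)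
    rw [conjugate_comp hKH, ← h, hρ₁, hρ₁, hρ₁, hρ₂, hρ₂, hρ₂] at hd
    refine Prod.ext (Circle.ext ?_) (Units.ext ?_)
    · exact hd.1
    · exact_mod_cast hd.2
  · intro H φ' hH ht Φ
    obtain ⟨K, -, hKH'⟩ := FormalMap.Invertible.exists_inverse hH.1
    have hmem' := conjugate_mem_aut hφ hH hKH' Φ.2
    -- The transition `H ∘ K₀` between the two coordinate systems has an upper triangular Jacobian
    -- with nonzero diagonal entries. It intertwines the two expressions of `Φ`, so comparing
    -- diagonals in `hcomm` and cancelling shows that they agree.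
    have hL := (hH₀.2.2.inverse hφ hH₀.2.1.zero hKH).comp hH.2.2 hH₀.2.1.zero hφ.zero
    have hLz := Sends.jacobian_one_zero hH₀.2.1 ht₀ ht hL
    have hLn := jacobian_diag_ne_zero
      (FormalMap.Invertible.comp hH.1 (invertible_of_comp_eq_id hKH)) hLz
    have hz' := Sends.jacobian_one_zero hH.2.1 ht ht hmem'.2
    have hcomm : (H.comp (Φ.1.comp K)).comp (H.comp K₀) =
        (H.comp K₀).comp (H₀.comp (Φ.1.comp K₀)) := by
      rw [comp_assoc, comp_assoc Φ.1, ← comp_assoc K, hKH', id_comp, comp_assoc H K₀,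
        ← comp_assoc K₀, hKH, id_comp]
    have hd := jacobian_comp_diag hz' hLz
    have hd' := jacobian_comp_diag hLz (hz Φ.1 Φ.2)
    rw [hcomm, hd'.1, hd'.2, hρ₁, hρ₂] at hd
    refine ⟨_, hmem', by rw [comp_assoc, comp_assoc, hKH', comp_id], ?_, ?_⟩
    · exact mul_left_cancel₀ hLn.1 ((mul_comm _ _).trans hd.1.symm)
    · exact mul_left_cancel₀ hLn.2 ((mul_comm _ _).trans hd.2.symm)
  -- The given coordinates need not satisfy `dφ(0) = 0`. The full 1-jet nevertheless determines, by
  -- the chain rule, the Jacobian in the prenormalized coordinates.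
  · intro Φ hΦ Ψ hΨ h
    refine hinj Φ hΦ Ψ hΨ ?_ ?_ <;>
    rw [jacobian_comp, jacobian_comp, jacobian_comp, jacobian_comp, h]
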